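/- Let $n\ge 3$ and let $P$ be a simple polygon in the Euclidean plane with $n$ vertices, no three of which are collinear. A chord of $P$ is a segment joining two distinct non-consecutive vertices. A chord is called a diagonal (respectively an epigonal) if, apart from its end points, it lies in the interior (respectively the exterior) of $P$. Two chords are non-crossing if they have no common point except possibly a common end point. For $i\ge 0$ let $d_i$ (respectively $e_i$) be the number of sets of $i$ diagonals (respectively epigonals) of $P$ that are pairwise non-crossing; thus $d_0=e_0=1$. Put $\chi(M_d)=\sum_{i\ge 0}(-1)^i d_i$ and $\chi(M_e)=\sum_{i\ge 0}(-1)^i e_i$. Then the following hold. (A) $P$ is convex if and only if $$d_1-d_2+d_3-\cdots+(-1)^n d_{n-3}=1+(-1)^n.$$ (B) The following are equivalent: $P$ is non-convex; $$d_1-d_2+d_3-\cdots+(-1)^n d_{n-3}=1;$$ $$e_1-e_2+e_3-\cdots+(-1)^n e_{n-3}=1.$$ Moreover, $P$ is non-convex if and only if $\chi(M_d)=0$, and if and only if $\chi(M_e)=0$. -/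

import Mathlib

/-!
Polygons in the Euclidean plane, their diagonals and epigonals, and the numbers of
pairwise non-crossing sets of such chords.

A polygon with `n` vertices is Mathlib's `Polygon`: the list of its vertices in cyclic order.
The `i`-th edge joins `P i` to `P (finRotate n i)`, and `P.boundary ℝ` is the union of the edges.
-/

noncomputable section

namespace Polygon

variable {n : ℕ}

/-- The polygon is simple: it has at least three vertices and its closed boundary curve, which
runs through the half-open edges `t ↦ P.edgePath ℝ i t`, `0 ≤ t < 1`, one after the other, visits
no point twice. -/
structure IsSimple (P : Polygon (EuclideanSpace ℝ (Fin 2)) n) : Prop where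
  three_le : 3 ≤ n
  injOn : Set.InjOn (fun q : Fin n × ℝ => P.edgePath ℝ q.1 q.2) (Set.univ ×ˢ Set.Ico (0 : ℝ) 1)

/-- The vertices are in general position: no three of them are collinear. -/
def InGeneralPosition (P : Polygon (EuclideanSpace ℝ (Fin 2)) n) : Prop :=
  ∀ i j k : Fin n, i ≠ j → j ≠ k → i ≠ k → ¬ Collinear ℝ {P i, P j, P k}

/-- The interior of the polygon: the points off the boundary curve whose connected component in
the complement of the curve is bounded. -/
def inside (P : Polygon (EuclideanSpace ℝ (Fin 2)) n) : Set (EuclideanSpace ℝ (Fin 2)) :=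
  {x | x ∉ P.boundary ℝ ∧ Bornology.IsBounded (connectedComponentIn (P.boundary ℝ)ᶜ x)}

/-- The exterior of the polygon: the points off the boundary curve whose connected component in
the complement of the curve is unbounded. -/
def outside (P : Polygon (EuclideanSpace ℝ (Fin 2)) n) : Set (EuclideanSpace ℝ (Fin 2)) :=
  {x | x ∉ P.boundary ℝ ∧ ¬ Bornology.IsBounded (connectedComponentIn (P.boundary ℝ)ᶜ x)}

/-- The polygon is convex: the region it bounds (interior and boundary) is a convex set. -/
def IsConvex (P : Polygon (EuclideanSpace ℝ (Fin 2)) n) : Prop :=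
  Convex ℝ (P.inside ∪ P.boundary ℝ)

/-- The open segment between the two vertices of an unordered pair. -/
def openSeg (P : Polygon (EuclideanSpace ℝ (Fin 2)) n) (e : Sym2 (Fin n)) :
    Set (EuclideanSpace ℝ (Fin 2)) :=
  Sym2.lift ⟨fun i j => openSegment ℝ (P i) (P j), fun i j => openSegment_symm ℝ (P i) (P j)⟩ e

/-- A chord, given by its pair of end points: two distinct, non-consecutive vertices. -/
def IsChord (e : Sym2 (Fin n)) : Prop :=
  ¬ e.IsDiag ∧ ∀ i : Fin n, e ≠ s(i, finRotate n i)

/-- The set of diagonals: the chords that lie (up to their end points) in the interior. -/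
def diagonals (P : Polygon (EuclideanSpace ℝ (Fin 2)) n) : Set (Sym2 (Fin n)) :=
  {e | IsChord e ∧ P.openSeg e ⊆ P.inside}

/-- The set of epigonals: the chords that lie (up to their end points) in the exterior. -/
def epigonals (P : Polygon (EuclideanSpace ℝ (Fin 2)) n) : Set (Sym2 (Fin n)) :=
  {e | IsChord e ∧ P.openSeg e ⊆ P.outside}

/-- Pairwise non-crossing sets of segments between vertices: any two different segments have no
common point apart from a common end point. -/
def NonCrossing (P : Polygon (EuclideanSpace ℝ (Fin 2)) n) (J : Set (Sym2 (Fin n))) : Prop :=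
  J.Pairwise fun e e' => Disjoint (P.openSeg e) (P.openSeg e')

/-- `P.count M i` is the number of pairwise non-crossing sets of `i` segments from `M`. -/
def count (P : Polygon (EuclideanSpace ℝ (Fin 2)) n) (M : Set (Sym2 (Fin n))) (i : ℕ) : ℕ :=
  {J : Finset (Sym2 (Fin n)) | (J : Set (Sym2 (Fin n))) ⊆ M ∧ P.NonCrossing J ∧ J.card = i}.ncard

/-- The Euler characteristic `∑_{i ≥ 0} (-1)^i f_i` of `M`, `f_i` being the number of pairwise
non-crossing sets of `i` segments from `M`; only finitely many terms are non-zero. -/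
def eulerChar (P : Polygon (EuclideanSpace ℝ (Fin 2)) n) (M : Set (Sym2 (Fin n))) : ℤ :=
  ∑ᶠ i : ℕ, (-1 : ℤ) ^ i * (P.count M i : ℤ)

end Polygon

end

/-!
The alternating sums in question are values of `∑ (-1) ^ |J|` over the pairwise non-crossing
subsets `J` of the set of diagonals, or of epigonals (`altSum`); that a non-crossing set has at most
`n - 3` members (`IsSimple.card_le`) makes the truncated sums equal to `1 - altSum`. Such a sum
vanishes as soon as some chord of the set crosses no other one, since toggling this chord pairs off
the non-crossing sets (`altSum_eq_zero_of_isolated`).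

A non-convex polygon has an edge `v z` of the convex hull that is no edge of the polygon
(`HullEdgesAreEdges.isConvex`). It is an epigonal that crosses no segment between vertices, which
settles the epigonals.

For the diagonals, fix an extremal vertex `v` and sort the non-crossing sets by the set `S` of the
diagonals at `v` that they contain (`InGeneralPosition.altSum_diagonals`); what remains is, for each
`S`, the alternating sum over the diagonals that avoid `v` and do not cross `S`. If `S` does not
reach all vertices that are not next to `v`, then among the segments from `v` to `S` and to the
neighbours of `v` there are two, `v w` and `v w'`, adjacent in the angular order, such that `w w'`
is no edge. Turn a ray at `w` from `v` towards `w'` until it meets a vertex `y` of the triangle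
`v w w'`. No diagonal under consideration enters the part of the triangle swept out. Hence `w y` is
an isolated diagonal; or else `w y` is an edge, `y` lies in the interior of the triangle, and `v y`
is a diagonal that can be added to `S` without changing the remaining sum
(`IsCorner.isolated_or_insert`). In a non-convex polygon `S` never contains the vertex `z` of the
hull edge, so that all remaining sums vanish by induction. In a convex polygon all chords are
diagonals and no vertex lies in a triangle of other ones, so that only the full set `S` of `n - 3`
diagonals contributes; it crosses all other diagonals, and the sum is `(-1) ^ (n - 3)`.

The bound `n - 3` follows from the fact that two interior, or two exterior, chords with interlacing
end points cross (`IsSimple.not_disjoint_of_interlacing`). This rests on the Jordan curve theorem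
for polygons in the form that the interior consists of the points of odd ray parity
(`mem_inside_of_parity`, `IsSimple.parity_eq_one_of_mem_inside`), applied to the theta curve that is
formed by the polygon and one of the chords.
-/

noncomputable section

namespace Polygon

/-! ### The cross product of the plane -/

/-- The Euclidean plane. -/
abbrev Plane : Type := EuclideanSpace ℝ (Fin 2)

/-- The signed area of the parallelogram spanned by two vectors. -/
def cross (x y : Plane) : ℝ := x 0 * y 1 - x 1 * y 0

/-- Twice the signed area of the triangle `a b c`; it is positive exactly when `c` lies strictly
to the left of the line from `a` to `b`. -/
def orient (a b c : Plane) : ℝ := cross (b - a) (c - a)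

/-- The coordinate dot product of two vectors. -/
def dot (x y : Plane) : ℝ := x 0 * y 0 + x 1 * y 1

lemma plane_ext {x y : Plane} (h0 : x 0 = y 0) (h1 : x 1 = y 1) : x = y := by
  ext i; fin_cases i <;> assumption

lemma cross_add_left (x y z : Plane) : cross (x + y) z = cross x z + cross y z := by
  simp [cross]; ring
lemma cross_add_right (x y z : Plane) : cross x (y + z) = cross x y + cross x z := by
  simp [cross]; ring
lemma cross_sub_right (x y z : Plane) : cross x (y - z) = cross x y - cross x z := by
  simp [cross]; ring
lemma cross_smul_left (t : ℝ) (x y : Plane) : cross (t • x) y = t * cross x y := by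
  simp [cross]; ring
lemma cross_smul_right (t : ℝ) (x y : Plane) : cross x (t • y) = t * cross x y := by
  simp [cross]; ring
lemma cross_neg_left (x y : Plane) : cross (-x) y = -cross x y := by
  simp [cross]; ring
lemma cross_neg_right (x y : Plane) : cross x (-y) = -cross x y := by
  simp [cross]; ring
lemma cross_self (x : Plane) : cross x x = 0 := by
  simp [cross]; ring
lemma cross_swap (x y : Plane) : cross y x = -cross x y := by
  simp [cross]; ring
lemma cross_zero_right (x : Plane) : cross x 0 = 0 := by simp [cross]

@[fun_prop]
lemma continuous_cross_right (x : Plane) : Continuous (fun y => cross x y) := by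
  unfold cross; fun_prop

@[fun_prop]
lemma continuous_orient (a b : Plane) : Continuous (fun y => orient a b y) := by
  unfold orient cross; fun_prop

lemma orient_rotate (a b c : Plane) : orient b c a = orient a b c := by
  simp [orient, cross]; ring
lemma orient_swap_left (a b c : Plane) : orient b a c = -orient a b c := by
  simp [orient, cross]; ring
lemma orient_swap_right (a b c : Plane) : orient a c b = -orient a b c := by
  simp [orient, cross]; ring
@[simp] lemma orient_self_left (a b : Plane) : orient a b a = 0 := by
  simp [orient, cross]
@[simp] lemma orient_self_right (a b : Plane) : orient a b b = 0 := by
  simp [orient, cross]; ring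

lemma orient_combo (a b c d : Plane) {s t : ℝ} (h : s + t = 1) :
    orient a b (s • c + t • d) = s * orient a b c + t * orient a b d := by
  obtain rfl : s = 1 - t := by linarith
  simp [orient, cross]; ring

lemma dot_self_pos {x : Plane} (hx : x ≠ 0) : 0 < dot x x := by
  have : x 0 ≠ 0 ∨ x 1 ≠ 0 := by
    by_contra! h
    exact hx (plane_ext h.1 h.2)
  unfold dot
  rcases this with h | h
  · have := mul_self_pos.2 h; nlinarith [mul_self_nonneg (x 1)]
  · have := mul_self_pos.2 h; nlinarith [mul_self_nonneg (x 0)]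

/-- Cramer's rule: the affine coordinates of `x` with respect to `v`, `a`, `b`. -/
lemma eq_affine_coordinates {v a b : Plane} (h : orient v a b ≠ 0) (x : Plane) :
    x = v + (orient v x b / orient v a b) • (a - v) + (orient v a x / orient v a b) • (b - v) := by
  have key : ∀ i, orient v a b * (x i - v i) =
      orient v x b * (a i - v i) + orient v a x * (b i - v i) := by
    intro i; fin_cases i <;> simp [orient, cross] <;> ring
  refine plane_ext ?_ ?_ <;> simp <;> field_simp <;> linarith [key 0, key 1]

lemma eq_smul_of_cross_eq_zero {x y : Plane} (hx : x ≠ 0) (h : cross x y = 0) :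
    y = (dot x y / dot x x) • x := by
  have hd := (dot_self_pos hx).ne'
  unfold cross at h
  refine plane_ext ?_ ?_
  · simp only [PiLp.smul_apply, smul_eq_mul]; field_simp; unfold dot; linear_combination (-x 1) * h
  · simp only [PiLp.smul_apply, smul_eq_mul]; field_simp; unfold dot; linear_combination (x 0) * h

lemma collinear_of_orient_eq_zero {a b c : Plane} (h : orient a b c = 0) :
    Collinear ℝ {a, b, c} := by
  by_cases hab : b = a
  · subst hab
    simpa using collinear_pair ℝ b c
  rw [collinear_iff_of_mem (p₀ := a) (by simp)]
  refine ⟨b - a, ?_⟩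
  have := eq_smul_of_cross_eq_zero (sub_ne_zero.2 hab) h
  intro p hp
  simp only [Set.mem_insert_iff, Set.mem_singleton_iff] at hp
  rcases hp with rfl | rfl | rfl
  · exact ⟨0, by simp⟩
  · exact ⟨1, by simp⟩
  · exact ⟨_, by rw [vadd_eq_add, ← this]; simp⟩

lemma mem_segment_iff' {a b x : Plane} :
    x ∈ segment ℝ a b ↔ ∃ t : ℝ, 0 ≤ t ∧ t ≤ 1 ∧ x = a + t • (b - a) := by
  rw [segment_eq_image']
  constructor
  · rintro ⟨t, ⟨h0, h1⟩, rfl⟩; exact ⟨t, h0, h1, rfl⟩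
  · rintro ⟨t, h0, h1, rfl⟩; exact ⟨t, ⟨h0, h1⟩, rfl⟩

lemma mem_openSegment_iff' {a b x : Plane} :
    x ∈ openSegment ℝ a b ↔ ∃ t : ℝ, 0 < t ∧ t < 1 ∧ x = a + t • (b - a) := by
  rw [openSegment_eq_image']
  constructor
  · rintro ⟨t, ⟨h0, h1⟩, rfl⟩; exact ⟨t, h0, h1, rfl⟩
  · rintro ⟨t, h0, h1, rfl⟩; exact ⟨t, ⟨h0, h1⟩, rfl⟩

lemma orient_segment (a b c d : Plane) (t : ℝ) :
    orient a b (c + t • (d - c)) = (1 - t) * orient a b c + t * orient a b d := by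
  simp [orient, cross]; ring

lemma left_notMem_openSegment {a b : Plane} (h : a ≠ b) : a ∉ openSegment ℝ a b := by
  simpa [left_mem_openSegment_iff] using h

lemma right_notMem_openSegment {a b : Plane} (h : a ≠ b) : b ∉ openSegment ℝ a b := by
  simpa [right_mem_openSegment_iff] using h

lemma mem_segment_cases {a b x : Plane} (h : x ∈ segment ℝ a b) :
    x = a ∨ x = b ∨ x ∈ openSegment ℝ a b := by
  rw [← insert_endpoints_openSegment] at h
  simpa using h

/-! ### Simple polygons in general position -/

variable {n : ℕ} {P : Polygon Plane n}

lemma edgeSet_eq_segment (P : Polygon Plane n) (i : Fin n) :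
    P.edgeSet ℝ i = segment ℝ (P i) (P (finRotate n i)) := by
  rw [edgeSet, affineSegment_eq_segment]

lemma mem_boundary {x : Plane} :
    x ∈ P.boundary ℝ ↔ ∃ i, x ∈ segment ℝ (P i) (P (finRotate n i)) := by
  simp [boundary, edgeSet_eq_segment]

lemma isCompact_segment (a b : Plane) : IsCompact (segment ℝ a b) := by
  rw [segment_eq_image']
  exact isCompact_Icc.image (by fun_prop)

lemma isCompact_boundary (P : Polygon Plane n) : IsCompact (P.boundary ℝ) := by
  unfold boundary
  exact isCompact_iUnion fun i => by rw [edgeSet_eq_segment]; exact isCompact_segment _ _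

lemma isOpen_compl_boundary (P : Polygon Plane n) : IsOpen (P.boundary ℝ)ᶜ :=
  (isCompact_boundary P).isClosed.isOpen_compl

lemma finRotate_ne (hn : 3 ≤ n) (i : Fin n) : finRotate n i ≠ i := by
  obtain ⟨m, rfl⟩ : ∃ m, n = m + 3 := ⟨n - 3, by omega⟩
  rw [finRotate_apply]
  simp

lemma finRotate_finRotate_ne (hn : 3 ≤ n) (i : Fin n) : finRotate n (finRotate n i) ≠ i := by
  obtain ⟨m, rfl⟩ : ∃ m, n = m + 3 := ⟨n - 3, by omega⟩
  rw [finRotate_apply, finRotate_apply, add_assoc]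
  intro h
  have h2 : (1 + 1 : Fin (m + 3)) = 0 := by simpa using h
  have := congrArg Fin.val h2
  rw [Fin.val_add] at this
  simp only [Fin.val_one, Fin.val_zero] at this
  rw [Nat.mod_eq_of_lt (by omega)] at this
  omega

/-- A set of vertices closed under passing to the next vertex contains all vertices. -/
lemma forall_of_finRotate {p : Fin n → Prop} {i : Fin n} (hi : p i)
    (hp : ∀ j, p j → p (finRotate n j)) (k : Fin n) : p k := by
  obtain ⟨m, rfl⟩ : ∃ m, n = m + 1 := ⟨n - 1, by have := i.2; omega⟩
  have h : ∀ d : ℕ, p (i + Fin.ofNat (m + 1) d) := by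
    intro d
    induction d with
    | zero => simpa using hi
    | succ d ih =>
      have := hp _ ih
      rw [finRotate_apply, add_assoc] at this
      convert this using 2
      ext; simp [Fin.val_add]
  have := h (k - i).val
  simpa using this

lemma IsSimple.injective (hs : P.IsSimple) : Function.Injective P.vertices := by
  intro i j hij
  have := hs.injOn (x₁ := (i, (0 : ℝ))) (x₂ := (j, (0 : ℝ))) (by simp) (by simp)
    (by simpa [edgePath] using hij)
  simpa using this

lemma IsSimple.ne (hs : P.IsSimple) {i j : Fin n} (h : i ≠ j) : P i ≠ P j :=
  fun h' => h (hs.injective h')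

/-- Every point of an edge is visited by a half-open edge: this one, or the next one at time
`0`. -/
lemma exists_edgePath_eq {i : Fin n} {x : Plane}
    (hx : x ∈ segment ℝ (P i) (P (finRotate n i))) :
    ∃ q : Fin n × ℝ, q.2 ∈ Set.Ico (0 : ℝ) 1 ∧ P.edgePath ℝ q.1 q.2 = x ∧
      (q.1 = i ∨ (q.1 = finRotate n i ∧ q.2 = 0)) := by
  rw [mem_segment_iff'] at hx
  obtain ⟨t, h0, h1, rfl⟩ := hx
  rcases h1.lt_or_eq with h | rfl
  · exact ⟨(i, t), ⟨h0, h⟩, by simp [edgePath, AffineMap.lineMap_apply, add_comm], Or.inl rfl⟩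
  · exact ⟨(finRotate n i, 0), by simp, by simp [edgePath], Or.inr ⟨rfl, rfl⟩⟩

/-- Two different edges of a simple polygon meet at most in a common vertex. -/
lemma IsSimple.edge_inter (hs : P.IsSimple) {i j : Fin n} (hij : i ≠ j) {x : Plane}
    (hi : x ∈ segment ℝ (P i) (P (finRotate n i)))
    (hj : x ∈ segment ℝ (P j) (P (finRotate n j))) :
    ∃ k, x = P k ∧ (k = i ∨ k = finRotate n i) ∧ (k = j ∨ k = finRotate n j) := by
  obtain ⟨⟨a, t⟩, hq, hqx, hqi⟩ := exists_edgePath_eq hi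
  obtain ⟨⟨b, s⟩, hr, hrx, hrj⟩ := exists_edgePath_eq hj
  have := hs.injOn (x₁ := (a, t)) (x₂ := (b, s)) (by simpa using hq) (by simpa using hr)
    (hqx.trans hrx.symm)
  simp only [Prod.mk.injEq] at this
  obtain ⟨rfl, rfl⟩ := this
  simp only at hqx hqi hrj
  have ht : t = 0 := by
    rcases hqi with h | h
    · rcases hrj with h' | h'
      · exact absurd (h.symm.trans h') hij
      · exact h'.2
    · exact h.2
  subst ht
  refine ⟨a, ?_, ?_, ?_⟩
  · rw [← hqx]; simp [edgePath]
  · exact hqi.imp id And.left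
  · exact hrj.imp id And.left

lemma IsSimple.openEdge_disjoint (hs : P.IsSimple) {i j : Fin n} (hij : i ≠ j) :
    Disjoint (openSegment ℝ (P i) (P (finRotate n i))) (segment ℝ (P j) (P (finRotate n j))) := by
  rw [Set.disjoint_left]
  intro x hx hx'
  obtain ⟨k, rfl, hk, -⟩ := hs.edge_inter hij (openSegment_subset_segment _ _ _ hx) hx'
  have hne := hs.ne (finRotate_ne hs.three_le i).symm
  rcases hk with rfl | rfl
  · exact left_notMem_openSegment hne hx
  · exact right_notMem_openSegment hne hx

lemma IsSimple.vertex_mem_edge (hs : P.IsSimple) {k j : Fin n}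
    (h : P k ∈ segment ℝ (P j) (P (finRotate n j))) : k = j ∨ k = finRotate n j := by
  by_cases hkj : k = j
  · exact Or.inl hkj
  obtain ⟨l, hl, -, h2⟩ := hs.edge_inter hkj (left_mem_segment ℝ _ _) h
  rw [hs.injective hl]; exact h2

lemma InGeneralPosition.orient_ne_zero (hg : P.InGeneralPosition) {i j k : Fin n} (hij : i ≠ j)
    (hjk : j ≠ k) (hik : i ≠ k) : orient (P i) (P j) (P k) ≠ 0 :=
  fun h => hg i j k hij hjk hik (collinear_of_orient_eq_zero h)

lemma InGeneralPosition.notMem_openSegment (hg : P.InGeneralPosition) (hs : P.IsSimple)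
    {i j : Fin n} (k : Fin n) (hij : i ≠ j) : P k ∉ openSegment ℝ (P i) (P j) := by
  intro h
  by_cases hik : k = i
  · subst hik; exact left_notMem_openSegment (hs.ne hij) h
  by_cases hjk : k = j
  · subst hjk; exact right_notMem_openSegment (hs.ne hij) h
  refine hg.orient_ne_zero hij (Ne.symm hjk) (Ne.symm hik) ?_
  obtain ⟨t, -, -, ht⟩ := mem_openSegment_iff'.1 h
  rw [ht, orient_segment]; simp

lemma vertex_mem_boundary (P : Polygon Plane n) (i : Fin n) : P i ∈ P.boundary ℝ :=
  mem_boundary.2 ⟨i, left_mem_segment ℝ _ _⟩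

/-! ### Ray parity -/

open Classical in
/-- Whether the ray from `p` in direction `h` crosses the segment `a b`, as an element of
`ZMod 2`. The end points of the segment are counted by the half-open rule: those on the line of
the ray count as lying to the left of it. -/
def crossing (h a b p : Plane) : ZMod 2 :=
  if ((cross h a ≤ cross h p) ↔ ¬ (cross h b ≤ cross h p)) ∧
    0 < cross (b - a) (p - a) * cross h (b - a) then 1 else 0

open Classical in
/-- Correction term at an end point `a`: when `q` moves near `p`, it jumps exactly when `a` lies
on the ray from `p` and `q` moves from one side of `a` to the other. -/
def above (h p a q : Plane) : ZMod 2 :=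
  if cross h a ≤ cross h q ∧ 0 < dot h (a - p) then 1 else 0

lemma zmod_two_add_self (x : ZMod 2) : x + x = 0 := CharTwo.add_self_eq_zero x

lemma crossing_swap (h a b p : Plane) : crossing h b a p = crossing h a b p := by
  have : cross (a - b) (p - b) * cross h (a - b) = cross (b - a) (p - a) * cross h (b - a) := by
    simp [cross]; ring
  unfold crossing
  rw [this]
  congr 1
  apply propext
  tauto

/-- A point `p` off the segment `a b` is off the line `a b` whenever the line through `p` in
direction `h` separates `a` from `b` weakly. -/
lemma mem_segment_of_cross {h a b p : Plane} (hab : cross h a < cross h b)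
    (h1 : cross h a ≤ cross h p) (h2 : cross h p ≤ cross h b) (h0 : cross (b - a) (p - a) = 0) :
    p ∈ segment ℝ a b := by
  have hne : b - a ≠ 0 := by
    rintro h; rw [sub_eq_zero.1 h] at hab; exact lt_irrefl _ hab
  obtain h3 := eq_smul_of_cross_eq_zero hne h0
  set t := dot (b - a) (p - a) / dot (b - a) (b - a)
  have h4 : cross h p - cross h a = t * (cross h b - cross h a) := by
    rw [← cross_sub_right, h3, cross_smul_right, cross_sub_right]
  refine mem_segment_iff'.2 ⟨t, ?_, ?_, ?_⟩
  · by_contra! ht; nlinarith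
  · by_contra! ht; nlinarith
  · rw [← h3]; simp

lemma mem_segment_of_vertical {h a b p : Plane} (hh : h ≠ 0) (ha : cross h a = cross h p)
    (hb : cross h b = cross h p) (h1 : dot h (a - p) ≤ 0) (h2 : 0 ≤ dot h (b - p)) :
    p ∈ segment ℝ a b := by
  have ha' := eq_smul_of_cross_eq_zero hh (y := a - p) (by rw [cross_sub_right, ha, sub_self])
  have hb' := eq_smul_of_cross_eq_zero hh (y := b - p) (by rw [cross_sub_right, hb, sub_self])
  have hp := dot_self_pos hh
  set s := dot h (a - p) / dot h h
  set t := dot h (b - p) / dot h h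
  have hs : s ≤ 0 := div_nonpos_of_nonpos_of_nonneg h1 hp.le
  have ht : 0 ≤ t := div_nonneg h2 hp.le
  by_cases hst : t - s = 0
  · have : a - p = 0 := by rw [ha', show s = 0 by linarith, zero_smul]
    rw [sub_eq_zero.1 this]; exact left_mem_segment ℝ _ _
  have hpos : 0 < t - s := lt_of_le_of_ne (by linarith) (Ne.symm hst)
  refine mem_segment_iff'.2 ⟨-s / (t - s), by apply div_nonneg <;> linarith, ?_, ?_⟩
  · rw [div_le_one hpos]; linarith
  · have hba : b - a = (t - s) • h := by rw [sub_smul, ← ha', ← hb']; abel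
    rw [hba, smul_smul, div_mul_cancel₀ _ hst, neg_smul, ← ha']; abel

lemma mem_segment_of_vertical' {h a b p : Plane} (hh : h ≠ 0) (ha : cross h a = cross h p)
    (hb : cross h b = cross h p) (hp : p ∉ segment ℝ a b) :
    0 < dot h (a - p) ↔ 0 < dot h (b - p) := by
  constructor
  · intro h1
    by_contra! h2
    rw [segment_symm] at hp
    exact hp (mem_segment_of_vertical hh hb ha h2 h1.le)
  · intro h1
    by_contra! h2
    exact hp (mem_segment_of_vertical hh ha hb h2 h1.le)

/-- Near a point `p` off the segment `a b`, the crossing number of the segment is constant up to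
the correction terms of its end points. -/
lemma crossing_eventually {h a b p : Plane} (hh : h ≠ 0) (hp : p ∉ segment ℝ a b) :
    ∀ᶠ q in nhds p, crossing h a b q + (above h p a q + above h p b q) =
      crossing h a b p + (above h p a p + above h p b p) := by
  set F : Plane → ℝ := fun q => cross (b - a) (q - a) * cross h (b - a) with hF
  have hFc : Continuous F := by simp only [hF, cross]; fun_prop
  have hκ : Continuous fun q => cross h q := by fun_prop
  have e1 : ∀ c : ℝ, ∀ᶠ q in nhds p, (c < cross h p → c ≤ cross h q) ∧
      (cross h p < c → cross h q < c) := by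
    intro c
    rw [Filter.eventually_and]
    constructor
    · by_cases hc : c < cross h p
      · filter_upwards [hκ.continuousAt.eventually (lt_mem_nhds hc)] with q hq _ using hq.le
      · simp [hc]
    · by_cases hc : cross h p < c
      · filter_upwards [hκ.continuousAt.eventually (gt_mem_nhds hc)] with q hq _ using hq
      · simp [hc]
  have e2 : ∀ᶠ q in nhds p, (0 < F p → 0 < F q) ∧ (F p < 0 → F q < 0) := by
    rw [Filter.eventually_and]
    constructor
    · by_cases hc : 0 < F p
      · filter_upwards [hFc.continuousAt.eventually (lt_mem_nhds hc)] with q hq _ using hq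
      · simp [hc]
    · by_cases hc : F p < 0
      · filter_upwards [hFc.continuousAt.eventually (gt_mem_nhds hc)] with q hq _ using hq
      · simp [hc]
  have hdd := dot_self_pos hh
  -- the sign of `F p` when one end point lies on the line of the ray
  have s1 : cross h a = cross h p → F p * dot h h = dot h (a - p) * cross h (b - a) ^ 2 := by
    intro h1
    have h3 := eq_smul_of_cross_eq_zero hh (y := a - p) (by rw [cross_sub_right, h1, sub_self])
    have h4 : p - a = -((dot h (a - p) / dot h h) • h) := by rw [← h3]; abel
    simp only [hF]
    rw [h4, cross_neg_right, cross_smul_right, cross_swap]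
    field_simp
  have s2 : cross h b = cross h p → F p * dot h h = dot h (b - p) * cross h (b - a) ^ 2 := by
    intro h1
    have h3 := eq_smul_of_cross_eq_zero hh (y := b - p) (by rw [cross_sub_right, h1, sub_self])
    have h4 : p - a = (b - a) - ((dot h (b - p) / dot h h) • h) := by rw [← h3]; abel
    simp only [hF]
    rw [h4, cross_sub_right, cross_smul_right, cross_self, cross_swap h (b - a)]
    field_simp
    ring
  have sgn : ∀ d : ℝ, cross h b ≠ cross h a → F p * dot h h = d * cross h (b - a) ^ 2 →
      (0 < d ↔ 0 < F p) ∧ (d < 0 ↔ F p < 0) := by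
    intro d hne hd
    have hsq : 0 < cross h (b - a) ^ 2 := by
      rw [cross_sub_right]; exact sq_pos_of_ne_zero (sub_ne_zero.2 hne)
    refine ⟨⟨fun h1 => ?_, fun h1 => ?_⟩, ⟨fun h1 => ?_, fun h1 => ?_⟩⟩ <;>
    · by_contra! h2
      nlinarith [mul_pos hdd hsq]
  have n0 : F p = 0 → cross h b ≠ cross h a → cross (b - a) (p - a) = 0 := by
    intro h1 h2
    refine (mul_eq_zero.1 h1).resolve_right ?_
    rw [cross_sub_right]; exact sub_ne_zero.2 h2
  have n1 : cross h a < cross h p → cross h p < cross h b → F p ≠ 0 := fun h1 h2 h3 =>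
    hp (mem_segment_of_cross (h1.trans h2) h1.le h2.le (n0 h3 (h1.trans h2).ne'))
  have n2 : cross h b < cross h p → cross h p < cross h a → F p ≠ 0 := fun h1 h2 h3 => by
    rw [segment_symm] at hp
    refine hp (mem_segment_of_cross (h1.trans h2) h1.le h2.le ?_)
    have := n0 h3 (h1.trans h2).ne
    have e : cross (a - b) (p - b) = - cross (b - a) (p - a) := by simp [cross]; ring
    rw [e, this, neg_zero]
  have d1 : cross h a = cross h p → dot h (a - p) ≠ 0 := by
    intro h1 h2
    have h3 := eq_smul_of_cross_eq_zero hh (y := a - p) (by rw [cross_sub_right, h1, sub_self])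
    rw [h2, zero_div, zero_smul, sub_eq_zero] at h3
    exact hp (h3 ▸ left_mem_segment ℝ _ _)
  have d2 : cross h b = cross h p → dot h (b - p) ≠ 0 := by
    intro h1 h2
    have h3 := eq_smul_of_cross_eq_zero hh (y := b - p) (by rw [cross_sub_right, h1, sub_self])
    rw [h2, zero_div, zero_smul, sub_eq_zero] at h3
    exact hp (h3 ▸ right_mem_segment ℝ _ _)
  have v1 : cross h a = cross h p → cross h b = cross h p →
      (0 < dot h (a - p) ↔ 0 < dot h (b - p)) := fun h1 h2 => mem_segment_of_vertical' hh h1 h2 hp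
  have g1 := fun h1 h2 => sgn _ h2 (s1 h1)
  have g2 := fun h1 h2 => sgn _ h2 (s2 h1)
  clear s1 s2 sgn n0
  filter_upwards [e1 (cross h a), e1 (cross h b), e2] with q ha hb hFq
  have hFq' : cross (b - a) (q - a) * cross h (b - a) = F q := rfl
  have hFp' : cross (b - a) (p - a) * cross h (b - a) = F p := rfl
  unfold crossing above
  rw [hFq', hFp']
  clear hFq' hFp' e1 e2 hFc hκ
  have two : (1 : ZMod 2) + 1 = 0 := rfl
  generalize cross h a = α at *
  generalize cross h b = β at *
  generalize cross h p = π at *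
  generalize cross h q = κ at *
  generalize dot h (a - p) = da at *
  generalize dot h (b - p) = db at *
  generalize F p = fp at *
  generalize F q = fq at *
  clear hF F hp hh hdd
  rcases lt_trichotomy α π with h1 | h1 | h1 <;> rcases lt_trichotomy β π with h2 | h2 | h2
  · have := ha.1 h1; have := hb.1 h2; simp [h1.le, h2.le, *]
  · subst h2
    have := ha.1 h1; have hd := g2 rfl (ne_of_gt h1); have := d2 rfl
    grind
  · have := ha.1 h1; have := hb.2 h2; have := n1 h1 h2
    grind
  · subst h1
    have := hb.1 h2; have hd := g1 rfl h2.ne; have := d1 rfl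
    grind
  · subst h1 h2
    have := v1 rfl rfl
    grind
  · subst h1
    have := hb.2 h2; have hd := g1 rfl h2.ne'; have := d1 rfl
    grind
  · have := ha.2 h1; have := hb.1 h2; have := n2 h2 h1
    grind
  · subst h2
    have := ha.2 h1; have hd := g2 rfl h1.ne; have := d2 rfl
    grind
  · have := ha.2 h1; have := hb.2 h2
    grind

/-- The number of segments `s i, t i`, `i ∈ A`, crossed by the ray from `p` in direction `h`,
modulo two. -/
def rayParity {ι : Type*} (h : Plane) (A : Finset ι) (s t : ι → Plane) (p : Plane) : ZMod 2 :=
  ∑ i ∈ A, crossing h (s i) (t i) p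

/-- A family of segments is a cycle modulo two if every point is an end point of an even number
of its segments; this is expressed by letting arbitrary functions sum to zero over the end
points. -/
def IsCycle {ι : Type*} (A : Finset ι) (s t : ι → Plane) : Prop :=
  ∀ f : Plane → ZMod 2, ∑ i ∈ A, (f (s i) + f (t i)) = 0

section Parity

variable {ι : Type*} {h : Plane} {A : Finset ι} {s t : ι → Plane}

lemma IsCycle.rayParity_eventually_eq (hc : IsCycle A s t) (hh : h ≠ 0) {p : Plane}
    (hp : ∀ i ∈ A, p ∉ segment ℝ (s i) (t i)) :
    ∀ᶠ q in nhds p, rayParity h A s t q = rayParity h A s t p := by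
  have : ∀ᶠ q in nhds p, ∀ i ∈ A,
      crossing h (s i) (t i) q + (above h p (s i) q + above h p (t i) q) =
      crossing h (s i) (t i) p + (above h p (s i) p + above h p (t i) p) :=
    (Filter.eventually_all_finset A).2 fun i hi => crossing_eventually hh (hp i hi)
  filter_upwards [this] with q hq
  have key := Finset.sum_congr rfl hq
  simpa only [Finset.sum_add_distrib (f := fun i => crossing h (s i) (t i) _),
    hc (fun x => above h p x q), hc (fun x => above h p x p), add_zero, rayParity] using key

lemma IsCycle.rayParity_eq (hc : IsCycle A s t) (hh : h ≠ 0) {C : Set Plane}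
    (hC : IsPreconnected C) (hd : ∀ i ∈ A, ∀ x ∈ C, x ∉ segment ℝ (s i) (t i)) {x y : Plane}
    (hx : x ∈ C) (hy : y ∈ C) : rayParity h A s t x = rayParity h A s t y := by
  refine hC.constant (f := rayParity h A s t) ?_ hx hy
  intro z hz
  refine ContinuousAt.continuousWithinAt ?_
  refine Filter.Tendsto.congr' ?_ (tendsto_const_nhds (x := rayParity h A s t z))
  filter_upwards [hc.rayParity_eventually_eq hh fun i hi => hd i hi z hz] with q hq using hq.symm

lemma IsCycle.rayParity_eq_of_segment (hc : IsCycle A s t) (hh : h ≠ 0) {x y : Plane}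
    (hd : ∀ i ∈ A, Disjoint (segment ℝ x y) (segment ℝ (s i) (t i))) :
    rayParity h A s t x = rayParity h A s t y :=
  hc.rayParity_eq hh (convex_segment x y).isPreconnected
    (fun i hi _ hz => Set.disjoint_left.1 (hd i hi) hz) (left_mem_segment ℝ _ _)
    (right_mem_segment ℝ _ _)

lemma rayParity_eq_zero_of_lt {p : Plane}
    (hp : ∀ i ∈ A, cross h p < cross h (s i) ∧ cross h p < cross h (t i)) :
    rayParity h A s t p = 0 := by
  refine Finset.sum_eq_zero fun i hi => ?_
  unfold crossing
  rw [if_neg]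
  have := hp i hi
  simp [this.2.not_ge, this.1.not_ge]

lemma rayParity_eq_zero_of_gt {p : Plane}
    (hp : ∀ i ∈ A, cross h (s i) ≤ cross h p ∧ cross h (t i) ≤ cross h p) :
    rayParity h A s t p = 0 := by
  refine Finset.sum_eq_zero fun i hi => ?_
  unfold crossing
  rw [if_neg]
  have := hp i hi
  simp [this.1, this.2]

lemma abs_cross_le (x y : Plane) : |cross x y| ≤ 2 * (‖x‖ * ‖y‖) := by
  have h0 := PiLp.norm_apply_le x 0
  have h1 := PiLp.norm_apply_le x 1
  have h2 := PiLp.norm_apply_le y 0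
  have h3 := PiLp.norm_apply_le y 1
  rw [Real.norm_eq_abs] at h0 h1 h2 h3
  unfold cross
  have e1 : |x 0 * y 1| ≤ ‖x‖ * ‖y‖ := by
    rw [abs_mul]; gcongr
  have e2 : |x 1 * y 0| ≤ ‖x‖ * ‖y‖ := by
    rw [abs_mul]; gcongr
  calc _ ≤ |x 0 * y 1| + |x 1 * y 0| := abs_sub _ _
    _ ≤ _ := by linarith

lemma norm_sq_eq_dot (x : Plane) : ‖x‖ ^ 2 = dot x x := by
  rw [EuclideanSpace.norm_sq_eq]
  simp [dot, Fin.sum_univ_two]; ring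

/-- The parity of a cycle vanishes far away: follow a ray that leaves the disc containing the
cycle and runs out of the strip in which rays meet it. -/
lemma IsCycle.rayParity_eq_zero_of_norm (hc : IsCycle A s t) (hh : h ≠ 0) {R : ℝ}
    (hR : ∀ i ∈ A, ‖s i‖ ≤ R ∧ ‖t i‖ ≤ R) {p : Plane} (hp : R < ‖p‖) (hR0 : 0 ≤ R) :
    rayParity h A s t p = 0 := by
  have hp0 : p ≠ 0 := by rintro rfl; simp at hp; linarith
  obtain ⟨w, hw, hpw⟩ : ∃ w : Plane, cross h w ≠ 0 ∧ 0 ≤ dot p w := by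
    by_cases h1 : cross h p = 0
    · refine ⟨WithLp.toLp 2 ![-p 1, p 0], ?_, by simp [dot]; linarith⟩
      intro h2
      have e1 : cross h (WithLp.toLp 2 ![-p 1, p 0]) = dot h p := by simp [cross, dot]
      have h3 := eq_smul_of_cross_eq_zero hh h1
      rw [← e1, h2, zero_div, zero_smul] at h3
      exact hp0 h3
    · exact ⟨p, h1, (dot_self_pos hp0).le⟩
  have hnorm : ∀ τ : ℝ, 0 ≤ τ → R < ‖p + τ • w‖ := by
    intro τ hτ
    refine hp.trans_le ?_
    rw [← sq_le_sq₀ (norm_nonneg _) (norm_nonneg _), norm_sq_eq_dot, norm_sq_eq_dot]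
    have : dot (p + τ • w) (p + τ • w) =
        dot p p + 2 * τ * dot p w + τ ^ 2 * (w 0 ^ 2 + w 1 ^ 2) := by
      simp [dot]; ring
    rw [this]
    have := mul_nonneg hτ hpw
    nlinarith [mul_nonneg (sq_nonneg τ) (add_nonneg (sq_nonneg (w 0)) (sq_nonneg (w 1)))]
  set C := (fun τ : ℝ => p + τ • w) '' Set.Ici 0
  have hC : IsPreconnected C := isPreconnected_Ici.image _ (by fun_prop)
  have hCd : ∀ i ∈ A, ∀ x ∈ C, x ∉ segment ℝ (s i) (t i) := by
    rintro i hi _ ⟨τ, hτ, rfl⟩ hx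
    have := (convex_closedBall (0 : Plane) R).segment_subset
      (by simpa using (hR i hi).1) (by simpa using (hR i hi).2) hx
    simp only [mem_closedBall_zero_iff] at this
    exact absurd (hnorm τ hτ) (not_lt.2 this)
  have hpC : p ∈ C := ⟨0, by simp, by simp⟩
  set τ := (2 * (‖h‖ * R) + |cross h p| + 1) / |cross h w|
  have hτ0 : 0 ≤ τ := by positivity
  have hτ : |cross h w| * τ = 2 * (‖h‖ * R) + |cross h p| + 1 := by
    simp only [τ]; field_simp
  have hb : ∀ x : Plane, ‖x‖ ≤ R → |cross h x| ≤ 2 * (‖h‖ * R) := fun x hx =>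
    (abs_cross_le h x).trans (by gcongr)
  rw [hc.rayParity_eq hh hC hCd hpC ⟨τ, hτ0, rfl⟩]
  have hcr : cross h (p + τ • w) = cross h p + τ * cross h w := by
    rw [cross_add_right, cross_smul_right]
  rcases lt_or_gt_of_ne hw with hw' | hw'
  · refine rayParity_eq_zero_of_lt fun i hi => ?_
    rw [abs_of_neg hw'] at hτ
    have h1 := abs_le.1 (hb _ (hR i hi).1)
    have h2 := abs_le.1 (hb _ (hR i hi).2)
    have h3 := le_abs_self (cross h p)
    rw [hcr]
    constructor <;> nlinarith
  · refine rayParity_eq_zero_of_gt fun i hi => ?_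
    rw [abs_of_pos hw'] at hτ
    have h1 := abs_le.1 (hb _ (hR i hi).1)
    have h2 := abs_le.1 (hb _ (hR i hi).2)
    have h3 := neg_abs_le (cross h p)
    rw [hcr]
    constructor <;> nlinarith

/-- Crossing a single segment of a family changes the parity. -/
lemma rayParity_jump {x : Plane} {i : ι} (hi : i ∈ A)
    (hx : x ∈ openSegment ℝ (s i) (t i))
    (hne : ∀ j ∈ A, cross h (s j) ≠ cross h x ∧ cross h (t j) ≠ cross h x)
    (hd : ∀ j ∈ A, j ≠ i → x ∉ segment ℝ (s j) (t j)) (hh : h ≠ 0) :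
    ∀ᶠ y in nhds x ×ˢ nhds x, orient (s i) (t i) y.1 * orient (s i) (t i) y.2 < 0 →
      rayParity h A s t y.1 + rayParity h A s t y.2 = 1 := by
  classical
  have hκ : Continuous fun q => cross h q := by fun_prop
  have e1 : ∀ j ∈ A, ∀ᶠ q in nhds x, (cross h (s j) ≤ cross h q ↔ cross h (s j) ≤ cross h x) ∧
      (cross h (t j) ≤ cross h q ↔ cross h (t j) ≤ cross h x) := by
    have : ∀ c, c ≠ cross h x → ∀ᶠ q in nhds x, (c ≤ cross h q ↔ c ≤ cross h x) := by
      intro c hc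
      rcases lt_or_gt_of_ne hc with h1 | h1
      · filter_upwards [hκ.continuousAt.eventually (lt_mem_nhds h1)] with q hq
        simp [h1.le, hq.le]
      · filter_upwards [hκ.continuousAt.eventually (gt_mem_nhds h1)] with q hq
        exact ⟨fun h2 => absurd h2 (not_le.2 hq), fun h2 => absurd h2 (not_le.2 h1)⟩
    intro j hj
    exact (this _ (hne j hj).1).and (this _ (hne j hj).2)
  have e2 : ∀ᶠ q in nhds x, ∀ j ∈ A.erase i,
      crossing h (s j) (t j) q = crossing h (s j) (t j) x := by
    refine (Filter.eventually_all_finset _).2 fun j hj => ?_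
    obtain ⟨hji, hj⟩ := Finset.mem_erase.1 hj
    filter_upwards [crossing_eventually hh (hd j hj hji), e1 j hj] with q hq hq'
    have a1 : above h x (s j) q = above h x (s j) x := by unfold above; simp only [hq'.1]
    have a2 : above h x (t j) q = above h x (t j) x := by unfold above; simp only [hq'.2]
    rw [a1, a2] at hq
    exact add_right_cancel hq
  have e3 : ∀ᶠ q in nhds x, crossing h (s i) (t i) q =
      if 0 < orient (s i) (t i) q * cross h (t i - s i) then 1 else 0 := by
    filter_upwards [e1 i hi] with q hq
    unfold crossing orient
    simp only [hq.1, hq.2]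
    clear hq
    obtain ⟨τ, h0, h1, rfl⟩ := mem_openSegment_iff'.1 hx
    have hc : cross h (s i + τ • (t i - s i)) =
        cross h (s i) + τ * (cross h (t i) - cross h (s i)) := by
      rw [cross_add_right, cross_smul_right, cross_sub_right]
    have := hne i hi
    rw [hc] at this ⊢
    have hs : cross h (t i) - cross h (s i) ≠ 0 := fun h => this.1 (by rw [h]; ring)
    have hiff : (cross h (s i) ≤ cross h (s i) + τ * (cross h (t i) - cross h (s i))) ↔
        ¬ cross h (t i) ≤ cross h (s i) + τ * (cross h (t i) - cross h (s i)) := by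
      rcases lt_or_gt_of_ne hs with h2 | h2
      · constructor
        · intro; nlinarith
        · intro h3; exfalso; apply h3; nlinarith
      · constructor
        · intro; rw [not_le]; nlinarith
        · intro; nlinarith
    simp [hiff]
  have hx1 : cross h (t i - s i) ≠ 0 := by
    obtain ⟨τ, h0, h1, rfl⟩ := mem_openSegment_iff'.1 hx
    intro h2
    refine (hne i hi).1 ?_
    rw [cross_add_right, cross_smul_right, h2]; ring
  filter_upwards [(e2.and e3).prod_mk (e2.and e3)] with y hy hlt
  obtain ⟨⟨h1, h2⟩, h3, h4⟩ := hy
  have hsplit : ∀ q, (∀ j ∈ A.erase i, crossing h (s j) (t j) q = crossing h (s j) (t j) x) →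
      rayParity h A s t q = crossing h (s i) (t i) q +
        ∑ j ∈ A.erase i, crossing h (s j) (t j) x := by
    intro q hq
    rw [rayParity, ← Finset.add_sum_erase _ _ hi, Finset.sum_congr rfl hq]
  rw [hsplit _ h1, hsplit _ h3, add_add_add_comm, zmod_two_add_self, add_zero, h2, h4]
  rcases mul_neg_iff.1 hlt with ⟨h5, h6⟩ | ⟨h5, h6⟩ <;> rcases lt_or_gt_of_ne hx1 with h7 | h7
  · rw [if_neg (not_lt.2 (mul_neg_of_pos_of_neg h5 h7).le),
      if_pos (mul_pos_of_neg_of_neg h6 h7)]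
    rfl
  · rw [if_pos (mul_pos h5 h7), if_neg (not_lt.2 (mul_neg_of_neg_of_pos h6 h7).le)]; rfl
  · rw [if_pos (mul_pos_of_neg_of_neg h5 h7),
      if_neg (not_lt.2 (mul_neg_of_pos_of_neg h6 h7).le)]
    rfl
  · rw [if_neg (not_lt.2 (mul_neg_of_neg_of_pos h5 h7).le), if_pos (mul_pos h6 h7)]; rfl

end Parity

/-! ### Interior, exterior and the parity of the boundary -/

/-- The parity of the number of edges crossed by the ray from `p` in direction `h`. -/
def parity (P : Polygon Plane n) (h p : Plane) : ZMod 2 :=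
  rayParity h Finset.univ (fun i => P i) (fun i => P (finRotate n i)) p

lemma isCycle_edges (P : Polygon Plane n) :
    IsCycle Finset.univ (fun i => P i) (fun i => P (finRotate n i)) := by
  intro f
  rw [Finset.sum_add_distrib, Equiv.sum_comp (finRotate n) (fun i => f (P i))]
  exact zmod_two_add_self _

lemma parity_eq {h : Plane} (hh : h ≠ 0) {C : Set Plane} (hC : IsPreconnected C)
    (hd : C ⊆ (P.boundary ℝ)ᶜ) {x y : Plane} (hx : x ∈ C) (hy : y ∈ C) :
    P.parity h x = P.parity h y :=
  (isCycle_edges P).rayParity_eq hh hC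
    (fun i _ _ hz hz' => hd hz (mem_boundary.2 ⟨i, hz'⟩)) hx hy

lemma inside_or_outside {x : Plane} (hx : x ∉ P.boundary ℝ) : x ∈ P.inside ∨ x ∈ P.outside := by
  by_cases h : Bornology.IsBounded (connectedComponentIn (P.boundary ℝ)ᶜ x)
  · exact Or.inl ⟨hx, h⟩
  · exact Or.inr ⟨hx, h⟩

lemma disjoint_inside_outside : Disjoint P.inside P.outside :=
  Set.disjoint_left.2 fun _ h h' => h'.2 h.2

lemma mem_inside_of_mem {C : Set Plane} (hC : IsPreconnected C) (hd : C ⊆ (P.boundary ℝ)ᶜ)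
    {x y : Plane} (hx : x ∈ C) (hy : y ∈ C) (h : x ∈ P.inside) : y ∈ P.inside := by
  refine ⟨hd hy, ?_⟩
  rw [← connectedComponentIn_eq (hC.subset_connectedComponentIn hx hd hy)]
  exact h.2

lemma mem_outside_of_mem {C : Set Plane} (hC : IsPreconnected C) (hd : C ⊆ (P.boundary ℝ)ᶜ)
    {x y : Plane} (hx : x ∈ C) (hy : y ∈ C) (h : x ∈ P.outside) : y ∈ P.outside := by
  refine ⟨hd hy, ?_⟩
  rw [← connectedComponentIn_eq (hC.subset_connectedComponentIn hx hd hy)]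
  exact h.2

lemma not_isBounded_ray (x : Plane) {w : Plane} (hw : w ≠ 0) :
    ¬ Bornology.IsBounded ((fun τ : ℝ => x + τ • w) '' Set.Ici 0) := by
  intro hb
  obtain ⟨R, hR⟩ := hb.subset_closedBall 0
  have hw' := norm_pos_iff.2 hw
  have hR0 : ‖x‖ ≤ R := by simpa using hR ⟨0, by simp, by simp⟩
  have h0 : 0 ≤ (‖x‖ + R + 1) / ‖w‖ := by
    have := norm_nonneg x
    exact div_nonneg (by linarith) hw'.le
  have h1 := hR ⟨(‖x‖ + R + 1) / ‖w‖, h0, rfl⟩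
  simp only [mem_closedBall_zero_iff] at h1
  have h2 : ‖((‖x‖ + R + 1) / ‖w‖) • w‖ = ‖x‖ + R + 1 := by
    rw [norm_smul, Real.norm_of_nonneg h0]; field_simp
  have h3 := norm_sub_le (x + ((‖x‖ + R + 1) / ‖w‖) • w) x
  rw [add_sub_cancel_left, h2] at h3
  linarith

/-- A point from which some ray avoids the boundary is exterior. -/
lemma mem_outside_of_ray {x w : Plane} (hw : w ≠ 0)
    (h : ∀ τ : ℝ, 0 ≤ τ → x + τ • w ∉ P.boundary ℝ) : x ∈ P.outside := by
  have hx : x ∈ (fun τ : ℝ => x + τ • w) '' Set.Ici 0 := ⟨0, by simp, by simp⟩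
  have hd : (fun τ : ℝ => x + τ • w) '' Set.Ici 0 ⊆ (P.boundary ℝ)ᶜ := by
    rintro _ ⟨τ, hτ, rfl⟩; exact h τ hτ
  have hC : IsPreconnected ((fun τ : ℝ => x + τ • w) '' Set.Ici 0) :=
    isPreconnected_Ici.image _ (by fun_prop)
  exact ⟨hd hx, fun hb => not_isBounded_ray x hw (hb.subset (hC.subset_connectedComponentIn hx hd))⟩

lemma parity_eq_zero_of_mem_outside {h : Plane} (hh : h ≠ 0) {x : Plane} (hx : x ∈ P.outside) :
    P.parity h x = 0 := by
  obtain ⟨R, hR⟩ := (isCompact_boundary P).isBounded.subset_closedBall 0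
  have h2 := hx.2
  rw [isBounded_iff_forall_norm_le] at h2
  push Not at h2
  obtain ⟨y, hy, hyR⟩ := h2 (max R 0)
  rw [parity_eq hh isPreconnected_connectedComponentIn (connectedComponentIn_subset _ _)
    (mem_connectedComponentIn hx.1) hy]
  refine (isCycle_edges P).rayParity_eq_zero_of_norm hh (fun i _ => ?_) hyR (le_max_right _ _)
  have := fun j => mem_closedBall_zero_iff.1 (hR (vertex_mem_boundary P j))
  exact ⟨(this i).trans (le_max_left _ _), (this _).trans (le_max_left _ _)⟩

lemma mem_inside_of_parity {h : Plane} (hh : h ≠ 0) {x : Plane} (hx : x ∉ P.boundary ℝ)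
    (h1 : P.parity h x = 1) : x ∈ P.inside :=
  (inside_or_outside hx).resolve_right fun h2 => by
    rw [parity_eq_zero_of_mem_outside hh h2] at h1
    exact zero_ne_one h1

/-! ### The boundary near a vertex and near an edge -/

/-- Near a vertex the boundary consists of the two edges at that vertex. -/
lemma IsSimple.exists_ball_vertex (hs : P.IsSimple) (v : Fin n) :
    ∃ ε > 0, ∀ q ∈ Metric.ball (P v) ε, ∀ i, q ∈ segment ℝ (P i) (P (finRotate n i)) →
      i = v ∨ finRotate n i = v := by
  have : ∀ᶠ q in nhds (P v), ∀ i, q ∈ segment ℝ (P i) (P (finRotate n i)) →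
      i = v ∨ finRotate n i = v := by
    refine Filter.eventually_all.2 fun i => ?_
    by_cases hi : i = v ∨ finRotate n i = v
    · exact Filter.Eventually.of_forall fun _ _ => hi
    have hv : P v ∉ segment ℝ (P i) (P (finRotate n i)) := fun h =>
      hi ((hs.vertex_mem_edge h).imp Eq.symm Eq.symm)
    filter_upwards [(isCompact_segment _ _).isClosed.isOpen_compl.mem_nhds hv] with q hq h
    exact absurd h hq
  exact Metric.eventually_nhds_iff_ball.1 this

/-- Near a closed part of the relative interior of an edge the boundary consists of that edge. -/
lemma IsSimple.exists_thickening_edge (hs : P.IsSimple) {i : Fin n} {z z' : Plane}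
    (hz : z ∈ openSegment ℝ (P i) (P (finRotate n i)))
    (hz' : z' ∈ openSegment ℝ (P i) (P (finRotate n i))) :
    ∃ δ > 0, ∀ q ∈ Metric.thickening δ (segment ℝ z z'), ∀ j,
      q ∈ segment ℝ (P j) (P (finRotate n j)) → j = i := by
  have hcl : IsClosed (⋃ j ∈ {j | j ≠ i}, segment ℝ (P j) (P (finRotate n j))) :=
    (Set.toFinite _).isClosed_biUnion fun j _ => (isCompact_segment _ _).isClosed
  have hsub : segment ℝ z z' ⊆ (⋃ j ∈ {j | j ≠ i}, segment ℝ (P j) (P (finRotate n j)))ᶜ := by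
    intro q hq hq'
    have hq := (convex_openSegment _ _).segment_subset hz hz' hq
    simp only [Set.mem_ofPred_eq, Set.mem_iUnion] at hq'
    obtain ⟨j, hj, hq'⟩ := hq'
    exact Set.disjoint_left.1 (hs.openEdge_disjoint (Ne.symm hj)) hq hq'
  obtain ⟨δ, hδ, h⟩ := (isCompact_segment z z').exists_thickening_subset_open hcl.isOpen_compl hsub
  refine ⟨δ, hδ, fun q hq j hj => ?_⟩
  by_contra hji
  exact h hq (Set.mem_biUnion (show j ∈ {j | j ≠ i} from hji) hj)

/-! ### Extremal vertices -/

/-- The functional `cross h` attains its minimum over the vertices only at the vertex `v`. -/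
def IsExtremal (P : Polygon Plane n) (h : Plane) (v : Fin n) : Prop :=
  ∀ k, k ≠ v → 0 < cross h (P k - P v)

lemma crossing_of_extremal {h v a q : Plane} (h1 : 0 < cross h (q - v))
    (h2 : cross h (q - v) < cross h (a - v)) :
    crossing h v a q = if 0 < cross (a - v) (q - v) then 1 else 0 := by
  rw [cross_sub_right] at h1
  have h3 := h1.trans (by simpa only [cross_sub_right] using h2 : _ < cross h a - cross h v)
  unfold crossing
  have e1 : cross h v ≤ cross h q := by linarith
  have e2 : ¬ cross h a ≤ cross h q := by simp only [cross_sub_right] at h2; linarith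
  have e3 : 0 < cross h (a - v) := by rw [cross_sub_right]; exact h3
  simp only [e1, e2, not_false_eq_true, mul_pos_iff_of_pos_right e3, true_and]

/-- Near an extremal vertex, a point of the angle of the polygon has odd parity. -/
lemma IsExtremal.parity_eq_one {h : Plane} {v b : Fin n} (hv : P.IsExtremal h v) (hn : 3 ≤ n)
    (hb : finRotate n b = v) {q : Plane} (h1 : 0 < cross h (q - P v))
    (h2 : ∀ k, k ≠ v → cross h (q - P v) < cross h (P k - P v))
    (h3 : cross (q - P v) (P (finRotate n v) - P v) * cross (q - P v) (P b - P v) < 0) :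
    P.parity h q = 1 := by
  have hbv : b ≠ v := by rintro rfl; exact finRotate_ne hn b hb
  unfold parity rayParity
  rw [Finset.sum_eq_add v b hbv.symm]
  · dsimp only
    rw [hb, crossing_swap h (P v) (P b), crossing_of_extremal h1 (h2 _ (finRotate_ne hn v)),
      crossing_of_extremal h1 (h2 _ hbv), cross_swap (q - P v), cross_swap (q - P v)]
    rcases mul_neg_iff.1 h3 with ⟨h4, h5⟩ | ⟨h4, h5⟩
    · rw [if_neg (by linarith), if_pos (by linarith)]; rfl
    · rw [if_pos (by linarith), if_neg (by linarith)]; rfl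
  · intro i _ hi
    have e1 := h2 i hi.1
    have e2 := h2 (finRotate n i) (fun h => hi.2 ((finRotate n).injective (h.trans hb.symm)))
    simp only [cross_sub_right] at e1 e2
    unfold crossing
    rw [if_neg]
    rintro ⟨h4, -⟩
    have : ¬ cross h (P (finRotate n i)) ≤ cross h q := by linarith
    have := h4.2 this
    linarith
  · simp
  · simp

/-- At an extremal vertex `v` with neighbours `a` and `b`, a segment that leaves `v` outside of the
angle of the polygon is not interior. -/
lemma IsExtremal.not_subset_inside {h : Plane} {v : Fin n} (hv : P.IsExtremal h v)
    (hs : P.IsSimple) {a b s : Plane} {σ : ℝ}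
    (hedge : ∀ i, (i = v ∨ finRotate n i = v) →
      segment ℝ (P i) (P (finRotate n i)) = segment ℝ (P v) a ∨
      segment ℝ (P i) (P (finRotate n i)) = segment ℝ (P v) b)
    (hsa : 0 < σ * cross (s - P v) (a - P v)) (hsb : 0 < σ * cross (s - P v) (b - P v))
    (hab : 0 < σ * cross (a - P v) (b - P v)) (hb : 0 < cross h (b - P v)) :
    ¬ openSegment ℝ (P v) s ⊆ P.inside := by
  intro hsub
  obtain ⟨ε, hε, hball⟩ := hs.exists_ball_vertex v
  set K := Metric.ball (P v) ε ∩
    ({q | 0 < σ * cross (q - P v) (a - P v)} ∩ {q | 0 < σ * cross (q - P v) (b - P v)}) with hK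
  have hhalf : ∀ c : Plane, Convex ℝ {q : Plane | 0 < σ * cross (q - P v) (c - P v)} := by
    intro c x hx y hy α β hα hβ hαβ
    simp only [Set.mem_ofPred_eq] at *
    have : σ * cross (α • x + β • y - P v) (c - P v) =
        α * (σ * cross (x - P v) (c - P v)) + β * (σ * cross (y - P v) (c - P v)) := by
      obtain rfl : α = 1 - β := by linarith
      simp [cross]; ring
    rw [this]
    rcases hα.lt_or_eq with h | rfl
    · exact add_pos_of_pos_of_nonneg (mul_pos h hx) (mul_nonneg hβ hy.le)
    · rw [show β = 1 by linarith]; linarith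
  have hKc : Convex ℝ K := (convex_ball _ _).inter ((hhalf a).inter (hhalf b))
  have hseg : ∀ c q : Plane, q ∈ segment ℝ (P v) c → ¬ 0 < σ * cross (q - P v) (c - P v) := by
    intro c q hq
    obtain ⟨t, -, -, rfl⟩ := mem_segment_iff'.1 hq
    rw [add_sub_cancel_left, cross_smul_left, cross_self]; simp
  have hKd : K ⊆ (P.boundary ℝ)ᶜ := by
    rintro q ⟨hq1, hq2, hq3⟩ hq
    obtain ⟨i, hi⟩ := mem_boundary.1 hq
    rcases hedge i (hball q hq1 i hi) with h | h
    · exact hseg a q (h ▸ hi) hq2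
    · exact hseg b q (h ▸ hi) hq3
  -- all points `P v + τ • w` with small `τ > 0` lie in `K` if the direction `w` does
  have hdir : ∀ w : Plane, 0 < σ * cross w (a - P v) → 0 < σ * cross w (b - P v) →
      ∀ᶠ τ in nhdsWithin (0 : ℝ) (Set.Ioi 0), P v + τ • w ∈ K := by
    intro w h1 h2
    have hc : ContinuousAt (fun τ : ℝ => P v + τ • w) 0 := by fun_prop
    have := hc.eventually (by simpa using Metric.ball_mem_nhds (P v) hε :
      Metric.ball (P v) ε ∈ nhds (P v + (0 : ℝ) • w))
    filter_upwards [nhdsWithin_le_nhds this, self_mem_nhdsWithin] with τ h3 h4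
    refine ⟨h3, ?_, ?_⟩ <;> simp only [Set.mem_ofPred_eq, add_sub_cancel_left, cross_smul_left]
    · have := mul_pos (Set.mem_Ioi.1 h4) h1; linarith
    · have := mul_pos (Set.mem_Ioi.1 h4) h2; linarith
  obtain ⟨τ, ⟨hτK, hτ0⟩, hτ1⟩ : ∃ τ : ℝ, (P v + τ • (s - P v) ∈ K ∧ 0 < τ) ∧ τ < 1 :=
    (((hdir _ hsa hsb).and self_mem_nhdsWithin).and
      (nhdsWithin_le_nhds (gt_mem_nhds one_pos))).exists
  have hin := hsub (mem_openSegment_iff'.2 ⟨τ, hτ0, hτ1, rfl⟩)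
  -- a direction of the same sector in which `cross h` decreases
  obtain ⟨δ, hδ, hδ'⟩ : ∃ δ : ℝ, 0 < δ ∧ cross h (-(b - P v) + δ • (s - P v)) < 0 := by
    have hc : Continuous fun δ : ℝ => cross h (-(b - P v) + δ • (s - P v)) := by fun_prop
    have h0 : cross h (-(b - P v) + (0 : ℝ) • (s - P v)) < 0 := by
      rw [zero_smul, add_zero, cross_neg_right]; linarith
    have := hc.continuousAt.eventually (gt_mem_nhds h0)
    obtain ⟨δ, h1, h2⟩ := ((this.filter_mono nhdsWithin_le_nhds).and
      (self_mem_nhdsWithin (s := Set.Ioi (0 : ℝ)))).exists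
    exact ⟨δ, h2, h1⟩
  set w := -(b - P v) + δ • (s - P v) with hw
  have hwa : 0 < σ * cross w (a - P v) := by
    rw [hw, cross_add_left, cross_neg_left, cross_smul_left, cross_swap (a - P v)]
    nlinarith [mul_pos hδ hsa]
  have hwb : 0 < σ * cross w (b - P v) := by
    rw [hw, cross_add_left, cross_neg_left, cross_smul_left, cross_self]
    nlinarith [mul_pos hδ hsb]
  obtain ⟨η, hηK, hη⟩ := ((hdir w hwa hwb).and self_mem_nhdsWithin).exists
  have hη0 : 0 < η := hη
  have hwne : w ≠ 0 := by rintro h0; rw [h0, cross_zero_right] at hδ'; exact lt_irrefl _ hδ'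
  have hout : P v + η • w ∈ P.outside := by
    refine mem_outside_of_ray hwne fun τ hτ hmem => ?_
    have hneg : cross h (P v + η • w + τ • w - P v) < 0 := by
      have : P v + η • w + τ • w - P v = (η + τ) • w := by rw [add_smul]; abel
      rw [this, cross_smul_right]
      exact mul_neg_of_pos_of_neg (by linarith) hδ'
    obtain ⟨i, hi⟩ := mem_boundary.1 hmem
    have hnn : ∀ k, 0 ≤ cross h (P k - P v) := fun k => by
      by_cases hk : k = v
      · rw [hk, sub_self, cross_zero_right]
      · exact (hv k hk).le
    obtain ⟨t, h0, h1, ht⟩ := mem_segment_iff'.1 hi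
    have e : P i + t • (P (finRotate n i) - P i) - P v =
        (1 - t) • (P i - P v) + t • (P (finRotate n i) - P v) := by module
    rw [ht, e, cross_add_right, cross_smul_right, cross_smul_right] at hneg
    nlinarith [mul_nonneg (sub_nonneg.2 h1) (hnn i), mul_nonneg h0 (hnn (finRotate n i))]
  exact Set.disjoint_left.1 disjoint_inside_outside hin
    (mem_outside_of_mem hKc.isPreconnected hKd hηK hτK hout)

/-! ### The two sides of the boundary curve -/

lemma exists_cross_pos {x : Plane} (hx : x ≠ 0) {σ : ℝ} (hσ : σ ≠ 0) :
    ∃ w : Plane, 0 < σ * cross x w := by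
  refine ⟨σ • WithLp.toLp 2 ![-x 1, x 0], ?_⟩
  have e : cross x (WithLp.toLp 2 ![-x 1, x 0]) = dot x x := by simp [cross, dot]
  rw [cross_smul_right, e]
  have := mul_pos (mul_self_pos.2 hσ) (dot_self_pos hx)
  linarith

lemma eventually_add_smul_mem {z w : Plane} {U : Set Plane} (hU : U ∈ nhds z) :
    ∀ᶠ τ in nhdsWithin (0 : ℝ) (Set.Ioi 0), z + τ • w ∈ U := by
  have hc : ContinuousAt (fun τ : ℝ => z + τ • w) 0 := by fun_prop
  exact (hc.eventually (by simpa using hU)).filter_mono nhdsWithin_le_nhds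

/-- The set `K` contains all points near `z` on the side of edge `i` given by the sign `σ`. -/
def TouchesAt (P : Polygon Plane n) (K : Set Plane) (i : Fin n) (σ : ℝ) (z : Plane) : Prop :=
  ∃ ε > 0, ∀ q ∈ Metric.ball z ε, 0 < σ * orient (P i) (P (finRotate n i)) q → q ∈ K

/-- The set `K` swallows every preconnected set off the boundary that meets it. -/
def Absorbs (P : Polygon Plane n) (K : Set Plane) : Prop :=
  ∀ C : Set Plane, IsPreconnected C → C ⊆ (P.boundary ℝ)ᶜ → (C ∩ K).Nonempty → C ⊆ K

lemma absorbs_connectedComponentIn (P : Polygon Plane n) (x : Plane) :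
    Absorbs P (connectedComponentIn (P.boundary ℝ)ᶜ x) := by
  rintro C hC hd ⟨y, hyC, hy⟩
  rw [connectedComponentIn_eq hy]
  exact hC.subset_connectedComponentIn hyC hd

lemma convex_halfPlane (a b : Plane) (σ : ℝ) : Convex ℝ {q : Plane | 0 < σ * orient a b q} := by
  intro x hx y hy α β hα hβ hαβ
  simp only [Set.mem_ofPred_eq] at *
  rw [orient_combo a b x y hαβ, mul_add]
  rcases hα.lt_or_eq with h | rfl
  · nlinarith [mul_pos h hx, mul_nonneg hβ hy.le]
  · rw [show β = 1 by linarith]; linarith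

lemma orient_eq_zero_of_mem_segment {a b q : Plane} (h : q ∈ segment ℝ a b) : orient a b q = 0 := by
  obtain ⟨t, -, -, rfl⟩ := mem_segment_iff'.1 h
  rw [orient_segment]; simp

lemma orient_add_smul (a b z w : Plane) (τ : ℝ) :
    orient a b (z + τ • w) = orient a b z + τ * cross (b - a) w := by
  simp [orient, cross]; ring

/-- There are points of the prescribed side of the edge arbitrarily close to any of its points. -/
lemma eventually_side {a b z w : Plane} {σ : ℝ} (hz : z ∈ segment ℝ a b)
    (hw : 0 < σ * cross (b - a) w) :
    ∀ᶠ τ in nhdsWithin (0 : ℝ) (Set.Ioi 0), 0 < σ * orient a b (z + τ • w) := by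
  filter_upwards [self_mem_nhdsWithin] with τ hτ
  rw [orient_add_smul, orient_eq_zero_of_mem_segment hz, zero_add, mul_left_comm]
  exact mul_pos hτ hw

/-- If `K` meets the side `σ` of edge `i` near a point of the edge, it touches the edge on that
side at every point. -/
lemma IsSimple.touchesAt_of_frequently (hs : P.IsSimple) {K : Set Plane} (hK : Absorbs P K)
    {i : Fin n} {σ : ℝ} {z z' : Plane} (hz : z ∈ openSegment ℝ (P i) (P (finRotate n i)))
    (hz' : z' ∈ openSegment ℝ (P i) (P (finRotate n i)))
    (h : ∃ᶠ q in nhds z, q ∈ K ∧ 0 < σ * orient (P i) (P (finRotate n i)) q) :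
    TouchesAt P K i σ z' := by
  obtain ⟨δ, hδ, hth⟩ := hs.exists_thickening_edge hz hz'
  have hC : Convex ℝ (Metric.thickening δ (segment ℝ z z') ∩
      {q | 0 < σ * orient (P i) (P (finRotate n i)) q}) :=
    ((convex_segment _ _).thickening δ).inter (convex_halfPlane _ _ _)
  have hmem : ∀ y ∈ segment ℝ z z', Metric.ball y δ ⊆ Metric.thickening δ (segment ℝ z z') :=
    fun y hy => Metric.ball_subset_thickening hy δ
  have hsub := hK _ hC.isPreconnected (by
    rintro q ⟨hq1, hq2⟩ hq
    obtain ⟨j, hj⟩ := mem_boundary.1 hq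
    obtain rfl := hth q hq1 j hj
    simp only [Set.mem_ofPred_eq, orient_eq_zero_of_mem_segment hj, mul_zero,
      lt_self_iff_false] at hq2) (by
    obtain ⟨q, ⟨hq1, hq2⟩, hq3⟩ := (h.and_eventually (Metric.ball_mem_nhds z hδ)).exists
    exact ⟨q, ⟨hmem z (left_mem_segment ℝ _ _) hq3, hq2⟩, hq1⟩)
  exact ⟨δ, hδ, fun q hq1 hq2 => hsub ⟨hmem z' (right_mem_segment ℝ _ _) hq1, hq2⟩⟩

lemma IsSimple.edge_ne_zero (hs : P.IsSimple) (i : Fin n) : P (finRotate n i) - P i ≠ 0 :=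
  sub_ne_zero.2 (hs.ne (finRotate_ne hs.three_le i))

lemma IsSimple.frequently_of_touchesAt (hs : P.IsSimple) {K : Set Plane}
    {i : Fin n} {σ : ℝ} (hσ : σ ≠ 0) {z : Plane}
    (hz : z ∈ openSegment ℝ (P i) (P (finRotate n i))) (h : TouchesAt P K i σ z) :
    ∃ᶠ q in nhds z, q ∈ K ∧ 0 < σ * orient (P i) (P (finRotate n i)) q := by
  obtain ⟨ε, hε, h⟩ := h
  obtain ⟨w, hw⟩ := exists_cross_pos (hs.edge_ne_zero i) hσ
  rw [Filter.frequently_iff]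
  intro U hU
  obtain ⟨τ, ⟨h1, h2⟩, h3⟩ := (((eventually_add_smul_mem (w := w) hU).and
    (eventually_add_smul_mem (w := w) (Metric.ball_mem_nhds z hε))).and
    (eventually_side (openSegment_subset_segment _ _ _ hz) hw)).exists
  exact ⟨_, h1, h _ h2 h3, h3⟩

lemma IsSimple.touchesAt_edge (hs : P.IsSimple) {K : Set Plane} (hK : Absorbs P K)
    {i : Fin n} {σ : ℝ} (hσ : σ ≠ 0) {z z' : Plane}
    (hz : z ∈ openSegment ℝ (P i) (P (finRotate n i)))
    (hz' : z' ∈ openSegment ℝ (P i) (P (finRotate n i))) (h : TouchesAt P K i σ z) :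
    TouchesAt P K i σ z' :=
  hs.touchesAt_of_frequently hK hz hz' (hs.frequently_of_touchesAt hσ hz h)

/-- A component that touches one edge touches the next edge on the same side: at the common vertex
the side is either a convex sector of a small disc, or the union of two overlapping half discs. -/
lemma IsSimple.touchesAt_next (hs : P.IsSimple) (hg : P.InGeneralPosition) {K : Set Plane}
    (hK : Absorbs P K) {i : Fin n} {σ : ℝ} (hσ : σ ≠ 0) {z : Plane}
    (hz : z ∈ openSegment ℝ (P i) (P (finRotate n i))) (h : TouchesAt P K i σ z) :
    ∃ z' ∈ openSegment ℝ (P (finRotate n i)) (P (finRotate n (finRotate n i))),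
      TouchesAt P K (finRotate n i) σ z' := by
  have hn := hs.three_le
  have hcr := hg.orient_ne_zero (finRotate_ne hn i).symm (finRotate_ne hn (finRotate n i)).symm
    (finRotate_finRotate_ne hn i).symm
  obtain ⟨ε, hε, hball⟩ := hs.exists_ball_vertex (finRotate n i)
  have hball' : ∀ q ∈ Metric.ball (P (finRotate n i)) ε, q ∈ P.boundary ℝ →
      q ∈ segment ℝ (P i) (P (finRotate n i)) ∨
      q ∈ segment ℝ (P (finRotate n i)) (P (finRotate n (finRotate n i))) := by
    intro q hq hqB
    obtain ⟨j, hj⟩ := mem_boundary.1 hqB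
    rcases hball q hq j hj with rfl | h1
    · exact Or.inr hj
    · obtain rfl := (finRotate n).injective h1
      exact Or.inl hj
  have e1 := hs.edge_ne_zero i
  have e2 := hs.edge_ne_zero (finRotate n i)
  have hne1 := hs.ne (finRotate_ne hn i).symm
  have hne2 := hs.ne (finRotate_ne hn (finRotate n i)).symm
  have htouch : ∀ z ∈ openSegment ℝ (P i) (P (finRotate n i)), TouchesAt P K i σ z := fun z' hz' =>
    hs.touchesAt_edge hK hσ hz hz' h
  suffices hsuff : ∃ z' ∈ openSegment ℝ (P (finRotate n i)) (P (finRotate n (finRotate n i))),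
      ∃ᶠ q in nhds z', q ∈ K ∧
        0 < σ * orient (P (finRotate n i)) (P (finRotate n (finRotate n i))) q by
    obtain ⟨z', hz', h'⟩ := hsuff
    exact ⟨z', hz', hs.touchesAt_of_frequently hK hz' hz' h'⟩
  clear hball h hz
  generalize P (finRotate n (finRotate n i)) = c at *
  have htf : ∀ z ∈ openSegment ℝ (P i) (P (finRotate n i)),
      ∃ᶠ q in nhds z, q ∈ K ∧ 0 < σ * orient (P i) (P (finRotate n i)) q := fun z hz =>
    hs.frequently_of_touchesAt hσ hz (htouch z hz)
  generalize P (finRotate n i) = b at *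
  generalize P i = a at *
  set A := Metric.ball b ε ∩ {q | 0 < σ * orient a b q} with hA
  set B := Metric.ball b ε ∩ {q | 0 < σ * orient b c q} with hB
  have hAc : Convex ℝ A := (convex_ball _ _).inter (convex_halfPlane _ _ _)
  have hBc : Convex ℝ B := (convex_ball _ _).inter (convex_halfPlane _ _ _)
  have hpos : ∀ {τ : ℝ}, τ ∈ Set.Ioi (0 : ℝ) → 0 < τ := fun h => h
  -- points of both edges close to the common vertex
  obtain ⟨τ, ⟨⟨hτ1, hτ2⟩, hτ3⟩, hτ4⟩ := (((eventually_add_smul_mem (w := a - b)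
    (Metric.ball_mem_nhds b hε)).and (eventually_add_smul_mem (w := c - b)
    (Metric.ball_mem_nhds b hε))).and ((gt_mem_nhds (one_pos (α := ℝ))).filter_mono
    (nhdsWithin_le_nhds (s := Set.Ioi 0)))).and self_mem_nhdsWithin |>.exists
  replace hτ4 : 0 < τ := hτ4
  set z := b + τ • (a - b)
  set z' := b + τ • (c - b)
  have hz : z ∈ openSegment ℝ a b := by
    rw [openSegment_symm]; exact mem_openSegment_iff'.2 ⟨τ, hτ4, hτ3, rfl⟩
  have hz' : z' ∈ openSegment ℝ b c := mem_openSegment_iff'.2 ⟨τ, hτ4, hτ3, rfl⟩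
  have hbz : ∀ t : ℝ, orient b c (b + t • (a - b)) = t * orient a b c := by
    intro t; simp [orient, cross]; ring
  have haz : ∀ t : ℝ, orient a b (b + t • (c - b)) = t * orient a b c := by
    intro t; simp [orient, cross]; ring
  obtain ⟨w, hw⟩ := exists_cross_pos e2 hσ
  refine ⟨z', hz', ?_⟩
  have hfreq : ∀ U ∈ nhds z', U ∩ {q | 0 < σ * orient b c q} ⊆ K →
      ∃ᶠ q in nhds z', q ∈ K ∧ 0 < σ * orient b c q := by
    intro U hU hUK
    rw [Filter.frequently_iff]
    intro V hV
    obtain ⟨t, h1, h2⟩ := ((eventually_add_smul_mem (w := w) (Filter.inter_mem hU hV)).and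
      (eventually_side (openSegment_subset_segment _ _ _ hz') hw)).exists
    exact ⟨_, h1.2, hUK ⟨h1.1, h2⟩, h2⟩
  have hopenA : IsOpen A := Metric.isOpen_ball.inter (isOpen_lt (by fun_prop) (by fun_prop))
  rcases lt_or_gt_of_ne (mul_ne_zero hσ hcr) with hlt | hlt
  · have hAd : A ⊆ (P.boundary ℝ)ᶜ := by
      rintro q ⟨hq1, hq2⟩ hq
      simp only [Set.mem_ofPred_eq] at hq2
      rcases hball' q hq1 hq with h | h
      · simp [orient_eq_zero_of_mem_segment h] at hq2
      · obtain ⟨t, h0, -, rfl⟩ := mem_segment_iff'.1 h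
        rw [haz] at hq2; nlinarith
    have hBd : B ⊆ (P.boundary ℝ)ᶜ := by
      rintro q ⟨hq1, hq2⟩ hq
      simp only [Set.mem_ofPred_eq] at hq2
      rcases hball' q hq1 hq with h | h
      · rw [segment_symm] at h
        obtain ⟨t, h0, -, rfl⟩ := mem_segment_iff'.1 h
        rw [hbz] at hq2; nlinarith
      · simp [orient_eq_zero_of_mem_segment h] at hq2
    have hAK : A ⊆ K := hK A hAc.isPreconnected hAd (by
      obtain ⟨q, ⟨h1, h2⟩, h3⟩ := ((htf z hz).and_eventually
        (Metric.isOpen_ball.mem_nhds hτ1)).exists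
      exact ⟨q, ⟨h3, h2⟩, h1⟩)
    have hBK : B ⊆ K := hK B hBc.isPreconnected hBd (by
      obtain ⟨t, h1, h2⟩ := ((eventually_add_smul_mem (w := (b - a) - (c - b))
        (Metric.ball_mem_nhds b hε)).and self_mem_nhdsWithin).exists
      have h2 : 0 < t := h2
      have e1 : orient a b (b + t • ((b - a) - (c - b))) = -(t * orient a b c) := by
        simp [orient, cross]; ring
      have e2 : orient b c (b + t • ((b - a) - (c - b))) = -(t * orient a b c) := by
        simp [orient, cross]; ring
      refine ⟨_, ⟨h1, ?_⟩, hAK ⟨h1, ?_⟩⟩ <;> simp only [Set.mem_ofPred_eq]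
      · rw [e2]; nlinarith
      · rw [e1]; nlinarith)
    exact hfreq _ (Metric.isOpen_ball.mem_nhds hτ2) hBK
  · have hWd : A ∩ B ⊆ (P.boundary ℝ)ᶜ := by
      rintro q ⟨⟨hq1, hq2⟩, -, hq3⟩ hq
      rcases hball' q hq1 hq with h | h
      · simp [orient_eq_zero_of_mem_segment h] at hq2
      · simp [orient_eq_zero_of_mem_segment h] at hq3
    have hopenB : IsOpen B := Metric.isOpen_ball.inter (isOpen_lt (by fun_prop) (by fun_prop))
    have hzB : z ∈ B := ⟨hτ1, by simp only [Set.mem_ofPred_eq, z]; rw [hbz]; nlinarith⟩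
    have hzA : z' ∈ A := ⟨hτ2, by simp only [Set.mem_ofPred_eq, z']; rw [haz]; nlinarith⟩
    have hWK : A ∩ B ⊆ K := hK _ (hAc.inter hBc).isPreconnected hWd (by
      obtain ⟨q, ⟨h1, h2⟩, h3⟩ := ((htf z hz).and_eventually (hopenB.mem_nhds hzB)).exists
      exact ⟨q, ⟨⟨h3.1, h2⟩, h3⟩, h1⟩)
    exact hfreq A (hopenA.mem_nhds hzA) fun q hq => hWK ⟨hq.1, hq.1.1, hq.2⟩

/-- A component that touches the boundary curve somewhere touches it everywhere on that side. -/
lemma IsSimple.touchesAt_all (hs : P.IsSimple) (hg : P.InGeneralPosition) {K : Set Plane}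
    (hK : Absorbs P K) {i : Fin n} {σ : ℝ} (hσ : σ ≠ 0) {z : Plane}
    (hz : z ∈ openSegment ℝ (P i) (P (finRotate n i))) (h : TouchesAt P K i σ z)
    (j : Fin n) {z' : Plane} (hz' : z' ∈ openSegment ℝ (P j) (P (finRotate n j))) :
    TouchesAt P K j σ z' := by
  have := forall_of_finRotate (p := fun j => ∃ z ∈ openSegment ℝ (P j) (P (finRotate n j)),
    TouchesAt P K j σ z) ⟨z, hz, h⟩
    (fun j ⟨z, hz, h⟩ => hs.touchesAt_next hg hK hσ hz h) j
  obtain ⟨y, hy, hy'⟩ := this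
  exact hs.touchesAt_edge hK hσ hy hz' hy'

lemma one_lt_rank_plane : 1 < Module.rank ℝ Plane := by
  rw [← Module.finrank_eq_rank, finrank_euclideanSpace_fin]
  norm_num

/-- Every component of the complement of the boundary curve touches it: otherwise its frontier
would consist of vertices, and finitely many points do not separate the plane. -/
lemma IsSimple.exists_touchesAt (hs : P.IsSimple) {x : Plane} (hx : x ∉ P.boundary ℝ) :
    ∃ i, ∃ z ∈ openSegment ℝ (P i) (P (finRotate n i)), ∃ σ : ℝ, (σ = 1 ∨ σ = -1) ∧
      TouchesAt P (connectedComponentIn (P.boundary ℝ)ᶜ x) i σ z := by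
  set K := connectedComponentIn (P.boundary ℝ)ᶜ x with hKdef
  have hK : Absorbs P K := absorbs_connectedComponentIn P x
  have hKo : IsOpen K := (isOpen_compl_boundary P).connectedComponentIn
  have hxK : x ∈ K := mem_connectedComponentIn hx
  have hKB : K ⊆ (P.boundary ℝ)ᶜ := connectedComponentIn_subset _ _
  have hfr : closure K \ K ⊆ P.boundary ℝ := by
    rintro z ⟨hz1, hz2⟩
    by_contra hzB
    obtain ⟨y, hy1, hy2⟩ := mem_closure_iff.1 hz1 _ (isOpen_compl_boundary P).connectedComponentIn
      (mem_connectedComponentIn hzB)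
    exact hz2 (hK _ isPreconnected_connectedComponentIn (connectedComponentIn_subset _ _)
      ⟨y, hy1, hy2⟩ (mem_connectedComponentIn hzB))
  obtain ⟨z, hzK, hzP⟩ : ∃ z ∈ closure K \ K, z ∉ Set.range P.vertices := by
    by_contra! hcon
    have hconn : IsPreconnected (Set.range P.vertices)ᶜ :=
      ((Set.finite_range _).countable.isConnected_compl_of_one_lt_rank
        one_lt_rank_plane).isPreconnected
    have hsub : (Set.range P.vertices)ᶜ ⊆ K := by
      refine hconn.subset_left_of_subset_union hKo isClosed_closure.isOpen_compl
        (Set.disjoint_left.2 fun y h1 h2 => h2 (subset_closure h1)) ?_ ?_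
      · intro y hy
        by_contra h
        simp only [Set.mem_union, Set.mem_compl_iff, not_or, not_not] at h
        exact hy (hcon y ⟨h.2, h.1⟩)
      · refine ⟨x, ?_, hxK⟩
        rintro ⟨k, rfl⟩
        exact hx (vertex_mem_boundary P k)
    have i : Fin n := ⟨0, by have := hs.three_le; omega⟩
    obtain ⟨y, hy⟩ : ∃ y, y ∈ openSegment ℝ (P i) (P (finRotate n i)) :=
      ⟨_, mem_openSegment_iff'.2 ⟨1 / 2, by norm_num, by norm_num, rfl⟩⟩
    have hyB : y ∈ P.boundary ℝ := mem_boundary.2 ⟨i, openSegment_subset_segment _ _ _ hy⟩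
    refine hKB (hsub ?_) hyB
    rintro ⟨k, rfl⟩
    rcases hs.vertex_mem_edge (openSegment_subset_segment _ _ _ hy) with rfl | rfl
    · exact left_notMem_openSegment (hs.ne (finRotate_ne hs.three_le k).symm) hy
    · exact right_notMem_openSegment (hs.ne (finRotate_ne hs.three_le i).symm) hy
  obtain ⟨i, hi⟩ := mem_boundary.1 (hfr hzK)
  have hz : z ∈ openSegment ℝ (P i) (P (finRotate n i)) := by
    rcases mem_segment_cases hi with h | h | h
    · exact absurd ⟨_, h.symm⟩ hzP
    · exact absurd ⟨_, h.symm⟩ hzP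
    · exact h
  refine ⟨i, z, hz, ?_⟩
  have key : ∃ᶠ q in nhds z, q ∈ K ∧ orient (P i) (P (finRotate n i)) q ≠ 0 := by
    rw [Filter.frequently_iff]
    intro U hU
    obtain ⟨V, hVU, hVo, hzV⟩ := mem_nhds_iff.1 hU
    obtain ⟨q, hqV, hqK⟩ := mem_closure_iff.1 hzK.1 V hVo hzV
    by_cases hq : orient (P i) (P (finRotate n i)) q = 0
    · obtain ⟨w, hw⟩ := exists_cross_pos (hs.edge_ne_zero i) one_ne_zero
      obtain ⟨τ, h1, h2⟩ := ((eventually_add_smul_mem (w := w)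
        ((hVo.inter hKo).mem_nhds ⟨hqV, hqK⟩)).and self_mem_nhdsWithin).exists
      have h2 : 0 < τ := h2
      refine ⟨_, hVU h1.1, h1.2, ?_⟩
      rw [orient_add_smul, hq, zero_add]
      rw [one_mul] at hw
      exact (mul_pos h2 hw).ne'
    · exact ⟨q, hVU hqV, hqK, hq⟩
  have key2 : (∃ᶠ q in nhds z, q ∈ K ∧ 0 < 1 * orient (P i) (P (finRotate n i)) q) ∨
      ∃ᶠ q in nhds z, q ∈ K ∧ 0 < -1 * orient (P i) (P (finRotate n i)) q := by
    rw [← Filter.frequently_or_distrib]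
    refine key.mono fun q hq => ?_
    rcases lt_or_gt_of_ne hq.2 with h | h
    · exact Or.inr ⟨hq.1, by linarith⟩
    · exact Or.inl ⟨hq.1, by linarith⟩
  rcases key2 with h | h
  · exact ⟨1, Or.inl rfl, hs.touchesAt_of_frequently hK hz hz h⟩
  · exact ⟨-1, Or.inr rfl, hs.touchesAt_of_frequently hK hz hz h⟩

lemma exists_mem_openSegment_generic {h a b : Plane} (hab : cross h a ≠ cross h b) {F : Set ℝ}
    (hF : F.Finite) : ∃ x ∈ openSegment ℝ a b, cross h x ∉ F := by
  have hd : cross h (b - a) ≠ 0 := by rw [cross_sub_right]; exact sub_ne_zero.2 hab.symm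
  have hinj : Function.Injective fun τ : ℝ => cross h (a + τ • (b - a)) := by
    intro s t hst
    simp only [cross_add_right, cross_smul_right, add_right_inj] at hst
    exact mul_right_cancel₀ hd hst
  obtain ⟨τ, hτ, hτ'⟩ := (Set.Ioo_infinite (zero_lt_one (α := ℝ))).exists_notMem_finite
    (hF.preimage hinj.injOn)
  exact ⟨_, mem_openSegment_iff'.2 ⟨τ, hτ.1, hτ.2, rfl⟩, hτ'⟩

/-- The hard half of the Jordan curve theorem for polygons: interior points have odd parity.  A
component with even parity touches the curve on the same side as the exterior does. -/
lemma IsSimple.parity_eq_one_of_mem_inside (hs : P.IsSimple) (hg : P.InGeneralPosition) {h : Plane}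
    (hh : h ≠ 0) {x : Plane} (hx : x ∈ P.inside) : P.parity h x = 1 := by
  have hn := hs.three_le
  obtain ⟨o, ho⟩ : ∃ o, o ∈ P.outside := by
    obtain ⟨R, hR⟩ := (isCompact_boundary P).isBounded.subset_closedBall 0
    obtain ⟨w, hw⟩ : ∃ w : Plane, w ≠ 0 := exists_ne 0
    have hw' := norm_pos_iff.2 hw
    refine ⟨((|R| + 1) / ‖w‖) • w, mem_outside_of_ray hw fun τ hτ hmem => ?_⟩
    have h1 := mem_closedBall_zero_iff.1 (hR hmem)
    rw [← add_smul, norm_smul, Real.norm_of_nonneg (by positivity), add_mul,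
      div_mul_cancel₀ _ hw'.ne'] at h1
    nlinarith [le_abs_self R, mul_nonneg hτ hw'.le]
  -- an edge that is not parallel to `h`
  obtain ⟨i, hi⟩ : ∃ i, cross h (P i) ≠ cross h (P (finRotate n i)) := by
    by_contra! hcon
    have i : Fin n := ⟨0, by omega⟩
    have e1 := eq_smul_of_cross_eq_zero hh (y := P (finRotate n i) - P i)
      (by rw [cross_sub_right, hcon i, sub_self])
    have e2 := eq_smul_of_cross_eq_zero hh (y := P (finRotate n (finRotate n i)) - P i)
      (by rw [cross_sub_right, hcon i, hcon (finRotate n i), sub_self])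
    refine hg.orient_ne_zero (finRotate_ne hn i).symm (finRotate_ne hn (finRotate n i)).symm
      (finRotate_finRotate_ne hn i).symm ?_
    rw [orient, e1, e2, cross_smul_left, cross_smul_right, cross_self]; simp
  obtain ⟨z, hz, hzF⟩ := exists_mem_openSegment_generic hi
    (Set.finite_range fun k => cross h (P k))
  have hside : ∀ y ∉ P.boundary ℝ, ∃ σ : ℝ, (σ = 1 ∨ σ = -1) ∧
      TouchesAt P (connectedComponentIn (P.boundary ℝ)ᶜ y) i σ z := by
    intro y hy
    obtain ⟨j, z', hz', σ, hσ, ht⟩ := hs.exists_touchesAt hy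
    have hσ0 : σ ≠ 0 := by rcases hσ with rfl | rfl <;> norm_num
    exact ⟨σ, hσ, hs.touchesAt_all hg (absorbs_connectedComponentIn P y) hσ0 hz' ht i hz⟩
  obtain ⟨σ, hσ, hσt⟩ := hside x hx.1
  obtain ⟨ρ, hρ, hρt⟩ := hside o ho.1
  have hσ0 : σ ≠ 0 := by rcases hσ with rfl | rfl <;> norm_num
  have hρ0 : ρ ≠ 0 := by rcases hρ with rfl | rfl <;> norm_num
  obtain ⟨δ, hδ, hσt'⟩ := id hσt
  by_cases hσρ : σ = ρ
  · exfalso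
    subst hσρ
    obtain ⟨q, ⟨h1, h2⟩, h3⟩ := ((hs.frequently_of_touchesAt hσ0 hz hρt).and_eventually
      (Metric.ball_mem_nhds z hδ)).exists
    have h4 := hσt' q h3 h2
    have h5 := (connectedComponentIn_eq h4).trans (connectedComponentIn_eq h1).symm
    exact ho.2 (h5 ▸ hx.2)
  have hneg : σ * ρ < 0 := by
    rcases hσ with rfl | rfl <;> rcases hρ with rfl | rfl <;>
      first | exact absurd rfl hσρ | norm_num
  have hjump := rayParity_jump (h := h) (A := Finset.univ) (s := fun i => P i)
    (t := fun i => P (finRotate n i)) (Finset.mem_univ i) hz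
    (fun j _ => ⟨fun h => hzF ⟨j, h⟩, fun h => hzF ⟨_, h⟩⟩)
    (fun j _ hji hmem => Set.disjoint_left.1 (hs.openEdge_disjoint hji.symm) hz hmem) hh
  have hfr := (hs.frequently_of_touchesAt hσ0 hz hσt)
  have hfr' := (hs.frequently_of_touchesAt hρ0 hz hρt)
  rw [Filter.eventually_prod_iff] at hjump
  obtain ⟨p1, hp1, p2, hp2, hjump⟩ := hjump
  obtain ⟨q, ⟨hq1, hq2⟩, hq3⟩ := (hfr.and_eventually hp1).exists
  obtain ⟨r, ⟨hr1, hr2⟩, hr3⟩ := (hfr'.and_eventually hp2).exists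
  have hlt : orient (P i) (P (finRotate n i)) q * orient (P i) (P (finRotate n i)) r < 0 := by
    by_contra! h0
    nlinarith [mul_pos hq2 hr2]
  have := hjump hq3 hr3 hlt
  have hq : P.parity h q = P.parity h x := parity_eq hh isPreconnected_connectedComponentIn
    (connectedComponentIn_subset _ _) hq1 (mem_connectedComponentIn hx.1)
  have hr : P.parity h r = P.parity h o := parity_eq hh isPreconnected_connectedComponentIn
    (connectedComponentIn_subset _ _) hr1 (mem_connectedComponentIn ho.1)
  rw [← hq]
  rw [parity_eq_zero_of_mem_outside hh ho] at hr
  change P.parity h q + P.parity h r = 1 at this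
  rwa [hr, add_zero] at this

/-! ### Three rays at a vertex -/

section ThreeRays

variable {ι : Type*} {s t : ι → Plane}

/-- The `i`-th segment of the family issues from `a` in direction `r`. -/
def IsRay (s t : ι → Plane) (i : ι) (a r : Plane) : Prop :=
  (s i = a ∧ t i = a + r) ∨ (t i = a ∧ s i = a + r)

lemma IsRay.mem_segment {i : ι} {a r q : Plane} (hi : IsRay s t i a r)
    (hq : q ∈ segment ℝ (s i) (t i)) : ∃ γ : ℝ, 0 ≤ γ ∧ q = a + γ • r := by
  rcases hi with ⟨h1, h2⟩ | ⟨h1, h2⟩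
  · rw [h1, h2] at hq
    obtain ⟨γ, h0, -, rfl⟩ := mem_segment_iff'.1 hq
    exact ⟨γ, h0, by simp⟩
  · rw [h1, h2, segment_symm] at hq
    obtain ⟨γ, h0, -, rfl⟩ := mem_segment_iff'.1 hq
    exact ⟨γ, h0, by simp⟩

lemma IsRay.mem_openSegment {i : ι} {a r : Plane} (hi : IsRay s t i a r) {τ : ℝ} (h0 : 0 < τ)
    (h1 : τ < 1) : a + τ • r ∈ openSegment ℝ (s i) (t i) := by
  rcases hi with ⟨h2, h3⟩ | ⟨h2, h3⟩
  · rw [h2, h3]; exact mem_openSegment_iff'.2 ⟨τ, h0, h1, by simp⟩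
  · rw [h2, h3, openSegment_symm]; exact mem_openSegment_iff'.2 ⟨τ, h0, h1, by simp⟩

lemma IsRay.orient_mul {i : ι} {a r : Plane} (hi : IsRay s t i a r) (τ η : ℝ) (u v : Plane) :
    orient (s i) (t i) (a + τ • r + η • u) * orient (s i) (t i) (a + τ • r + η • v) =
      η ^ 2 * (cross r u * cross r v) := by
  rcases hi with ⟨h2, h3⟩ | ⟨h2, h3⟩ <;> rw [h2, h3] <;> simp [orient, cross] <;> ring

/-- Let three cycles modulo two with zero sum each contain two of three rays at `a`. Then the
parities of each cycle along the ray that it omits add up to one. Here `r₂` is the ray that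
separates the other two. -/
lemma three_rays_of_middle {h a r₁ r₂ r₃ : Plane} {C₁ C₂ C₃ : Finset ι} {e₁ e₂ e₃ : ι}
    (hh : h ≠ 0) (hr : cross h r₂ ≠ 0)
    (c1 : IsCycle C₁ s t) (c2 : IsCycle C₂ s t) (c3 : IsCycle C₃ s t)
    (i1 : e₁ ∉ C₁) (i2 : e₂ ∉ C₂) (i3 : e₃ ∉ C₃) (h23 : e₂ ∈ C₃)
    (r1 : IsRay s t e₁ a r₁) (r2 : IsRay s t e₂ a r₂) (r3 : IsRay s t e₃ a r₃)
    (d1 : ∀ e ∈ C₁, a ∈ segment ℝ (s e) (t e) → e = e₁ ∨ e = e₂ ∨ e = e₃)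
    (d2 : ∀ e ∈ C₂, a ∈ segment ℝ (s e) (t e) → e = e₁ ∨ e = e₂ ∨ e = e₃)
    (d3 : ∀ e ∈ C₃, a ∈ segment ℝ (s e) (t e) → e = e₁ ∨ e = e₂ ∨ e = e₃)
    (hsum : ∀ q, rayParity h C₁ s t q + rayParity h C₂ s t q + rayParity h C₃ s t q = 0)
    (hmid : cross r₂ r₁ * cross r₂ r₃ < 0) :
    ∀ᶠ τ in nhdsWithin (0 : ℝ) (Set.Ioi 0), rayParity h C₁ s t (a + τ • r₁) +
      rayParity h C₂ s t (a + τ • r₂) + rayParity h C₃ s t (a + τ • r₃) = 1 := by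
  classical
  have near : ∀ C : Finset ι, (∀ e ∈ C, a ∈ segment ℝ (s e) (t e) → e = e₁ ∨ e = e₂ ∨ e = e₃) →
      ∀ᶠ q in nhds a, ∀ e ∈ C, q ∈ segment ℝ (s e) (t e) → e = e₁ ∨ e = e₂ ∨ e = e₃ := by
    intro C hC
    refine (Filter.eventually_all_finset C).2 fun e he => ?_
    by_cases hae : a ∈ segment ℝ (s e) (t e)
    · exact Filter.Eventually.of_forall fun _ _ => hC e he hae
    · filter_upwards [(isCompact_segment _ _).isClosed.isOpen_compl.mem_nhds hae] with q hq hq'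
      exact absurd hq' hq
  obtain ⟨ε, hε, hball⟩ := Metric.eventually_nhds_iff_ball.1
    ((near C₁ d1).and ((near C₂ d2).and (near C₃ d3)))
  have hgen : ∀ c : ℝ, ∀ᶠ τ in nhdsWithin (0 : ℝ) (Set.Ioi 0), c ≠ cross h (a + τ • r₂) := by
    intro c
    by_cases hc : c = cross h a
    · filter_upwards [self_mem_nhdsWithin] with τ hτ
      have hτ : 0 < τ := hτ
      rw [hc, cross_add_right, cross_smul_right]
      intro h0
      exact mul_ne_zero hτ.ne' hr (by linarith)
    · have hcont : ContinuousAt (fun τ : ℝ => cross h (a + τ • r₂)) 0 := by fun_prop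
      have := hcont.eventually_ne
        (by simpa using Ne.symm hc : cross h (a + (0 : ℝ) • r₂) ≠ c)
      exact (this.filter_mono nhdsWithin_le_nhds).mono fun τ hτ => hτ.symm
  have hgen' : ∀ᶠ τ in nhdsWithin (0 : ℝ) (Set.Ioi 0), ∀ e ∈ C₃,
      cross h (s e) ≠ cross h (a + τ • r₂) ∧ cross h (t e) ≠ cross h (a + τ • r₂) :=
    (Filter.eventually_all_finset C₃).2 fun e _ => (hgen _).and (hgen _)
  filter_upwards [eventually_add_smul_mem (w := r₁) (Metric.ball_mem_nhds a hε),
    eventually_add_smul_mem (w := r₂) (Metric.ball_mem_nhds a hε),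
    eventually_add_smul_mem (w := r₃) (Metric.ball_mem_nhds a hε), hgen',
    (gt_mem_nhds (one_pos (α := ℝ))).filter_mono (nhdsWithin_le_nhds (s := Set.Ioi 0)),
    self_mem_nhdsWithin] with τ m1 m2 m3 hg hτ1 hτ0
  replace hτ0 : 0 < τ := hτ0
  have hr21 : cross r₂ r₁ ≠ 0 := fun h0 => by rw [h0] at hmid; simp at hmid
  have hr23 : cross r₂ r₃ ≠ 0 := fun h0 => by rw [h0] at hmid; simp at hmid
  -- no nonnegative multiples of `r₁` and `r₃` lie on the same side of `r₂`
  have hsep : ∀ β γ : ℝ, 0 < β → 0 ≤ γ → β * cross r₂ r₃ ≠ γ * cross r₂ r₁ ∧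
      β * cross r₂ r₁ ≠ γ * cross r₂ r₃ := by
    intro β γ hβ hγ
    constructor <;> intro h0
    · have := mul_pos hβ (mul_self_pos.2 hr23)
      have e : β * (cross r₂ r₃ * cross r₂ r₃) = γ * (cross r₂ r₁ * cross r₂ r₃) := by
        linear_combination cross r₂ r₃ * h0
      nlinarith
    · have := mul_pos hβ (mul_self_pos.2 hr21)
      have e : β * (cross r₂ r₁ * cross r₂ r₁) = γ * (cross r₂ r₁ * cross r₂ r₃) := by
        linear_combination cross r₂ r₁ * h0
      nlinarith
  set x := a + τ • r₂ with hx
  -- crossing the middle ray at `x`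
  have hxo : x ∈ _ := r2.mem_openSegment hτ0 hτ1
  have hjump := rayParity_jump h23 hxo hg (fun e he hne hmem => by
    rcases (hball x m2).2.2 e he hmem with rfl | rfl | rfl
    · obtain ⟨γ, -, hγ⟩ := r1.mem_segment hmem
      have : τ • r₂ = γ • r₁ := by simpa [hx] using hγ
      have := congrArg (fun z => cross z r₁) this
      simp only [cross_smul_left, cross_self, mul_zero] at this
      exact mul_ne_zero hτ0.ne' hr21 this
    · exact hne rfl
    · exact i3 he) hh
  obtain ⟨p1, hp1, p2, hp2, hjump⟩ := Filter.eventually_prod_iff.1 hjump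
  obtain ⟨η, ⟨⟨⟨⟨hq1, hq3⟩, b1⟩, b3⟩, hη1⟩, hη0⟩ :=
    ((((((eventually_add_smul_mem (w := r₁) hp1).and
    (eventually_add_smul_mem (w := r₃) hp2)).and
    (eventually_add_smul_mem (w := r₁) (Metric.isOpen_ball.mem_nhds m2))).and
    (eventually_add_smul_mem (w := r₃) (Metric.isOpen_ball.mem_nhds m2))).and
    ((gt_mem_nhds hτ0).filter_mono (nhdsWithin_le_nhds (s := Set.Ioi 0)))).and
    self_mem_nhdsWithin).exists
  replace hη0 : 0 < η := hη0
  have hflip := hjump hq1 hq3 (by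
    change orient _ _ (a + τ • r₂ + η • r₁) * orient _ _ (a + τ • r₂ + η • r₃) < 0
    rw [r2.orient_mul]
    have := pow_pos hη0 2
    nlinarith)
  have hcb := convex_ball a ε
  -- the sector between `r₃` and the middle ray is free of the rays of `C₃`
  have k3 : rayParity h C₃ s t (a + τ • r₃) = rayParity h C₃ s t (x + η • r₃) := by
    refine c3.rayParity_eq_of_segment hh fun e he => Set.disjoint_left.2 fun q hq hqe => ?_
    have hqb := hcb.segment_subset m3 b3 hq
    obtain ⟨θ, h0, h1, rfl⟩ := mem_segment_iff'.1 hq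
    have hθ : 0 < τ + θ * (η - τ) := by nlinarith
    have e1 : a + τ • r₃ + θ • (x + η • r₃ - (a + τ • r₃)) =
        a + ((θ * τ) • r₂ + (τ + θ * (η - τ)) • r₃) := by rw [hx]; module
    rw [e1] at hqb hqe
    rcases (hball _ hqb).2.2 e he hqe with rfl | rfl | rfl
    · obtain ⟨γ, hγ0, hγ⟩ := r1.mem_segment hqe
      have := congrArg (cross r₂) (add_left_cancel hγ)
      simp only [cross_add_right, cross_smul_right, cross_self, mul_zero, zero_add] at this
      exact (hsep _ γ hθ hγ0).1 this
    · obtain ⟨γ, hγ0, hγ⟩ := r2.mem_segment hqe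
      have := congrArg (cross r₂) (add_left_cancel hγ)
      simp only [cross_add_right, cross_smul_right, cross_self, mul_zero, zero_add] at this
      exact mul_ne_zero hθ.ne' hr23 this
    · exact i3 he
  have k1 : rayParity h C₁ s t (a + τ • r₁) = rayParity h C₁ s t (x + η • r₁) := by
    refine c1.rayParity_eq_of_segment hh fun e he => Set.disjoint_left.2 fun q hq hqe => ?_
    have hqb := hcb.segment_subset m1 b1 hq
    obtain ⟨θ, h0, h1, rfl⟩ := mem_segment_iff'.1 hq
    have hθ : 0 < τ + θ * (η - τ) := by nlinarith
    have e1 : a + τ • r₁ + θ • (x + η • r₁ - (a + τ • r₁)) =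
        a + ((θ * τ) • r₂ + (τ + θ * (η - τ)) • r₁) := by rw [hx]; module
    rw [e1] at hqb hqe
    rcases (hball _ hqb).1 e he hqe with rfl | rfl | rfl
    · exact i1 he
    · obtain ⟨γ, hγ0, hγ⟩ := r2.mem_segment hqe
      have := congrArg (cross r₂) (add_left_cancel hγ)
      simp only [cross_add_right, cross_smul_right, cross_self, mul_zero, zero_add] at this
      exact mul_ne_zero hθ.ne' hr21 this
    · obtain ⟨γ, hγ0, hγ⟩ := r3.mem_segment hqe
      have := congrArg (cross r₂) (add_left_cancel hγ)
      simp only [cross_add_right, cross_smul_right, cross_self, mul_zero, zero_add] at this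
      exact (hsep _ γ hθ hγ0).2 this
  have k2 : rayParity h C₂ s t x = rayParity h C₂ s t (x + η • r₁) := by
    refine c2.rayParity_eq_of_segment hh fun e he => Set.disjoint_left.2 fun q hq hqe => ?_
    have hqb := hcb.segment_subset m2 b1 hq
    obtain ⟨θ, h0, h1, rfl⟩ := mem_segment_iff'.1 hq
    have e1 : x + θ • (x + η • r₁ - x) = a + (τ • r₂ + (θ * η) • r₁) := by rw [hx]; module
    rw [e1] at hqb hqe
    rcases (hball _ hqb).2.1 e he hqe with rfl | rfl | rfl
    · obtain ⟨γ, hγ0, hγ⟩ := r1.mem_segment hqe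
      have := congrArg (fun z => cross z r₁) (add_left_cancel hγ)
      simp only [cross_add_left, cross_smul_left, cross_self, mul_zero, add_zero] at this
      exact mul_ne_zero hτ0.ne' hr21 this
    · exact i2 he
    · obtain ⟨γ, hγ0, hγ⟩ := r3.mem_segment hqe
      have hc := congrArg (cross r₂) (add_left_cancel hγ)
      simp only [cross_add_right, cross_smul_right, cross_self, mul_zero, zero_add] at hc
      rcases h0.lt_or_eq with h2 | rfl
      · exact (hsep _ γ (mul_pos h2 hη0) hγ0).2 hc
      · have hγ' : γ = 0 := by
          rw [zero_mul, zero_mul] at hc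
          exact (mul_eq_zero.1 hc.symm).resolve_right hr23
        have hc2 := add_left_cancel hγ
        rw [hγ', zero_mul, zero_smul, zero_smul, add_zero] at hc2
        have := (smul_eq_zero.1 hc2).resolve_left hτ0.ne'
        rw [this, cross_zero_right] at hr
        exact hr rfl
  have hs1 := hsum (x + η • r₁)
  rw [k1, k2, k3]
  linear_combination hs1 + hflip - zmod_two_add_self (rayParity h C₃ s t (x + η • r₁))

lemma three_rays {h a r₁ r₂ r₃ : Plane} {C₁ C₂ C₃ : Finset ι} {e₁ e₂ e₃ : ι} (hh : h ≠ 0)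
    (hr1 : cross h r₁ ≠ 0) (hr2 : cross h r₂ ≠ 0) (hr3 : cross h r₃ ≠ 0)
    (c1 : IsCycle C₁ s t) (c2 : IsCycle C₂ s t) (c3 : IsCycle C₃ s t)
    (i1 : e₁ ∉ C₁) (i2 : e₂ ∉ C₂) (i3 : e₃ ∉ C₃) (h12 : e₁ ∈ C₂) (h23 : e₂ ∈ C₃) (h31 : e₃ ∈ C₁)
    (r1 : IsRay s t e₁ a r₁) (r2 : IsRay s t e₂ a r₂) (r3 : IsRay s t e₃ a r₃)
    (d1 : ∀ e ∈ C₁, a ∈ segment ℝ (s e) (t e) → e = e₁ ∨ e = e₂ ∨ e = e₃)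
    (d2 : ∀ e ∈ C₂, a ∈ segment ℝ (s e) (t e) → e = e₁ ∨ e = e₂ ∨ e = e₃)
    (d3 : ∀ e ∈ C₃, a ∈ segment ℝ (s e) (t e) → e = e₁ ∨ e = e₂ ∨ e = e₃)
    (hsum : ∀ q, rayParity h C₁ s t q + rayParity h C₂ s t q + rayParity h C₃ s t q = 0)
    (h1 : cross r₁ r₂ ≠ 0) (h2 : cross r₂ r₃ ≠ 0) (h3 : cross r₃ r₁ ≠ 0) :
    ∀ᶠ τ in nhdsWithin (0 : ℝ) (Set.Ioi 0), rayParity h C₁ s t (a + τ • r₁) +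
      rayParity h C₂ s t (a + τ • r₂) + rayParity h C₃ s t (a + τ • r₃) = 1 := by
  have e1 : ∀ e, e = e₁ ∨ e = e₂ ∨ e = e₃ → e = e₂ ∨ e = e₃ ∨ e = e₁ := fun e h => by tauto
  have e2 : ∀ e, e = e₁ ∨ e = e₂ ∨ e = e₃ → e = e₃ ∨ e = e₁ ∨ e = e₂ := fun e h => by tauto
  have hcases : 0 < cross r₁ r₂ * cross r₂ r₃ ∨ 0 < cross r₂ r₃ * cross r₃ r₁ ∨
      0 < cross r₃ r₁ * cross r₁ r₂ := by
    rcases lt_or_gt_of_ne h1 with h1 | h1 <;> rcases lt_or_gt_of_ne h2 with h2 | h2 <;>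
      rcases lt_or_gt_of_ne h3 with h3 | h3 <;> simp [mul_pos_of_neg_of_neg, *]
  rcases hcases with hm | hm | hm
  · exact three_rays_of_middle hh hr2 c1 c2 c3 i1 i2 i3 h23 r1 r2 r3 d1 d2 d3 hsum
      (by rw [cross_swap r₁ r₂]; linarith)
  · refine (three_rays_of_middle hh hr3 c2 c3 c1 i2 i3 i1 h31 r2 r3 r1
      (fun e he h => e1 e (d2 e he h)) (fun e he h => e1 e (d3 e he h))
      (fun e he h => e1 e (d1 e he h)) (fun q => by rw [← hsum q]; ring)
      (by rw [cross_swap r₂ r₃]; linarith)).mono fun τ h => ?_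
    rw [← h]; ring
  · refine (three_rays_of_middle hh hr1 c3 c1 c2 i3 i1 i2 h12 r3 r1 r2
      (fun e he h => e2 e (d3 e he h)) (fun e he h => e2 e (d1 e he h))
      (fun e he h => e2 e (d2 e he h)) (fun q => by rw [← hsum q]; ring)
      (by rw [cross_swap r₃ r₁]; linarith)).mono fun τ h => ?_
    rw [← h]; ring

end ThreeRays

/-! ### Chords on one side of the polygon do not interlace -/

lemma val_finRotate (i : Fin n) :
    (finRotate n i).val = if i.val + 1 = n then 0 else i.val + 1 := by
  obtain ⟨m, rfl⟩ : ∃ m, n = m + 1 := ⟨n - 1, by have := i.2; omega⟩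
  rw [finRotate_apply, Fin.val_add]
  have := i.2
  rcases Nat.eq_zero_or_pos m with rfl | hm
  · simp
  · split_ifs with h
    · rw [show i.val = m by omega]
      simp [Nat.mod_eq_of_lt (show 1 < m + 1 by omega)]
    · have h1 : ((1 : Fin (m + 1)) : ℕ) = 1 := by
        rw [Fin.val_one']; exact Nat.mod_eq_of_lt (by omega)
      rw [h1]
      exact Nat.mod_eq_of_lt (by omega)

lemma sum_Ico_edges (f : Fin n → ZMod 2) (k : Fin n) (l : ℕ) (hl : l < n) (hkl : k.val ≤ l) :
    ∑ m ∈ Finset.Ico k ⟨l, hl⟩, (f m + f (finRotate n m)) = f k + f ⟨l, hl⟩ := by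
  induction l, hkl using Nat.le_induction with
  | base => simp [zmod_two_add_self]
  | succ l hkl ih =>
    have hl' : l < n := by omega
    have e : Finset.Ico k ⟨l + 1, hl⟩ = insert ⟨l, hl'⟩ (Finset.Ico k ⟨l, hl'⟩) := by
      ext m
      simp only [Finset.mem_Ico, Finset.mem_insert, Fin.le_def, Fin.lt_def, Fin.ext_iff]
      omega
    have e2 : finRotate n ⟨l, hl'⟩ = ⟨l + 1, hl⟩ := by
      ext; rw [val_finRotate]; simp; omega
    rw [e, Finset.sum_insert (by simp), ih hl', e2]
    linear_combination zmod_two_add_self (f ⟨l, hl'⟩)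

/-- The segments of a polygon together with one further segment joining two of its vertices. -/
def withChord (P : Polygon Plane n) (k : Fin n) (f : Fin n → Fin n) : Option (Fin n) → Plane :=
  fun o => o.elim (P k) fun m => P (f m)

lemma isCycle_insertNone {A : Finset (Fin n)} {k l : Fin n}
    (hA : ∀ f : Fin n → ZMod 2, ∑ m ∈ A, (f m + f (finRotate n m)) = f k + f l) :
    IsCycle (Finset.insertNone A) (withChord P k id) (withChord P l (finRotate n)) := by
  intro f
  rw [Finset.sum_insertNone]
  simp only [withChord, Option.elim, id]
  rw [hA fun m => f (P m), zmod_two_add_self]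

set_option maxHeartbeats 1000000 in
/-- Two interlacing chords on the same side of a simple polygon have a common point: together with
the two arcs of the polygon, the chord `k l` forms a theta curve. -/
theorem IsSimple.not_disjoint_of_interlacing (hs : P.IsSimple) (hg : P.InGeneralPosition)
    {i k j l : Fin n} (hik : i < k) (hkj : k < j) (hjl : j < l)
    (hside : (openSegment ℝ (P i) (P j) ⊆ P.inside ∧ openSegment ℝ (P k) (P l) ⊆ P.inside) ∨
      (openSegment ℝ (P i) (P j) ⊆ P.outside ∧ openSegment ℝ (P k) (P l) ⊆ P.outside)) :
    ¬ Disjoint (openSegment ℝ (P i) (P j)) (openSegment ℝ (P k) (P l)) := by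
  intro hdisj
  have hn := hs.three_le
  obtain ⟨k', hk'⟩ : ∃ k', finRotate n k' = k := (finRotate n).surjective k
  have hk'v : k'.val + 1 = k.val := by
    have := val_finRotate k'
    rw [hk'] at this
    have := Fin.lt_def.1 hik
    split_ifs at * <;> omega
  have hkv := val_finRotate k
  have hlv := l.2
  simp only [Fin.lt_def] at hik hkj hjl
  rw [if_neg (by omega)] at hkv
  set K := finRotate n k with hKdef
  have ne_kl : k ≠ l := by intro h; rw [h] at hkj; omega
  have ne_ij : i ≠ j := by intro h; rw [h] at hik; omega
  have ne_Kk : K ≠ k := by intro h; rw [h] at hkv; omega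
  have ne_k'k : k' ≠ k := by intro h; rw [h] at hk'v; omega
  have ne_Kk' : K ≠ k' := by intro h; rw [h] at hkv; omega
  have ne_Kl : K ≠ l := by intro h; rw [h] at hkv; omega
  have ne_k'l : k' ≠ l := by intro h; rw [h] at hk'v; omega
  set r₁ := P K - P k
  set r₂ := P k' - P k
  set r₃ := P l - P k
  have h12 : cross r₁ r₂ ≠ 0 := hg.orient_ne_zero ne_Kk.symm ne_Kk' ne_k'k.symm
  have h23 : cross r₂ r₃ ≠ 0 := hg.orient_ne_zero ne_k'k.symm ne_k'l ne_kl
  have h31 : cross r₃ r₁ ≠ 0 := hg.orient_ne_zero ne_kl ne_Kl.symm ne_Kk.symm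
  -- a direction that is not parallel to any of the three rays at `P k`
  obtain ⟨h, hr1, hr2, hr3⟩ : ∃ h, cross h r₁ ≠ 0 ∧ cross h r₂ ≠ 0 ∧ cross h r₃ ≠ 0 := by
    have e : ∀ c : ℝ, c ≠ 0 → cross (r₁ + c • r₂) r₃ ≠ 0 → ∃ h, cross h r₁ ≠ 0 ∧ cross h r₂ ≠ 0 ∧
        cross h r₃ ≠ 0 := by
      intro c hc h3
      refine ⟨r₁ + c • r₂, ?_, ?_, h3⟩
      · rw [cross_add_left, cross_smul_left, cross_self, zero_add, cross_swap]
        exact mul_ne_zero hc (neg_ne_zero.2 h12)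
      · rw [cross_add_left, cross_smul_left, cross_self, mul_zero, add_zero]; exact h12
    by_cases hc : cross (r₁ + (1 : ℝ) • r₂) r₃ = 0
    · refine e 2 two_ne_zero fun hc2 => h23 ?_
      rw [cross_add_left, cross_smul_left] at hc hc2
      linarith
    · exact e 1 one_ne_zero hc
  have hh : h ≠ 0 := by rintro rfl; simp [cross] at hr1
  -- the two chords have the same parity
  have hpar : ∀ x ∈ openSegment ℝ (P k) (P l), ∀ y ∈ openSegment ℝ (P i) (P j),
      P.parity h x = P.parity h y := by
    intro x hx y hy
    rcases hside with ⟨h1, h2⟩ | ⟨h1, h2⟩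
    · rw [hs.parity_eq_one_of_mem_inside hg hh (h2 hx),
        hs.parity_eq_one_of_mem_inside hg hh (h1 hy)]
    · rw [parity_eq_zero_of_mem_outside hh (h2 hx), parity_eq_zero_of_mem_outside hh (h1 hy)]
  have hoff : (∀ x ∈ openSegment ℝ (P k) (P l), x ∉ P.boundary ℝ) ∧
      ∀ y ∈ openSegment ℝ (P i) (P j), y ∉ P.boundary ℝ := by
    rcases hside with ⟨h1, h2⟩ | ⟨h1, h2⟩ <;>
      exact ⟨fun x hx => (h2 hx).1, fun y hy => (h1 hy).1⟩
  -- the three cycles of the theta curve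
  set s := withChord P k id with hs_def
  set t := withChord P l (finRotate n) with ht_def
  set C₁ := Finset.insertNone (Finset.Ico k l)ᶜ with hC₁
  set C₂ := Finset.insertNone (Finset.Ico k l) with hC₂
  set C₃ : Finset (Option (Fin n)) := Finset.univ.map Function.Embedding.some with hC₃
  have hIco : ∀ a, a ∈ Finset.Ico k l ↔ k.val ≤ a.val ∧ a.val < l.val := fun a => Finset.mem_Ico
  have hIcoc : ∀ a, a ∈ (Finset.Ico k l)ᶜ ↔ ¬ (k.val ≤ a.val ∧ a.val < l.val) := fun a => by
    rw [Finset.mem_compl, hIco]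
  have hm1 : ∀ a, some a ∈ C₁ ↔ ¬ (k.val ≤ a.val ∧ a.val < l.val) := fun a => by
    rw [hC₁, Finset.some_mem_insertNone, hIcoc]
  have hm2 : ∀ a, some a ∈ C₂ ↔ (k.val ≤ a.val ∧ a.val < l.val) := fun a => by
    rw [hC₂, Finset.some_mem_insertNone, hIco]
  have hcyc : ∀ f : Fin n → ZMod 2, ∑ m ∈ Finset.Ico k l, (f m + f (finRotate n m)) = f k + f l :=
    fun f => sum_Ico_edges f k l.val l.2 (by omega)
  have hcyc' : ∀ f : Fin n → ZMod 2, ∑ m, (f m + f (finRotate n m)) = 0 := fun f => by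
    rw [Finset.sum_add_distrib, Equiv.sum_comp (finRotate n) f]; exact zmod_two_add_self _
  have c2 : IsCycle C₂ s t := isCycle_insertNone hcyc
  have c1 : IsCycle C₁ s t := isCycle_insertNone fun f => by
    have := Finset.sum_compl_add_sum (Finset.Ico k l) fun m => f m + f (finRotate n m)
    rw [hcyc, hcyc'] at this
    linear_combination this - zmod_two_add_self (f k + f l)
  have hC₃p : ∀ q, rayParity h C₃ s t q = P.parity h q := by
    intro q
    simp [rayParity, parity, hC₃, hs_def, ht_def, withChord]
  have c3 : IsCycle C₃ s t := by
    intro f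
    have := isCycle_edges P f
    simpa [hC₃, hs_def, ht_def, withChord] using this
  have hsum : ∀ q, rayParity h C₁ s t q + rayParity h C₂ s t q + rayParity h C₃ s t q = 0 := by
    intro q
    have e := Finset.sum_compl_add_sum (Finset.Ico k l)
      fun m => crossing h (s (some m)) (t (some m)) q
    rw [rayParity, rayParity, rayParity, hC₁, hC₂, hC₃, Finset.sum_insertNone,
      Finset.sum_insertNone, Finset.sum_map]
    simp only [Function.Embedding.some_apply]
    rw [← e]
    linear_combination zmod_two_add_self (crossing h (s none) (t none) q +
      ∑ m ∈ (Finset.Ico k l)ᶜ, crossing h (s (some m)) (t (some m)) q +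
      ∑ m ∈ Finset.Ico k l, crossing h (s (some m)) (t (some m)) q)
  have hd : ∀ e : Option (Fin n), P k ∈ segment ℝ (s e) (t e) →
      e = some k ∨ e = some k' ∨ e = none := by
    rintro (_ | m) hm
    · simp
    change P k ∈ segment ℝ (P m) (P (finRotate n m)) at hm
    rcases hs.vertex_mem_edge hm with h1 | h1
    · exact Or.inl (congrArg some h1.symm)
    · exact Or.inr (Or.inl (congrArg some ((finRotate n).injective (hk'.trans h1)).symm))
  have hrays := three_rays (s := s) (t := t) (a := P k) (C₁ := C₁) (C₂ := C₂) (C₃ := C₃)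
    (e₁ := some k) (e₂ := some k') (e₃ := none) hh hr1 hr2 hr3 c1 c2 c3
    (by rw [hm1]; omega) (by rw [hm2]; omega)
    (by simp [hC₃]) (by rw [hm2]; omega) (by simp [hC₃]) (by simp [hC₁])
    (Or.inl (by simp [hs_def, ht_def, withChord, r₁, hKdef, -finRotate_apply]))
    (Or.inr (by simp [hs_def, ht_def, withChord, r₂, hk', -finRotate_apply]))
    (Or.inl (by simp [hs_def, ht_def, withChord, r₃]))
    (fun e _ => hd e) (fun e _ => hd e) (fun e _ => hd e) hsum h12 h23 h31
  obtain ⟨τ, ⟨hτ, hτ1⟩, hτ0⟩ := ((hrays.and ((gt_mem_nhds (one_pos (α := ℝ))).filter_mono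
    (nhdsWithin_le_nhds (s := Set.Ioi 0)))).and self_mem_nhdsWithin).exists
  replace hτ0 : 0 < τ := hτ0
  have hvC : ∀ {v : Fin n}, v ≠ k → v ≠ l → P v ∉ segment ℝ (P k) (P l) := by
    intro v h1 h2 h3
    rcases mem_segment_cases h3 with h | h | h
    · exact h1 (hs.injective h)
    · exact h2 (hs.injective h)
    · exact hg.notMem_openSegment hs v ne_kl h
  -- an edge away from an arc and its chord is disjoint from the cycle that they form
  have hedge : ∀ A : Finset (Fin n), ∀ m : Fin n, m ∉ A → ∀ x y : Plane,
      segment ℝ x y ⊆ segment ℝ (P m) (P (finRotate n m)) →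
      (∀ w, P w ∈ segment ℝ x y → w ≠ k ∧ w ≠ l ∧
        ∀ a ∈ A, w ≠ a ∧ w ≠ finRotate n a) →
      ∀ e ∈ Finset.insertNone A, Disjoint (segment ℝ x y) (segment ℝ (s e) (t e)) := by
    intro A m hmA x y hsub hw e he
    rw [Set.disjoint_left]
    intro z hz hze
    rcases e with _ | a
    · change z ∈ segment ℝ (P k) (P l) at hze
      rcases mem_segment_cases hze with rfl | rfl | h1
      · exact (hw k hz).1 rfl
      · exact (hw l hz).2.1 rfl
      · exact hoff.1 z h1 (mem_boundary.2 ⟨m, hsub hz⟩)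
    · have haA : a ∈ A := Finset.some_mem_insertNone.1 he
      change z ∈ segment ℝ (P a) (P (finRotate n a)) at hze
      obtain ⟨w, rfl, -, h2⟩ := hs.edge_inter (fun h => hmA (by rwa [h])) (hsub hz) hze
      have := (hw w hz).2.2 a haA
      rcases h2 with h2 | h2
      · exact this.1 h2
      · exact this.2 h2
  -- from `P i` along the first arc to the corner
  have hA1 : ∀ m : ℕ, ∀ hm : m ≤ k'.val, i.val ≤ m →
      rayParity h C₂ s t (P ⟨m, by have := k'.2; omega⟩) = rayParity h C₂ s t (P k') := by
    intro m hm
    induction hm using Nat.decreasingInduction with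
    | self => intro; rfl
    | of_succ m hm ih =>
      intro him
      have hm' : m < k'.val := hm
      have hmn : m < n := by omega
      rw [← ih (by omega)]
      have hrot : finRotate n ⟨m, hmn⟩ = ⟨m + 1, by omega⟩ := by
        ext; rw [val_finRotate]; simp; omega
      refine c2.rayParity_eq_of_segment hh (hedge _ ⟨m, hmn⟩ ?_ _ _ (by rw [hrot]) ?_)
      · rw [hIco]; simp only; omega
      · intro w hw
        have := hs.vertex_mem_edge (j := ⟨m, hmn⟩) (by rw [hrot]; exact hw)
        rw [hrot] at this
        have hwm : w.val ≤ m + 1 := by rcases this with rfl | rfl <;> simp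
        refine ⟨?_, ?_, fun a ha => ⟨?_, ?_⟩⟩ <;> intro h0
        · rw [h0] at hwm; omega
        · rw [h0] at hwm; omega
        · rw [h0] at hwm; rw [hIco] at ha; omega
        · rw [h0, val_finRotate] at hwm; rw [hIco] at ha
          rw [if_neg (by omega)] at hwm; omega
  have hA1' : rayParity h C₂ s t (P k') = rayParity h C₂ s t (P k + τ • r₂) := by
    have hx : P k + τ • r₂ ∈ openSegment ℝ (P k) (P k') :=
      mem_openSegment_iff'.2 ⟨τ, hτ0, hτ1, rfl⟩
    have hsub : segment ℝ (P k') (P k + τ • r₂) ⊆ segment ℝ (P k') (P k) :=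
      (convex_segment _ _).segment_subset (left_mem_segment ℝ _ _)
        (by rw [segment_symm]; exact openSegment_subset_segment _ _ _ hx)
    refine c2.rayParity_eq_of_segment hh (hedge _ k' ?_ _ _ (by rw [hk']; exact hsub) ?_)
    · rw [hIco]; omega
    · intro w hw
      have hwk : w ≠ k := by
        rintro rfl
        rw [segment_symm] at hw
        obtain ⟨θ, h0, h1, hθ⟩ := mem_segment_iff'.1 hw
        have e : P w + τ • r₂ + θ • (P k' - (P w + τ • r₂)) =
            P w + (τ + θ * (1 - τ)) • r₂ := by simp only [r₂]; module
        rw [e] at hθ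
        have := (smul_eq_zero.1 (left_eq_add.1 hθ)).resolve_right
          (sub_ne_zero.2 (hs.ne ne_k'k))
        nlinarith [mul_nonneg h0 (sub_nonneg.2 hτ1.le)]
      have hwk' : w = k' := by
        have := hs.vertex_mem_edge (j := k') (by rw [hk']; exact hsub hw)
        rw [hk'] at this
        exact this.resolve_right hwk
      subst hwk'
      refine ⟨ne_k'k, ne_k'l, fun a ha => ⟨?_, ?_⟩⟩ <;> intro h0 <;>
        rw [hIco] at ha
      · rw [h0] at hk'v; omega
      · rw [h0, val_finRotate, if_neg (by omega)] at hk'v; omega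
  -- from `P j` along the second arc to the corner
  have hA2 : ∀ m : ℕ, K.val ≤ m → ∀ hm : m ≤ j.val,
      rayParity h C₁ s t (P K) = rayParity h C₁ s t (P ⟨m, by have := j.2; omega⟩) := by
    intro m hKm
    induction m, hKm using Nat.le_induction with
    | base => intro; rfl
    | succ m hKm ih =>
      intro hmj
      have hmn : m < n := by omega
      rw [ih (by omega)]
      have hrot : finRotate n ⟨m, hmn⟩ = ⟨m + 1, by omega⟩ := by
        ext; rw [val_finRotate]; simp; omega
      refine c1.rayParity_eq_of_segment hh (hedge _ ⟨m, hmn⟩ ?_ _ _ (by rw [hrot]) ?_)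
      · rw [hIcoc]; simp only; omega
      · intro w hw
        have := hs.vertex_mem_edge (j := ⟨m, hmn⟩) (by rw [hrot]; exact hw)
        rw [hrot] at this
        have hwm : m ≤ w.val ∧ w.val ≤ m + 1 := by rcases this with rfl | rfl <;> simp
        refine ⟨?_, ?_, fun a ha => ⟨?_, ?_⟩⟩ <;> intro h0
        · rw [h0] at hwm; omega
        · rw [h0] at hwm; omega
        · rw [h0] at hwm; rw [hIcoc] at ha; omega
        · rw [h0, val_finRotate] at hwm; rw [hIcoc] at ha
          split_ifs at hwm <;> omega
  have hA2' : rayParity h C₁ s t (P K) = rayParity h C₁ s t (P k + τ • r₁) := by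
    have hx : P k + τ • r₁ ∈ openSegment ℝ (P k) (P K) :=
      mem_openSegment_iff'.2 ⟨τ, hτ0, hτ1, rfl⟩
    have hsub : segment ℝ (P K) (P k + τ • r₁) ⊆ segment ℝ (P k) (P K) :=
      (convex_segment _ _).segment_subset (right_mem_segment ℝ _ _)
        (openSegment_subset_segment _ _ _ hx)
    refine c1.rayParity_eq_of_segment hh (hedge _ k ?_ _ _ hsub ?_)
    · rw [hIcoc]; omega
    · intro w hw
      have hwk : w ≠ k := by
        rintro rfl
        rw [segment_symm] at hw
        obtain ⟨θ, h0, h1, hθ⟩ := mem_segment_iff'.1 hw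
        have e : P w + τ • r₁ + θ • (P K - (P w + τ • r₁)) =
            P w + (τ + θ * (1 - τ)) • r₁ := by simp only [r₁]; module
        rw [e] at hθ
        have := (smul_eq_zero.1 (left_eq_add.1 hθ)).resolve_right
          (sub_ne_zero.2 (hs.ne ne_Kk))
        nlinarith [mul_nonneg h0 (sub_nonneg.2 hτ1.le)]
      obtain rfl : w = K := (hs.vertex_mem_edge (hsub hw)).resolve_left hwk
      refine ⟨ne_Kk, ne_Kl, fun a ha => ?_⟩
      rw [hIcoc] at ha
      refine ⟨?_, ?_⟩ <;> intro h0
      · rw [← h0] at ha; omega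
      · have := congrArg Fin.val h0
        rw [hkv, val_finRotate] at this
        split_ifs at this; omega
  -- the chord `i j` misses both small cycles, up to an end point
  obtain ⟨y, hy⟩ : ∃ y, y ∈ openSegment ℝ (P i) (P j) :=
    ⟨_, mem_openSegment_iff'.2 ⟨1 / 2, by norm_num, by norm_num, rfl⟩⟩
  have hyC : ∀ z ∈ openSegment ℝ (P i) (P j), ∀ e, z ∉ segment ℝ (s e) (t e) := by
    rintro z hz (_ | a) hze
    · change z ∈ segment ℝ (P k) (P l) at hze
      rcases mem_segment_cases hze with rfl | rfl | h1
      · exact hg.notMem_openSegment hs _ ne_ij hz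
      · exact hg.notMem_openSegment hs _ ne_ij hz
      · exact Set.disjoint_left.1 hdisj hz h1
    · exact hoff.2 z hz (mem_boundary.2 ⟨a, hze⟩)
  have hiy : rayParity h C₂ s t (P i) = rayParity h C₂ s t y := by
    have hsub : segment ℝ (P i) y ⊆ insert (P i) (openSegment ℝ (P i) (P j)) := by
      intro z hz
      rcases mem_segment_cases hz with rfl | rfl | h1
      · exact Or.inl rfl
      · exact Or.inr hy
      · obtain ⟨θ, h2, h3, rfl⟩ := mem_openSegment_iff'.1 hy
        obtain ⟨η, h4, h5, rfl⟩ := mem_openSegment_iff'.1 h1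
        refine Or.inr (mem_openSegment_iff'.2 ⟨η * θ, mul_pos h4 h2, by nlinarith, by module⟩)
    refine c2.rayParity_eq_of_segment hh fun e he => Set.disjoint_left.2 fun z hz hze => ?_
    rcases hsub hz with rfl | h1
    · rcases e with _ | a
      · exact hvC (fun h => by rw [h] at hik; omega) (fun h => by rw [h] at hik; omega) hze
      · change P i ∈ segment ℝ (P a) (P (finRotate n a)) at hze
        have ha : a ∈ Finset.Ico k l := Finset.some_mem_insertNone.1 he
        rw [hIco] at ha
        rcases hs.vertex_mem_edge hze with rfl | h2
        · omega
        · rw [h2, val_finRotate, if_neg (by omega)] at hik; omega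
    · exact hyC z h1 e hze
  have hjy : rayParity h C₁ s t (P j) = rayParity h C₁ s t y := by
    have hsub : segment ℝ (P j) y ⊆ insert (P j) (openSegment ℝ (P i) (P j)) := by
      intro z hz
      rcases mem_segment_cases hz with rfl | rfl | h1
      · exact Or.inl rfl
      · exact Or.inr hy
      · rw [openSegment_symm] at hy ⊢
        obtain ⟨θ, h2, h3, rfl⟩ := mem_openSegment_iff'.1 hy
        obtain ⟨η, h4, h5, rfl⟩ := mem_openSegment_iff'.1 h1
        refine Or.inr (mem_openSegment_iff'.2 ⟨η * θ, mul_pos h4 h2, by nlinarith, by module⟩)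
    refine c1.rayParity_eq_of_segment hh fun e he => Set.disjoint_left.2 fun z hz hze => ?_
    rcases hsub hz with rfl | h1
    · rcases e with _ | a
      · exact hvC (fun h => by rw [h] at hkj; omega) (fun h => by rw [h] at hjl; omega) hze
      · change P j ∈ segment ℝ (P a) (P (finRotate n a)) at hze
        have ha : a ∈ (Finset.Ico k l)ᶜ := Finset.some_mem_insertNone.1 he
        rw [hIcoc] at ha
        rcases hs.vertex_mem_edge hze with rfl | h2
        · omega
        · have := congrArg Fin.val h2
          rw [val_finRotate] at this
          split_ifs at this <;> omega
    · exact hyC z h1 e hze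
  have hx : P k + τ • r₃ ∈ openSegment ℝ (P k) (P l) :=
    mem_openSegment_iff'.2 ⟨τ, hτ0, hτ1, rfl⟩
  have f1 := hsum y
  rw [hC₃p, ← hiy, ← hjy] at f1
  rw [hC₃p, hpar _ hx y hy, ← hA1', ← hA2', hA2 j.val (by omega) le_rfl,
    ← hA1 i.val (by omega) le_rfl] at hτ
  exact zero_ne_one (f1.symm.trans ((by ring : _ = _).trans hτ))

/-! ### The number of pairwise non-crossing chords -/

/-- A family of pairwise non-interlacing intervals of length at least two with end points in
`{l, …, r}` has at most `r - l - 1` members. -/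
lemma card_le_of_not_interlacing (d : ℕ) : ∀ (l r : ℕ), r = l + d + 1 → ∀ F : Finset (ℕ × ℕ),
    (∀ p ∈ F, l ≤ p.1 ∧ p.2 ≤ r ∧ p.1 + 2 ≤ p.2) →
    (∀ p ∈ F, ∀ q ∈ F, ¬ (p.1 < q.1 ∧ q.1 < p.2 ∧ p.2 < q.2)) → F.card ≤ d := by
  induction d using Nat.strong_induction_on with
  | _ d ih =>
    intro l r hr F hF hI
    rcases Nat.eq_zero_or_pos d with rfl | hd
    · rw [Nat.le_zero, Finset.card_eq_zero, Finset.eq_empty_iff_forall_notMem]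
      intro p hp
      have := hF p hp
      omega
    -- a point `k` that no interval other than `(l, r)` covers
    obtain ⟨k, hlk, hkr, hk⟩ : ∃ k, l < k ∧ k < r ∧
        ∀ p ∈ F, p ≠ (l, r) → p.2 ≤ k ∨ k ≤ p.1 := by
      by_cases hne : (F.filter fun p => p.1 = l ∧ p.2 ≠ r).Nonempty
      · obtain ⟨q, hq, hmax⟩ := Finset.exists_max_image _ (fun p : ℕ × ℕ => p.2) hne
        obtain ⟨hqF, hql, hqr⟩ := Finset.mem_filter.1 hq
        have h1 := hF q hqF
        refine ⟨q.2, by omega, by omega, fun p hp hpne => ?_⟩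
        by_contra! hcon
        have h2 := hF p hp
        by_cases hpl : p.1 = l
        · have hpr : p.2 ≠ r := fun h => hpne (Prod.ext hpl h)
          have := hmax p (Finset.mem_filter.2 ⟨hp, hpl, hpr⟩)
          omega
        · exact hI q hqF p hp ⟨by omega, hcon.2, hcon.1⟩
      · refine ⟨l + 1, by omega, by omega, fun p hp hpne => ?_⟩
        by_contra! hcon
        have h2 := hF p hp
        refine hne ⟨p, Finset.mem_filter.2 ⟨hp, by omega, fun h => hpne (Prod.ext ?_ h)⟩⟩
        simp only
        omega
    have hsub : F ⊆ insert (l, r) (F.filter (fun p => p.2 ≤ k) ∪ F.filter (fun p => k ≤ p.1)) := by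
      intro p hp
      by_cases h : p = (l, r)
      · simp [h]
      · have := hk p hp h
        simp [hp, h, this]
    have h1 := ih (k - l - 1) (by omega) l k (by omega) (F.filter fun p => p.2 ≤ k)
      (fun p hp => by
        obtain ⟨hp, hpk⟩ := Finset.mem_filter.1 hp
        exact ⟨(hF p hp).1, hpk, (hF p hp).2.2⟩)
      (fun p hp q hq => hI p (Finset.mem_filter.1 hp).1 q (Finset.mem_filter.1 hq).1)
    have h2 := ih (r - k - 1) (by omega) k r (by omega) (F.filter fun p => k ≤ p.1)
      (fun p hp => by
        obtain ⟨hp, hpk⟩ := Finset.mem_filter.1 hp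
        exact ⟨hpk, (hF p hp).2⟩)
      (fun p hp q hq => hI p (Finset.mem_filter.1 hp).1 q (Finset.mem_filter.1 hq).1)
    have h3 := Finset.card_le_card hsub
    have h4 := Finset.card_insert_le (l, r)
      (F.filter (fun p => p.2 ≤ k) ∪ F.filter (fun p => k ≤ p.1))
    have h5 := Finset.card_union_le (F.filter fun p => p.2 ≤ k) (F.filter fun p => k ≤ p.1)
    omega

lemma isChord_mk {i j : Fin n} (h : IsChord s(i, j)) :
    i ≠ j ∧ finRotate n i ≠ j ∧ finRotate n j ≠ i := by
  refine ⟨fun hij => h.1 (by simp [hij]), fun hij => h.2 i (by rw [hij]), fun hij => h.2 j ?_⟩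
  rw [hij, Sym2.eq_swap]

lemma isChord_mk_of {i j : Fin n} (h1 : i ≠ j) (h2 : finRotate n i ≠ j) (h3 : finRotate n j ≠ i) :
    IsChord s(i, j) := by
  refine ⟨by simpa using h1, fun k hk => ?_⟩
  rcases Sym2.eq_iff.1 hk with ⟨rfl, rfl⟩ | ⟨rfl, rfl⟩
  · exact h2 rfl
  · exact h3 rfl

@[simp] lemma openSeg_mk (P : Polygon Plane n) (i j : Fin n) :
    P.openSeg s(i, j) = openSegment ℝ (P i) (P j) := rfl

/-- Pairwise non-crossing chords that all lie in the interior, or all in the exterior, of the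
polygon: there are at most `n - 3` of them. -/
lemma IsSimple.card_le (hs : P.IsSimple) (hg : P.InGeneralPosition) {M : Set (Sym2 (Fin n))}
    (hM : M = P.diagonals ∨ M = P.epigonals) {J : Finset (Sym2 (Fin n))}
    (hJM : (J : Set (Sym2 (Fin n))) ⊆ M) (hJ : P.NonCrossing J) : J.card ≤ n - 3 := by
  have hn := hs.three_le
  set g : Sym2 (Fin n) → ℕ × ℕ := fun e => (e.inf.val, e.sup.val) with hgdef
  have hinj : Function.Injective g := by
    intro e e' h
    simp only [hgdef, Prod.mk.injEq] at h
    exact Sym2.inf_eq_inf_and_sup_eq_sup.1 ⟨Fin.ext h.1, Fin.ext h.2⟩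
  have hmk : ∀ e : Sym2 (Fin n), ∃ i j, e = s(i, j) ∧ i ≤ j ∧ g e = (i.val, j.val) := by
    intro e
    induction e with | h i j
    rcases le_total i j with h | h
    · exact ⟨i, j, rfl, h, by simp [hgdef, h]⟩
    · exact ⟨j, i, Sym2.eq_swap, h, by simp [hgdef, h]⟩
  have hchord : ∀ e ∈ M, IsChord e := by
    rcases hM with rfl | rfl <;> exact fun e he => he.1
  have hrange : ∀ p ∈ J.image g, p.1 + 2 ≤ p.2 ∧ p.2 ≤ n - 1 ∧ p ≠ (0, n - 1) := by
    intro p hp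
    obtain ⟨e, he, rfl⟩ := Finset.mem_image.1 hp
    obtain ⟨i, j, rfl, hij, hgij⟩ := hmk e
    rw [hgij]
    obtain ⟨h1, h2, h3⟩ := isChord_mk (hchord _ (hJM he))
    rw [Ne, Fin.ext_iff, val_finRotate] at h2 h3
    have h1 : i.val ≠ j.val := fun h => h1 (Fin.ext h)
    have hij : i.val ≤ j.val := hij
    have := j.2
    simp only [ne_eq, Prod.mk.injEq]
    split_ifs at h2 h3 <;> omega
  have hI : ∀ p ∈ J.image g, ∀ q ∈ J.image g, ¬ (p.1 < q.1 ∧ q.1 < p.2 ∧ p.2 < q.2) := by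
    intro p hp q hq
    obtain ⟨e, he, rfl⟩ := Finset.mem_image.1 hp
    obtain ⟨e', he', rfl⟩ := Finset.mem_image.1 hq
    obtain ⟨i, j, rfl, -, h1⟩ := hmk e
    obtain ⟨k, l, rfl, -, h2⟩ := hmk e'
    rw [h1, h2]
    rintro ⟨h3, h4, h5⟩
    have h3 : i < k := h3
    have h4 : k < j := h4
    have h5 : j < l := h5
    refine hs.not_disjoint_of_interlacing hg h3 h4 h5 ?_
      (hJ he he' (fun h => ?_))
    · rcases hM with rfl | rfl
      · exact Or.inl ⟨(hJM he).2, (hJM he').2⟩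
      · exact Or.inr ⟨(hJM he).2, (hJM he').2⟩
    · rcases Sym2.eq_iff.1 h with ⟨rfl, -⟩ | ⟨-, rfl⟩
      · exact lt_irrefl _ h3
      · exact lt_irrefl _ h4
  have hnot : (0, n - 1) ∉ J.image g := fun h => (hrange _ h).2.2 rfl
  have key := card_le_of_not_interlacing (n - 2) 0 (n - 1) (by omega)
    (insert (0, n - 1) (J.image g))
    (by
      intro p hp
      rcases Finset.mem_insert.1 hp with rfl | hp
      · exact ⟨le_rfl, le_rfl, by omega⟩
      · have := hrange p hp; omega)
    (by
      intro p hp q hq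
      rcases Finset.mem_insert.1 hp with rfl | hp <;> rcases Finset.mem_insert.1 hq with rfl | hq
      · simp
      · have := hrange q hq; simp only; omega
      · simp only; omega
      · exact hI p hp q hq)
  rw [Finset.card_insert_of_notMem hnot, Finset.card_image_of_injective _ hinj] at key
  omega

/-! ### Alternating sums over non-crossing sets -/

open Classical in
/-- The alternating sum `∑ (-1) ^ |J|` over the pairwise non-crossing subsets `J` of `M`. -/
def altSum (P : Polygon Plane n) (M : Finset (Sym2 (Fin n))) : ℤ :=
  ∑ J ∈ M.powerset.filter fun J : Finset (Sym2 (Fin n)) => P.NonCrossing (J : Set (Sym2 (Fin n))),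
    (-1 : ℤ) ^ J.card

lemma nonCrossing_mono {J J' : Set (Sym2 (Fin n))} (h : J ⊆ J') (hJ : P.NonCrossing J') :
    P.NonCrossing J := Set.Pairwise.mono h hJ

/-- If some member of `M` crosses no other member, toggling it shows that the alternating sum
vanishes. -/
lemma altSum_eq_zero_of_isolated {M : Finset (Sym2 (Fin n))} {e : Sym2 (Fin n)} (he : e ∈ M)
    (h : ∀ e' ∈ M, e' ≠ e → Disjoint (P.openSeg e') (P.openSeg e)) : P.altSum M = 0 := by
  classical
  unfold altSum
  refine Finset.sum_involution (fun J _ => if e ∈ J then J.erase e else insert e J) ?_ ?_ ?_ ?_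
  · intro J hJ
    by_cases heJ : e ∈ J
    · simp only [heJ, if_true]
      rw [← Finset.card_erase_add_one heJ, pow_succ]; ring
    · simp only [heJ, if_false]
      rw [Finset.card_insert_of_notMem heJ, pow_succ]; ring
  · intro J hJ _
    by_cases heJ : e ∈ J
    · simp only [heJ, if_true]
      exact fun h => Finset.notMem_erase e J (by rw [h]; exact heJ)
    · simp only [heJ, if_false]
      exact fun h => heJ (by rw [← h]; exact Finset.mem_insert_self e J)
  · intro J hJ
    rw [Finset.mem_filter, Finset.mem_powerset] at hJ ⊢
    by_cases heJ : e ∈ J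
    · simp only [heJ, if_true]
      exact ⟨(Finset.erase_subset _ _).trans hJ.1,
        nonCrossing_mono (Finset.coe_subset.2 (Finset.erase_subset _ _)) hJ.2⟩
    · simp only [heJ, if_false]
      refine ⟨Finset.insert_subset he hJ.1, ?_⟩
      rw [Finset.coe_insert]
      refine Set.pairwise_insert.2 ⟨hJ.2, ?_⟩
      intro b hb hne
      exact ⟨(h b (hJ.1 hb) hne.symm).symm, h b (hJ.1 hb) hne.symm⟩
  · intro J hJ
    by_cases heJ : e ∈ J
    · simp [heJ, Finset.insert_erase heJ]
    · simp [heJ, Finset.erase_insert heJ]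

/-- If `V` consists of pairwise non-crossing segments, the alternating sum of `M ⊇ V` is sorted by
the intersections of the non-crossing sets with `V`. -/
lemma altSum_eq_sum {M V : Finset (Sym2 (Fin n))} (hVM : V ⊆ M)
    (hV : P.NonCrossing (V : Set (Sym2 (Fin n)))) [DecidableEq (Sym2 (Fin n))]
    [∀ S : Finset (Sym2 (Fin n)), DecidablePred
      fun e => ∀ e' ∈ S, Disjoint (P.openSeg e) (P.openSeg e')] :
    P.altSum M = ∑ S ∈ V.powerset, (-1 : ℤ) ^ S.card *
      P.altSum ((M \ V).filter fun e => ∀ e' ∈ S, Disjoint (P.openSeg e) (P.openSeg e')) := by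
  classical
  unfold altSum
  simp_rw [Finset.mul_sum]
  rw [Finset.sum_sigma']
  refine Finset.sum_bij' (fun J _ => (⟨J ∩ V, J \ V⟩ : (_ : Finset (Sym2 (Fin n))) ×
    Finset (Sym2 (Fin n)))) (fun p _ => p.1 ∪ p.2) ?_ ?_ ?_ ?_ ?_
  · intro J hJ
    rw [Finset.mem_filter, Finset.mem_powerset] at hJ
    rw [Finset.mem_sigma, Finset.mem_powerset, Finset.mem_filter, Finset.mem_powerset]
    refine ⟨Finset.inter_subset_right, fun e he => ?_,
      nonCrossing_mono (Finset.coe_subset.2 Finset.sdiff_subset) hJ.2⟩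
    obtain ⟨heJ, heV⟩ := Finset.mem_sdiff.1 he
    refine Finset.mem_filter.2 ⟨Finset.mem_sdiff.2 ⟨hJ.1 heJ, heV⟩, fun e' he' => ?_⟩
    obtain ⟨h1, h2⟩ := Finset.mem_inter.1 he'
    exact hJ.2 heJ h1 (fun h => heV (h ▸ h2))
  · rintro ⟨S, T⟩ hp
    rw [Finset.mem_sigma, Finset.mem_powerset, Finset.mem_filter, Finset.mem_powerset] at hp
    obtain ⟨hS, hT, hTn⟩ := hp
    simp only at hS hT hTn ⊢
    rw [Finset.mem_filter, Finset.mem_powerset]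
    refine ⟨Finset.union_subset (hS.trans hVM) (hT.trans ((Finset.filter_subset _ _).trans
      Finset.sdiff_subset)), ?_⟩
    rw [Finset.coe_union]
    refine Set.pairwise_union.2
      ⟨nonCrossing_mono (Finset.coe_subset.2 hS) hV, hTn, fun a ha b hb _ => ?_⟩
    have := (Finset.mem_filter.1 (hT hb)).2 a ha
    exact ⟨this.symm, this⟩
  · intro J hJ
    ext e; simp; tauto
  · rintro ⟨S, T⟩ hp
    rw [Finset.mem_sigma, Finset.mem_powerset, Finset.mem_filter, Finset.mem_powerset] at hp
    obtain ⟨hS, hT, -⟩ := hp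
    have hTV : ∀ e ∈ T, e ∉ V := fun e he =>
      (Finset.mem_sdiff.1 (Finset.mem_filter.1 (hT he)).1).2
    have e1 : (S ∪ T) ∩ V = S := by
      ext e; have := hTV e; have := @hS e; simp; tauto
    have e2 : (S ∪ T) \ V = T := by
      ext e; have := hTV e; have := @hS e; simp at *; tauto
    simp only [e1, e2]
  · intro J hJ
    simp only
    rw [← pow_add, Finset.card_inter_add_card_sdiff]

lemma ncard_eq_card_filter [DecidablePred fun J : Finset (Sym2 (Fin n)) =>
      P.NonCrossing (J : Set (Sym2 (Fin n)))] (M : Finset (Sym2 (Fin n))) (i : ℕ) :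
    P.count M i = ((M.powerset.filter
      fun J : Finset (Sym2 (Fin n)) => P.NonCrossing (J : Set (Sym2 (Fin n)))).filter
      fun J => J.card = i).card := by
  rw [count, ← Set.ncard_coe_finset]
  congr 1
  ext J
  simp [and_assoc]

/-- The alternating sum of the numbers of non-crossing sets, in terms of `altSum`. -/
lemma sum_count_eq (M : Finset (Sym2 (Fin n))) {N : ℕ}
    (hN : ∀ J : Finset (Sym2 (Fin n)), J ⊆ M → P.NonCrossing (J : Set (Sym2 (Fin n))) →
      J.card ≤ N) :
    P.altSum M = ∑ i ∈ Finset.range (N + 1), (-1 : ℤ) ^ i * (P.count M i : ℤ) := by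
  classical
  unfold altSum
  rw [← Finset.sum_fiberwise_of_maps_to (t := Finset.range (N + 1)) (g := Finset.card)]
  · refine Finset.sum_congr rfl fun i _ => ?_
    rw [ncard_eq_card_filter, Finset.sum_congr rfl (g := fun _ => (-1 : ℤ) ^ i)]
    · rw [Finset.sum_const, nsmul_eq_mul, mul_comm]
    · intro J hJ
      rw [(Finset.mem_filter.1 hJ).2]
  · intro J hJ
    rw [Finset.mem_filter, Finset.mem_powerset] at hJ
    exact Finset.mem_range.2 (Nat.lt_succ_of_le (hN J hJ.1 hJ.2))

lemma count_zero (M : Finset (Sym2 (Fin n))) : P.count M 0 = 1 := by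
  rw [count, Set.ncard_eq_one]
  refine ⟨∅, ?_⟩
  ext J
  simp only [Finset.card_eq_zero, Set.mem_ofPred_eq, Set.mem_singleton_iff]
  constructor
  · exact fun h => h.2.2
  · rintro rfl
    simp [NonCrossing]

lemma sum_Icc_count_eq (M : Finset (Sym2 (Fin n))) {N : ℕ}
    (hN : ∀ J : Finset (Sym2 (Fin n)), J ⊆ M → P.NonCrossing (J : Set (Sym2 (Fin n))) →
      J.card ≤ N) :
    ∑ i ∈ Finset.Icc 1 N, (-1 : ℤ) ^ (i + 1) * (P.count M i : ℤ) = 1 - P.altSum M := by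
  rw [sum_count_eq M hN, Finset.sum_range_succ', count_zero,
    show Finset.Icc 1 N = Finset.Ico 1 (N + 1) from rfl, Finset.sum_Ico_eq_sum_range]
  have : ∀ k ∈ Finset.range N, (-1 : ℤ) ^ (1 + k + 1) * (P.count M (1 + k) : ℤ) =
      -((-1 : ℤ) ^ (k + 1) * (P.count M (k + 1) : ℤ)) := by
    intro k _
    rw [add_comm 1 k]; ring
  rw [Nat.add_sub_cancel, Finset.sum_congr rfl this, Finset.sum_neg_distrib]
  push_cast
  ring

lemma eulerChar_eq (M : Finset (Sym2 (Fin n))) : P.eulerChar M = P.altSum M := by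
  rw [sum_count_eq M (N := M.card) (fun J hJ _ => Finset.card_le_card hJ), eulerChar]
  refine finsum_eq_sum_of_support_subset _ fun i hi => ?_
  by_contra h
  refine hi ?_
  have : P.count M i = 0 := by
    classical
    rw [ncard_eq_card_filter, Finset.card_eq_zero, Finset.filter_eq_empty_iff]
    intro J hJ hc
    rw [Finset.mem_filter, Finset.mem_powerset] at hJ
    have := Finset.card_le_card hJ.1
    simp at h
    omega
  simp [this]

/-! ### The angular order around an extremal vertex -/

/-- A key that sorts the vertices by the angle under which they are seen from the extremal
vertex `v`, counterclockwise: minus the cotangent of the angle with the direction `h`. -/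
def angleKey (P : Polygon Plane n) (h : Plane) (v x : Fin n) : ℝ :=
  -dot h (P x - P v) / cross h (P x - P v)

lemma IsExtremal.ne_zero {h : Plane} {v : Fin n} (hv : P.IsExtremal h v) {x : Fin n}
    (hx : x ≠ v) : h ≠ 0 := by
  rintro rfl
  have := hv x hx
  simp [cross] at this

lemma IsExtremal.orient_pos_iff {h : Plane} {v : Fin n} (hv : P.IsExtremal h v) {x y : Fin n}
    (hx : x ≠ v) (hy : y ≠ v) :
    0 < orient (P v) (P x) (P y) ↔ P.angleKey h v x < P.angleKey h v y := by
  have e : dot h h * orient (P v) (P x) (P y) =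
      dot h (P x - P v) * cross h (P y - P v) - dot h (P y - P v) * cross h (P x - P v) := by
    simp [orient, cross, dot]; ring
  have hd := dot_self_pos (hv.ne_zero hx)
  rw [angleKey, angleKey, div_lt_div_iff₀ (hv x hx) (hv y hy), ← mul_pos_iff_of_pos_left hd, e]
  constructor <;> intro h1 <;> linarith

lemma IsExtremal.angleKey_ne {h : Plane} {v : Fin n} (hv : P.IsExtremal h v)
    (hg : P.InGeneralPosition) {x y : Fin n} (hx : x ≠ v) (hy : y ≠ v) (hxy : x ≠ y) :
    P.angleKey h v x ≠ P.angleKey h v y := by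
  intro he
  have h1 := hv.orient_pos_iff hx hy
  have h2 := hv.orient_pos_iff hy hx
  rw [orient_swap_right] at h2
  have h3 := hg.orient_ne_zero hx.symm hxy hy.symm
  rcases lt_or_gt_of_ne h3 with h4 | h4
  · exact absurd (h2.1 (by linarith)) (by rw [he]; exact lt_irrefl _)
  · exact absurd (h1.1 h4) (by rw [he]; exact lt_irrefl _)

/-! ### Visibility in a sector -/

/-- The equation of the line `w y` in the affine coordinates with origin `v` given by `w` and
`w'`. -/
lemma orient_ident (v w w' y p : Plane) : orient v w w' * orient w y p =
    orient v w y * (orient v w w' - orient v p w') -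
      (orient v w w' - orient v y w') * orient v w p := by
  simp [orient, cross]; ring

/-- A segment that enters the part of the triangle `v w w'` on the side of `v` of the line `w y`,
and one of whose end points lies on that side of the line but outside of the angle at `v`, meets one
of the sides `v w` and `v w'`. -/
lemma exists_mem_side {v w w' y c d x : Plane} (hD : 0 < orient v w w')
    (hTy : 0 < orient v w y) (hy : orient v y w' + orient v w y ≤ orient v w w')
    (hx : x ∈ openSegment ℝ c d) (hS : 0 < orient v x w') (hT : 0 < orient v w x)
    (hG : 0 ≤ orient w y x) (hGc : 0 < orient w y c)
    (hc : orient v c w' < 0 ∨ orient v w c < 0) (hv : v ∉ openSegment ℝ c d) :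
    ∃ z ∈ openSegment ℝ c d, z ∈ openSegment ℝ v w ∨ z ∈ openSegment ℝ v w' := by
  have hident := orient_ident v w w' y
  have hz : ∀ t : ℝ, 0 < t → t < 1 → x + t • (c - x) ∈ openSegment ℝ c d := by
    intro t h0 h1
    obtain ⟨η, h2, h3, rfl⟩ := mem_openSegment_iff'.1 hx
    refine mem_openSegment_iff'.2 ⟨(1 - t) * η, mul_pos (by linarith) h2, by nlinarith, ?_⟩
    module
  have eS : ∀ t : ℝ, orient v (x + t • (c - x)) w' =
      (1 - t) * orient v x w' + t * orient v c w' := by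
    intro t
    rw [orient_swap_right, orient_segment, orient_swap_right v x, orient_swap_right v c]
    ring
  have eT : ∀ t : ℝ, orient v w (x + t • (c - x)) = (1 - t) * orient v w x + t * orient v w c :=
    fun t => orient_segment _ _ _ _ _
  have eG : ∀ t : ℝ, orient w y (x + t • (c - x)) = (1 - t) * orient w y x + t * orient w y c :=
    fun t => orient_segment _ _ _ _ _
  -- leaving through the side `v w'`
  have exitS : ∀ t : ℝ, 0 < t → t < 1 → orient v (x + t • (c - x)) w' = 0 →
      0 < orient v w (x + t • (c - x)) →
      ∃ z ∈ openSegment ℝ c d, z ∈ openSegment ℝ v w ∨ z ∈ openSegment ℝ v w' := by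
    intro t h0 h1 h2 h3
    refine ⟨_, hz t h0 h1, Or.inr ?_⟩
    have hGz : 0 < orient w y (x + t • (c - x)) := by
      rw [eG]; nlinarith [mul_pos h0 hGc, mul_nonneg (sub_nonneg.2 h1.le) hG]
    have := mul_pos hD hGz
    have hz' := eq_affine_coordinates hD.ne' (x + t • (c - x))
    rw [h2, zero_div, zero_smul, add_zero] at hz'
    rw [hident, h2] at this
    refine mem_openSegment_iff'.2 ⟨_, div_pos h3 hD, (div_lt_one hD).2 ?_, hz'⟩
    by_contra! h4
    nlinarith
  have hS1 : orient v c w' < 0 → ∃ t : ℝ, 0 < t ∧ t < 1 ∧ orient v (x + t • (c - x)) w' = 0 ∧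
      t * (orient v x w' - orient v c w') = orient v x w' := by
    intro h
    have hp : 0 < orient v x w' - orient v c w' := by linarith
    have ht : orient v x w' / (orient v x w' - orient v c w') *
      (orient v x w' - orient v c w') = orient v x w' := div_mul_cancel₀ _ hp.ne'
    refine ⟨_, div_pos hS hp, (div_lt_one hp).2 (by linarith), ?_, ht⟩
    rw [eS]; linarith
  rcases lt_or_ge (orient v w c) 0 with hTc | hTc
  · have hp : 0 < orient v w x - orient v w c := by linarith
    set t := orient v w x / (orient v w x - orient v w c) with htdef
    have ht : t * (orient v w x - orient v w c) = orient v w x := div_mul_cancel₀ _ hp.ne'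
    have h0 : 0 < t := div_pos hT hp
    have h1 : t < 1 := (div_lt_one hp).2 (by linarith)
    have hTz : orient v w (x + t • (c - x)) = 0 := by rw [eT]; linarith
    have hGz : 0 < orient w y (x + t • (c - x)) := by
      rw [eG]; nlinarith [mul_pos h0 hGc, mul_nonneg (sub_nonneg.2 h1.le) hG]
    have hz' := eq_affine_coordinates hD.ne' (x + t • (c - x))
    rw [hTz, zero_div, zero_smul, add_zero] at hz'
    have hid := mul_pos hD hGz
    rw [hident, hTz, mul_zero, sub_zero] at hid
    have hlt : orient v (x + t • (c - x)) w' < orient v w w' := by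
      have := (mul_pos_iff_of_pos_left hTy).1 hid; linarith
    rcases lt_trichotomy (orient v (x + t • (c - x)) w') 0 with h2 | h2 | h2
    · have hSc : orient v c w' < 0 := by
        rw [eS] at h2
        by_contra! h3
        nlinarith [mul_nonneg h0.le h3, mul_pos (sub_pos.2 h1) hS]
      obtain ⟨t', h0', h1', h3, ht'⟩ := hS1 hSc
      refine exitS t' h0' h1' h3 ?_
      have : t' < t := by
        rw [eS] at h2
        by_contra! h4
        nlinarith
      rw [eT]
      nlinarith
    · exfalso
      rw [h2, zero_div, zero_smul, add_zero] at hz'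
      exact hv (hz' ▸ hz t h0 h1)
    · exact ⟨_, hz t h0 h1, Or.inl (mem_openSegment_iff'.2
        ⟨_, div_pos h2 hD, (div_lt_one hD).2 hlt, hz'⟩)⟩
  · obtain ⟨t, h0, h1, h2, -⟩ := hS1 (hc.resolve_right (not_lt.2 hTc))
    refine exitS t h0 h1 h2 ?_
    rw [eT]
    nlinarith [mul_nonneg h0.le hTc, mul_pos (sub_pos.2 h1) hT]

/-- The vertex `y` of the closed triangle `v w w'` is the first one met when a ray from `w` turns
from `v` towards `w'`: the side of `v` of the line `w y` contains no vertex of the triangle other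
than `v`. -/
structure IsFirst (P : Polygon Plane n) (v w w' y : Fin n) : Prop where
  pos : 0 < orient (P v) (P w) (P w')
  ne_v : y ≠ v
  ne_w : y ≠ w
  left_pos : 0 < orient (P v) (P w) (P y)
  right_nonneg : 0 ≤ orient (P v) (P y) (P w')
  add_le : orient (P v) (P y) (P w') + orient (P v) (P w) (P y) ≤ orient (P v) (P w) (P w')
  first : ∀ z, z ≠ v → z ≠ w → 0 ≤ orient (P v) (P z) (P w') → 0 ≤ orient (P v) (P w) (P z) →
    orient (P v) (P z) (P w') + orient (P v) (P w) (P z) ≤ orient (P v) (P w) (P w') →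
    orient (P w) (P y) (P z) ≤ 0

/-- Among the vertices of the triangle, take one on a line through `w` of least slope with respect
to `v w`. -/
lemma InGeneralPosition.exists_isFirst (hg : P.InGeneralPosition) {v w w' : Fin n}
    (hvw : v ≠ w) (hD : 0 < orient (P v) (P w) (P w')) : ∃ y, IsFirst P v w w' y := by
  classical
  have hw'v : w' ≠ v := by rintro rfl; simp at hD
  have hw'w : w' ≠ w := by rintro rfl; simp at hD
  set F := Finset.univ.filter fun z : Fin n => z ≠ v ∧ z ≠ w ∧ 0 ≤ orient (P v) (P z) (P w') ∧
    0 ≤ orient (P v) (P w) (P z) ∧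
    orient (P v) (P z) (P w') + orient (P v) (P w) (P z) ≤ orient (P v) (P w) (P w') with hF
  have hpos : ∀ z ∈ F, 0 < orient (P v) (P w) (P z) := by
    intro z hz
    obtain ⟨-, h1, h2, -, h3, -⟩ := Finset.mem_filter.1 hz
    exact lt_of_le_of_ne h3 (hg.orient_ne_zero hvw (Ne.symm h2) (Ne.symm h1)).symm
  obtain ⟨y, hy, hmin⟩ := F.exists_min_image (fun z => orient (P v) (P w) (P z) /
    (orient (P v) (P w) (P w') - orient (P v) (P z) (P w')))
    ⟨w', by simp [hF, hw'v, hw'w, hD.le]⟩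
  obtain ⟨-, h1, h2, h3, h4, h5⟩ := Finset.mem_filter.1 hy
  refine ⟨y, hD, h1, h2, hpos y hy, h3, h5, fun z hz1 hz2 hz3 hz4 hz5 => ?_⟩
  have hz : z ∈ F := by simp [*]
  have hle := hmin z hz
  have e1 := hpos y hy
  have e2 := hpos z hz
  rw [div_le_div_iff₀ (by linarith) (by linarith)] at hle
  have hid := orient_ident (P v) (P w) (P w') (P y) (P z)
  by_contra! h6
  have := mul_pos hD h6
  nlinarith

section Sector

variable {v w w' y : Fin n}

lemma IsFirst.ne_vw (hf : IsFirst P v w w' y) : v ≠ w := by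
  rintro rfl; have := hf.pos; simp [orient, cross] at this

/-- The only vertex in the interior of the angle at `v` that is not strictly beyond the line `w y`,
seen from `v`, is `y`: such a vertex belongs to the triangle. -/
lemma IsFirst.eq_of_mem (hf : IsFirst P v w w' y) (hg : P.InGeneralPosition) {z : Fin n}
    (hS : 0 < orient (P v) (P z) (P w')) (hT : 0 < orient (P v) (P w) (P z))
    (hG : 0 ≤ orient (P w) (P y) (P z)) : z = y := by
  have hzv : z ≠ v := by rintro rfl; simp at hT
  have hzw : z ≠ w := by rintro rfl; simp at hT
  have hle : orient (P v) (P z) (P w') + orient (P v) (P w) (P z) ≤ orient (P v) (P w) (P w') := by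
    have h1 := orient_ident (P v) (P w) (P w') (P y) (P z)
    have h2 := mul_nonneg hf.pos.le hG
    have h3 := hf.left_pos
    have h4 := hf.add_le
    rw [h1] at h2
    by_contra! h5
    rcases le_or_gt (orient (P v) (P w) (P w')) (orient (P v) (P z) (P w')) with h6 | h6
    · have : 0 < orient (P v) (P w) (P w') - orient (P v) (P y) (P w') := by linarith
      nlinarith [mul_pos this hT, mul_nonneg h3.le (sub_nonneg.2 h6)]
    · nlinarith
  by_contra hzy
  have h1 := hf.first z hzv hzw hS.le hT.le hle
  exact hg.orient_ne_zero hf.ne_w.symm (Ne.symm hzy) (Ne.symm hzw) (le_antisymm h1 hG)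

/-- A segment between two vertices other than `v` that crosses neither `v w` nor `v w'` does not
enter the part of the angle at `v` that is cut off by `w y`. -/
lemma IsFirst.notMem_openSegment (hf : IsFirst P v w w' y) (hs : P.IsSimple)
    (hg : P.InGeneralPosition) {c d : Fin n} (hcd : c ≠ d) (hcv : c ≠ v) (hdv : d ≠ v)
    (hne : s(c, d) ≠ s(w, y))
    (h1 : Disjoint (openSegment ℝ (P c) (P d)) (openSegment ℝ (P v) (P w)))
    (h2 : Disjoint (openSegment ℝ (P c) (P d)) (openSegment ℝ (P v) (P w'))) {x : Plane}
    (hS : 0 < orient (P v) x (P w')) (hT : 0 < orient (P v) (P w) x)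
    (hG : 0 ≤ orient (P w) (P y) x) : x ∉ openSegment ℝ (P c) (P d) := by
  have main : ∀ c d : Fin n, c ≠ d → c ≠ v →
      Disjoint (openSegment ℝ (P c) (P d)) (openSegment ℝ (P v) (P w)) →
      Disjoint (openSegment ℝ (P c) (P d)) (openSegment ℝ (P v) (P w')) →
      x ∈ openSegment ℝ (P c) (P d) → 0 < orient (P w) (P y) (P c) → False := by
    intro c d hcd hcv h1 h2 hx hGc
    have hcw : c ≠ w := by rintro rfl; simp at hGc
    have hc : orient (P v) (P c) (P w') < 0 ∨ orient (P v) (P w) (P c) < 0 := by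
      by_contra! hcon
      have hT' := lt_of_le_of_ne hcon.2 (hg.orient_ne_zero hf.ne_vw hcw.symm hcv.symm).symm
      rcases hcon.1.lt_or_eq with hS' | hS'
      · have := hf.eq_of_mem hg hS' hT' hGc.le
        rw [this] at hGc; simp at hGc
      · have hw'v : v ≠ w' := by rintro rfl; have := hf.pos; simp at this
        have hcw' : c = w' := by
          by_contra hne
          exact hg.orient_ne_zero hcv.symm hne hw'v hS'.symm
        subst hcw'
        have := hf.first c hcv hcw (by simp) hT'.le (by simp)
        linarith
    obtain ⟨z, hz, hz'⟩ := exists_mem_side hf.pos hf.left_pos hf.add_le hx hS hT hG hGc hc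
      (hg.notMem_openSegment hs v hcd)
    rcases hz' with hz' | hz'
    · exact Set.disjoint_left.1 h1 hz hz'
    · exact Set.disjoint_left.1 h2 hz hz'
  intro hx
  by_cases hGc : 0 < orient (P w) (P y) (P c)
  · exact main c d hcd hcv h1 h2 hx hGc
  by_cases hGd : 0 < orient (P w) (P y) (P d)
  · rw [openSegment_symm] at h1 h2 hx
    exact main d c hcd.symm hdv h1 h2 hx hGd
  push Not at hGc hGd
  -- otherwise both end points lie on the line `w y`
  obtain ⟨t, h0, h3, rfl⟩ := mem_openSegment_iff'.1 hx
  rw [orient_segment] at hG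
  have e1 : orient (P w) (P y) (P c) = 0 := by nlinarith
  have e2 : orient (P w) (P y) (P d) = 0 := by nlinarith
  have key : ∀ z, orient (P w) (P y) (P z) = 0 → z = w ∨ z = y := by
    intro z hz
    by_contra! hcon
    exact hg.orient_ne_zero hf.ne_w.symm hcon.2.symm hcon.1.symm hz
  rcases key c e1 with rfl | rfl <;> rcases key d e2 with rfl | rfl
  · exact hcd rfl
  · exact hne rfl
  · exact hne Sym2.eq_swap
  · exact hcd rfl

end Sector

/-! ### The angle at an extremal vertex -/

/-- The vertex `v` is extremal with respect to `h`, and its two neighbours on the polygon are `lo`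
and `hi`, in counterclockwise order. -/
structure IsCorner (P : Polygon Plane n) (h : Plane) (v lo hi : Fin n) : Prop where
  extremal : P.IsExtremal h v
  pos : 0 < orient (P v) (P lo) (P hi)
  neighbours : (finRotate n v = lo ∧ finRotate n hi = v) ∨ (finRotate n v = hi ∧ finRotate n lo = v)

lemma IsExtremal.exists_isCorner {h : Plane} {v : Fin n} (hv : P.IsExtremal h v) (hs : P.IsSimple)
    (hg : P.InGeneralPosition) : ∃ lo hi, IsCorner P h v lo hi := by
  have hn := hs.three_le
  obtain ⟨b, rfl⟩ := (finRotate n).surjective v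
  have h1 := finRotate_ne hn b
  have h2 := finRotate_ne hn (finRotate n b)
  have h3 := finRotate_finRotate_ne hn b
  rcases lt_or_gt_of_ne (hg.orient_ne_zero h2.symm h3 h1) with h4 | h4
  · exact ⟨b, _, hv, by rw [orient_swap_right]; linarith, Or.inr ⟨rfl, rfl⟩⟩
  · exact ⟨_, b, hv, h4, Or.inl ⟨rfl, rfl⟩⟩

section Corner

variable {h : Plane} {v lo hi : Fin n}

lemma IsCorner.lo_ne (hc : IsCorner P h v lo hi) : lo ≠ v := by
  rintro rfl; have := hc.pos; simp [orient, cross] at this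

lemma IsCorner.hi_ne (hc : IsCorner P h v lo hi) : hi ≠ v := by
  rintro rfl; have := hc.pos; simp at this

lemma IsCorner.lo_ne_hi (hc : IsCorner P h v lo hi) : lo ≠ hi := by
  rintro rfl; have := hc.pos; simp at this

lemma IsCorner.key_lt (hc : IsCorner P h v lo hi) : P.angleKey h v lo < P.angleKey h v hi :=
  (hc.extremal.orient_pos_iff hc.lo_ne hc.hi_ne).1 hc.pos

/-- The edges at the vertex `v` are `v lo` and `v hi`. -/
lemma IsCorner.edge (hc : IsCorner P h v lo hi) {i : Fin n} (hi' : i = v ∨ finRotate n i = v) :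
    ∃ j, (j = lo ∨ j = hi) ∧
      segment ℝ (P i) (P (finRotate n i)) = segment ℝ (P v) (P j) := by
  rcases hi' with rfl | hi'
  · rcases hc.neighbours with ⟨h1, -⟩ | ⟨h1, -⟩
    · exact ⟨lo, Or.inl rfl, by rw [h1]⟩
    · exact ⟨hi, Or.inr rfl, by rw [h1]⟩
  · rcases hc.neighbours with ⟨-, h1⟩ | ⟨-, h1⟩
    · obtain rfl := (finRotate n).injective (hi'.trans h1.symm)
      exact ⟨i, Or.inr rfl, by rw [hi', segment_symm]⟩
    · obtain rfl := (finRotate n).injective (hi'.trans h1.symm)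
      exact ⟨i, Or.inl rfl, by rw [hi', segment_symm]⟩

/-- The open edges at `v` lie on the boundary. -/
lemma IsCorner.exists_edge (hc : IsCorner P h v lo hi) {j : Fin n} (hj : j = lo ∨ j = hi) :
    ∃ i, (i = v ∨ finRotate n i = v) ∧
      openSegment ℝ (P i) (P (finRotate n i)) = openSegment ℝ (P v) (P j) := by
  rcases hc.neighbours with ⟨h1, h2⟩ | ⟨h1, h2⟩ <;> rcases hj with rfl | rfl
  · exact ⟨v, Or.inl rfl, by rw [h1]⟩
  · exact ⟨j, Or.inr h2, by rw [h2, openSegment_symm]⟩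
  · exact ⟨j, Or.inr h2, by rw [h2, openSegment_symm]⟩
  · exact ⟨v, Or.inl rfl, by rw [h1]⟩

/-- A diagonal at the extremal vertex `v` lies in the angle of the polygon at `v`. -/
lemma IsCorner.key_lt_of_diagonal (hc : IsCorner P h v lo hi) (hs : P.IsSimple)
    (hg : P.InGeneralPosition) {x : Fin n} (hx : s(v, x) ∈ P.diagonals) :
    P.angleKey h v lo < P.angleKey h v x ∧ P.angleKey h v x < P.angleKey h v hi := by
  obtain ⟨h1, h2, h3⟩ := isChord_mk hx.1
  have hxlo : x ≠ lo := by
    rintro rfl; rcases hc.neighbours with h | h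
    · exact h2 h.1
    · exact h3 h.2
  have hxhi : x ≠ hi := by
    rintro rfl; rcases hc.neighbours with h | h
    · exact h3 h.2
    · exact h2 h.1
  have hpos := hc.pos
  have hedge : ∀ i, (i = v ∨ finRotate n i = v) →
      segment ℝ (P i) (P (finRotate n i)) = segment ℝ (P v) (P lo) ∨
      segment ℝ (P i) (P (finRotate n i)) = segment ℝ (P v) (P hi) := by
    intro i hi'
    obtain ⟨j, rfl | rfl, hj⟩ := hc.edge hi'
    · exact Or.inl hj
    · exact Or.inr hj
  have hsub : openSegment ℝ (P v) (P x) ⊆ P.inside := hx.2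
  rw [← hc.extremal.orient_pos_iff hc.lo_ne h1.symm, ← hc.extremal.orient_pos_iff h1.symm hc.hi_ne]
  by_contra! hcon
  by_cases h4 : 0 < orient (P v) (P lo) (P x)
  · have h5 := lt_of_le_of_ne (hcon h4) (hg.orient_ne_zero h1 hxhi hc.hi_ne.symm)
    refine hc.extremal.not_subset_inside (σ := -1) hs (fun i hi' => (hedge i hi').symm) ?_ ?_ ?_
      (hc.extremal _ hc.lo_ne) hsub
    · change 0 < -1 * orient (P v) (P x) (P hi); linarith
    · change 0 < -1 * orient (P v) (P x) (P lo); rw [orient_swap_right]; linarith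
    · change 0 < -1 * orient (P v) (P hi) (P lo); rw [orient_swap_right]; linarith
  · have h5 := lt_of_le_of_ne (not_lt.1 h4) (hg.orient_ne_zero hc.lo_ne.symm hxlo.symm h1)
    refine hc.extremal.not_subset_inside (σ := 1) hs hedge ?_ ?_ ?_
      (hc.extremal _ hc.hi_ne) hsub
    · change 0 < 1 * orient (P v) (P x) (P lo); rw [orient_swap_right]; linarith
    · change 0 < 1 * orient (P v) (P x) (P hi)
      rw [one_mul, hc.extremal.orient_pos_iff h1.symm hc.hi_ne]
      have h6 : P.angleKey h v x < P.angleKey h v lo := by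
        rw [← hc.extremal.orient_pos_iff h1.symm hc.lo_ne, orient_swap_right]; linarith
      exact h6.trans hc.key_lt
    · change 0 < 1 * orient (P v) (P lo) (P hi); linarith

/-- A vertex `x` is a spoke of the corner `v` if the segment `v x` is an edge or a diagonal. -/
def IsCorner.IsSpoke (_ : IsCorner P h v lo hi) (x : Fin n) : Prop :=
  x = lo ∨ x = hi ∨ s(v, x) ∈ P.diagonals

lemma IsCorner.IsSpoke.ne {hc : IsCorner P h v lo hi} {x : Fin n} (hx : hc.IsSpoke x) : x ≠ v := by
  rcases hx with rfl | rfl | hx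
  · exact hc.lo_ne
  · exact hc.hi_ne
  · exact (isChord_mk hx.1).1.symm

lemma IsCorner.IsSpoke.key_le {hc : IsCorner P h v lo hi} (hs : P.IsSimple)
    (hg : P.InGeneralPosition) {x : Fin n} (hx : hc.IsSpoke x) :
    P.angleKey h v lo ≤ P.angleKey h v x ∧ P.angleKey h v x ≤ P.angleKey h v hi := by
  rcases hx with rfl | rfl | hx
  · exact ⟨le_rfl, hc.key_lt.le⟩
  · exact ⟨hc.key_lt.le, le_rfl⟩
  · have := hc.key_lt_of_diagonal hs hg hx
    exact ⟨this.1.le, this.2.le⟩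

lemma IsCorner.IsSpoke.disjoint_edge {hc : IsCorner P h v lo hi} (hs : P.IsSimple) {x : Fin n}
    (hx : hc.IsSpoke x) {i : Fin n} (h1 : i ≠ v) (h2 : finRotate n i ≠ v) :
    Disjoint (openSegment ℝ (P v) (P x)) (segment ℝ (P i) (P (finRotate n i))) := by
  have hedge : (x = lo ∨ x = hi) →
      Disjoint (openSegment ℝ (P v) (P x)) (segment ℝ (P i) (P (finRotate n i))) := by
    intro hx
    obtain ⟨j, hj, hj'⟩ := hc.exists_edge hx
    rw [← hj']
    refine hs.openEdge_disjoint ?_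
    rintro rfl
    exact hj.elim h1 h2
  rcases hx with hx | hx | hx
  · exact hedge (Or.inl hx)
  · exact hedge (Or.inr hx)
  · refine Set.disjoint_left.2 fun q hq hq' => ?_
    exact (hx.2 hq).1 (mem_boundary.2 ⟨i, hq'⟩)

lemma IsCorner.disjoint_of_diagonal (hc : IsCorner P h v lo hi) {x : Fin n} {e : Sym2 (Fin n)}
    (he : e ∈ P.diagonals) (hx : x = lo ∨ x = hi) :
    Disjoint (P.openSeg e) (openSegment ℝ (P v) (P x)) := by
  obtain ⟨j, hj, hj'⟩ := hc.exists_edge hx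
  rw [← hj']
  refine Set.disjoint_left.2 fun q hq hq' => (he.2 hq).1 ?_
  exact mem_boundary.2 ⟨j, openSegment_subset_segment _ _ _ hq'⟩

variable {w w' y : Fin n}

/-- The part of the angle between two spokes that is cut off by the first line `w y` meets the
boundary at most in the edge `w y`. -/
lemma IsCorner.notMem_boundary (hc : IsCorner P h v lo hi) (hs : P.IsSimple)
    (hg : P.InGeneralPosition) (hw : hc.IsSpoke w) (hw' : hc.IsSpoke w') (hf : IsFirst P v w w' y)
    {x : Plane} (hxy : x ≠ P y) (hS : 0 < orient (P v) x (P w')) (hT : 0 < orient (P v) (P w) x)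
    (hG : 0 ≤ orient (P w) (P y) x)
    (hadj : 0 < orient (P w) (P y) x ∨ ∀ i, s(i, finRotate n i) ≠ s(w, y)) :
    x ∉ P.boundary ℝ := by
  intro hx
  obtain ⟨i, hi'⟩ := mem_boundary.1 hx
  have hvert : ∀ k, x ≠ P k := by
    rintro k rfl
    exact hxy (by rw [hf.eq_of_mem hg hS hT hG])
  by_cases hiv : i = v ∨ finRotate n i = v
  · obtain ⟨j, hj, he⟩ := hc.edge hiv
    rw [he] at hi'
    obtain ⟨t, h0, -, rfl⟩ := mem_segment_iff'.1 hi'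
    rw [orient_segment, orient_self_left, mul_zero, zero_add] at hT
    rw [orient_swap_right, orient_segment, orient_self_left, mul_zero, zero_add,
      orient_swap_right] at hS
    have hT' : 0 < orient (P v) (P w) (P j) := by
      by_contra! h; nlinarith
    have hS' : 0 < orient (P v) (P j) (P w') := by
      by_contra! h; nlinarith
    have hjv : j ≠ v := by rintro rfl; simp at hT'
    rw [hc.extremal.orient_pos_iff hw.ne hjv] at hT'
    rw [hc.extremal.orient_pos_iff hjv hw'.ne] at hS'
    rcases hj with rfl | rfl
    · have := (hw.key_le hs hg).1; linarith
    · have := (hw'.key_le hs hg).2; linarith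
  · push Not at hiv
    have hio : x ∈ openSegment ℝ (P i) (P (finRotate n i)) := by
      rcases mem_segment_cases hi' with h1 | h1 | h1
      · exact absurd h1 (hvert _)
      · exact absurd h1 (hvert _)
      · exact h1
    refine hf.notMem_openSegment hs hg (finRotate_ne hs.three_le i).symm hiv.1 hiv.2 ?_
      ((hw.disjoint_edge hs hiv.1 hiv.2).symm.mono_left (openSegment_subset_segment _ _ _))
      ((hw'.disjoint_edge hs hiv.1 hiv.2).symm.mono_left (openSegment_subset_segment _ _ _))
      hS hT hG hio
    intro he
    rcases hadj with h1 | h1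
    · have : orient (P w) (P y) x = 0 := by
        rcases Sym2.eq_iff.1 he with ⟨rfl, h2⟩ | ⟨rfl, h2⟩
        · exact orient_eq_zero_of_mem_segment (h2 ▸ hi')
        · rw [h2, segment_symm] at hi'
          exact orient_eq_zero_of_mem_segment hi'
      linarith
    · exact h1 i he

/-- The cut-off part of the angle is interior: it is star-shaped with respect to a point close to
`v`, whose parity is odd. -/
lemma IsCorner.mem_inside (hc : IsCorner P h v lo hi) (hs : P.IsSimple)
    (hg : P.InGeneralPosition) (hw : hc.IsSpoke w) (hw' : hc.IsSpoke w') (hf : IsFirst P v w w' y)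
    {x : Plane} (hxy : x ≠ P y) (hS : 0 < orient (P v) x (P w')) (hT : 0 < orient (P v) (P w) x)
    (hG : 0 ≤ orient (P w) (P y) x)
    (hadj : 0 < orient (P w) (P y) x ∨ ∀ i, s(i, finRotate n i) ≠ s(w, y)) :
    x ∈ P.inside := by
  have hD := hf.pos
  have hkw := (hc.extremal.orient_pos_iff hw.ne hw'.ne).1 hD
  -- a point close to `v` between the two spokes
  set u := (P w - P v) + (P w' - P v) with hu
  have hhu : 0 < cross h u := by
    rw [hu, cross_add_right]; exact add_pos (hc.extremal _ hw.ne) (hc.extremal _ hw'.ne)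
  have hev : ∀ᶠ ε in nhdsWithin (0 : ℝ) (Set.Ioi 0), (∀ k, k ≠ v →
      cross h (P v + ε • u - P v) < cross h (P k - P v)) ∧
      0 < orient (P w) (P y) (P v + ε • u) := by
    refine (Filter.Eventually.filter_mono nhdsWithin_le_nhds
      (Filter.eventually_all.2 fun k => ?_)).and
      (eventually_add_smul_mem (w := u) (U := {q | 0 < orient (P w) (P y) q}) ?_)
    · by_cases hk : k = v
      · exact Filter.Eventually.of_forall fun _ h => absurd hk h
      have hcont : Continuous fun ε : ℝ => cross h (P v + ε • u - P v) := by fun_prop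
      have h0 : cross h (P v + (0 : ℝ) • u - P v) < cross h (P k - P v) := by
        simpa [cross_zero_right] using hc.extremal k hk
      have := hcont.continuousAt.eventually (gt_mem_nhds h0)
      filter_upwards [this] with ε hε _ using hε
    · refine IsOpen.mem_nhds (isOpen_lt continuous_const (continuous_orient _ _)) ?_
      change 0 < orient (P w) (P y) (P v)
      rw [orient_rotate]; exact hf.left_pos
  obtain ⟨ε, ⟨h1, h2⟩, hε⟩ := (hev.and self_mem_nhdsWithin).exists
  have hε : 0 < ε := hε
  set q := P v + ε • u with hq
  have hqv : q - P v = ε • u := by rw [hq]; abel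
  have hSq : 0 < orient (P v) q (P w') := by
    have : orient (P v) q (P w') = ε * orient (P v) (P w) (P w') := by
      simp [hq, hu, orient, cross]; ring
    rw [this]; exact mul_pos hε hD
  have hTq : 0 < orient (P v) (P w) q := by
    have : orient (P v) (P w) q = ε * orient (P v) (P w) (P w') := by
      simp [hq, hu, orient, cross]; ring
    rw [this]; exact mul_pos hε hD
  have hGy : ∀ z, 0 < orient (P w) (P y) z → z ≠ P y := by
    rintro z hz rfl; simp at hz
  have hqi : q ∈ P.inside := by
    refine mem_inside_of_parity (hc.extremal.ne_zero hc.lo_ne)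
      (hc.notMem_boundary hs hg hw hw' hf (hGy _ h2) hSq hTq h2.le (Or.inl h2)) ?_
    have e1 : cross (q - P v) (P lo - P v) =
        -(ε * (orient (P v) (P lo) (P w) + orient (P v) (P lo) (P w'))) := by
      rw [hqv, hu]; simp [orient, cross]; ring
    have e2 : cross (q - P v) (P hi - P v) =
        ε * (orient (P v) (P w) (P hi) + orient (P v) (P w') (P hi)) := by
      rw [hqv, hu]; simp [orient, cross]; ring
    have hlt : ∀ {a b : Fin n}, a ≠ v → b ≠ v → P.angleKey h v a < P.angleKey h v b →
        0 < orient (P v) (P a) (P b) := fun ha hb => (hc.extremal.orient_pos_iff ha hb).2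
    have hle : ∀ {a b : Fin n}, a ≠ v → b ≠ v → P.angleKey h v a ≤ P.angleKey h v b →
        0 ≤ orient (P v) (P a) (P b) := by
      intro a b ha hb hab
      by_contra! hneg
      refine absurd ((hc.extremal.orient_pos_iff hb ha).1 ?_) (not_lt.2 hab)
      rw [orient_swap_right]; linarith
    have k1 := hw.key_le hs hg
    have k2 := hw'.key_le hs hg
    have f1 : cross (q - P v) (P lo - P v) < 0 := by
      rw [e1, neg_lt_zero]
      exact mul_pos hε (add_pos_of_nonneg_of_pos (hle hc.lo_ne hw.ne k1.1)
        (hlt hc.lo_ne hw'.ne (by linarith)))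
    have f2 : 0 < cross (q - P v) (P hi - P v) := by
      rw [e2]
      exact mul_pos hε (add_pos_of_pos_of_nonneg (hlt hw.ne hc.hi_ne (by linarith))
        (hle hw'.ne hc.hi_ne k2.2))
    have hq0 : 0 < cross h (q - P v) := by
      rw [hqv, cross_smul_right]; exact mul_pos hε hhu
    rcases hc.neighbours with ⟨h3, h4⟩ | ⟨h3, h4⟩
    · refine hc.extremal.parity_eq_one hs.three_le h4 hq0 h1 ?_
      rw [h3]; exact mul_neg_of_neg_of_pos f1 f2
    · refine hc.extremal.parity_eq_one hs.three_le h4 hq0 h1 ?_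
      rw [h3]; exact mul_neg_of_pos_of_neg f2 f1
  refine mem_inside_of_mem (convex_segment q x).isPreconnected ?_ (left_mem_segment ℝ _ _)
    (right_mem_segment ℝ _ _) hqi
  intro z hz
  obtain ⟨t, ht0, ht1, rfl⟩ := mem_segment_iff'.1 hz
  rcases ht1.lt_or_eq with ht1 | rfl
  · have h1t := sub_pos.2 ht1
    have hGz : 0 < orient (P w) (P y) (q + t • (x - q)) := by
      rw [orient_segment]
      exact add_pos_of_pos_of_nonneg (mul_pos h1t h2) (mul_nonneg ht0 hG)
    refine hc.notMem_boundary hs hg hw hw' hf (hGy _ hGz) ?_ ?_ hGz.le (Or.inl hGz)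
    · rw [orient_swap_right, orient_segment, orient_swap_right (P v) q, orient_swap_right (P v) x]
      nlinarith [mul_pos h1t hSq, mul_nonneg ht0 hS.le]
    · rw [orient_segment]
      exact add_pos_of_pos_of_nonneg (mul_pos h1t hTq) (mul_nonneg ht0 hT.le)
  · rw [one_smul, add_sub_cancel]
    exact hc.notMem_boundary hs hg hw hw' hf hxy hS hT hG hadj

/-- If `w y` is no edge of the polygon, it is a diagonal. -/
lemma IsCorner.openSegment_subset_inside (hc : IsCorner P h v lo hi) (hs : P.IsSimple)
    (hg : P.InGeneralPosition) (hw : hc.IsSpoke w) (hw' : hc.IsSpoke w') (hf : IsFirst P v w w' y)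
    (hadj : ∀ i, s(i, finRotate n i) ≠ s(w, y)) :
    openSegment ℝ (P w) (P y) ⊆ P.inside := by
  intro x hx
  have hne : x ≠ P y := by
    rintro rfl; exact right_notMem_openSegment (hs.ne hf.ne_w.symm) hx
  obtain ⟨t, h0, h1, rfl⟩ := mem_openSegment_iff'.1 hx
  refine hc.mem_inside hs hg hw hw' hf hne ?_ ?_ ?_ (Or.inr hadj)
  · rw [orient_swap_right, orient_segment, orient_swap_right (P v) (P w),
      orient_swap_right (P v) (P y)]
    nlinarith [mul_pos (sub_pos.2 h1) hf.pos, mul_nonneg h0.le hf.right_nonneg]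
  · rw [orient_segment, orient_self_right]
    have := mul_pos h0 hf.left_pos; linarith
  · rw [orient_segment]; simp

/-- If the first vertex `y` is not on the side `v w'`, it is visible from `v`. -/
lemma IsCorner.spoke_subset_inside (hc : IsCorner P h v lo hi) (hs : P.IsSimple)
    (hg : P.InGeneralPosition) (hw : hc.IsSpoke w) (hw' : hc.IsSpoke w') (hf : IsFirst P v w w' y)
    (hy : 0 < orient (P v) (P y) (P w')) : openSegment ℝ (P v) (P y) ⊆ P.inside := by
  intro x hx
  have hne : x ≠ P y := by
    rintro rfl; exact right_notMem_openSegment (hs.ne hf.ne_v.symm) hx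
  obtain ⟨t, h0, h1, rfl⟩ := mem_openSegment_iff'.1 hx
  have hG : 0 < orient (P w) (P y) (P v + t • (P y - P v)) := by
    rw [orient_segment, orient_self_right, orient_rotate]
    have := mul_pos (sub_pos.2 h1) hf.left_pos; linarith
  refine hc.mem_inside hs hg hw hw' hf hne ?_ ?_ hG.le (Or.inl hG)
  · rw [orient_swap_right, orient_segment, orient_self_left, orient_swap_right (P v) (P y)]
    have := mul_pos h0 hy; linarith
  · rw [orient_segment, orient_self_left]
    have := mul_pos h0 hf.left_pos; linarith

end Corner

/-! ### Adding a diagonal at an extremal vertex -/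

section Corner

variable {h : Plane} {v lo hi : Fin n}

/-- If some vertex other than `v` is not in the set `S` of spokes, then two spokes of `S` that are
neighbours in the angular order are not consecutive vertices: otherwise `S` and `v` together would
form a closed part of the polygon. -/
lemma IsCorner.exists_gap (hc : IsCorner P h v lo hi) (hs : P.IsSimple)
    (hg : P.InGeneralPosition) {S : Finset (Fin n)} (hS : ∀ x ∈ S, hc.IsSpoke x) (hlo : lo ∈ S)
    (hhi : hi ∈ S) {t : Fin n} (htv : t ≠ v) (ht : t ∉ S) :
    ∃ w ∈ S, ∃ w' ∈ S, P.angleKey h v w < P.angleKey h v w' ∧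
      (∀ x ∈ S, P.angleKey h v x ≤ P.angleKey h v w ∨ P.angleKey h v w' ≤ P.angleKey h v x) ∧
      ∀ i, s(i, finRotate n i) ≠ s(w, w') := by
  by_contra! hcon
  have hadj : ∀ w ∈ S, ∀ w' ∈ S, P.angleKey h v w < P.angleKey h v w' →
      (∀ x ∈ S, P.angleKey h v x ≤ P.angleKey h v w ∨ P.angleKey h v w' ≤ P.angleKey h v x) →
      finRotate n w = w' ∨ finRotate n w' = w := by
    intro w hw w' hw' h1 h2
    obtain ⟨i, hi⟩ := hcon w hw w' hw' h1 h2
    rcases Sym2.eq_iff.1 hi with ⟨rfl, h3⟩ | ⟨rfl, h3⟩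
    · exact Or.inl h3
    · exact Or.inr h3
  have hinj : ∀ x ∈ S, ∀ y ∈ S, P.angleKey h v x = P.angleKey h v y → x = y := by
    intro x hx y hy hxy
    by_contra hne
    exact hc.extremal.angleKey_ne hg (hS x hx).ne (hS y hy).ne hne hxy
  have hclosed : ∀ j, (j = v ∨ j ∈ S) → (finRotate n j = v ∨ finRotate n j ∈ S) := by
    rintro j (rfl | hj)
    · rcases hc.neighbours with h1 | h1
      · exact Or.inr (h1.1 ▸ hlo)
      · exact Or.inr (h1.1 ▸ hhi)
    -- the neighbours of `j` on both sides of the angular order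
    obtain ⟨a, ha, haj⟩ : ∃ a, (a = v ∧ j = lo ∨ a ∈ S ∧ P.angleKey h v a < P.angleKey h v j) ∧
        (finRotate n j = a ∨ finRotate n a = j) := by
      by_cases hjlo : j = lo
      · subst hjlo
        exact ⟨v, Or.inl ⟨rfl, rfl⟩, hc.neighbours.symm.imp And.right And.left⟩
      · obtain ⟨a, ha, hmax⟩ := Finset.exists_max_image
          (S.filter fun x => P.angleKey h v x < P.angleKey h v j)
          (P.angleKey h v) ⟨lo, Finset.mem_filter.2 ⟨hlo, lt_of_le_of_ne ((hS j hj).key_le hs hg).1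
            fun h => hjlo (hinj _ hj _ hlo h.symm)⟩⟩
        rw [Finset.mem_filter] at ha
        refine ⟨a, Or.inr ha, (hadj a ha.1 j hj ha.2 fun x hx => ?_).symm⟩
        rcases lt_or_ge (P.angleKey h v x) (P.angleKey h v j) with h1 | h1
        · exact Or.inl (hmax x (Finset.mem_filter.2 ⟨hx, h1⟩))
        · exact Or.inr h1
    obtain ⟨b, hb, hbj⟩ : ∃ b, (b = v ∧ j = hi ∨ b ∈ S ∧ P.angleKey h v j < P.angleKey h v b) ∧
        (finRotate n j = b ∨ finRotate n b = j) := by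
      by_cases hjhi : j = hi
      · subst hjhi
        exact ⟨v, Or.inl ⟨rfl, rfl⟩, hc.neighbours.imp And.right And.left⟩
      · obtain ⟨b, hb, hmin⟩ := Finset.exists_min_image
          (S.filter fun x => P.angleKey h v j < P.angleKey h v x)
          (P.angleKey h v) ⟨hi, Finset.mem_filter.2 ⟨hhi, lt_of_le_of_ne ((hS j hj).key_le hs hg).2
            fun h => hjhi (hinj _ hj _ hhi h)⟩⟩
        rw [Finset.mem_filter] at hb
        refine ⟨b, Or.inr hb, hadj j hj b hb.1 hb.2 fun x hx => ?_⟩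
        rcases lt_or_ge (P.angleKey h v j) (P.angleKey h v x) with h1 | h1
        · exact Or.inr (hmin x (Finset.mem_filter.2 ⟨hx, h1⟩))
        · exact Or.inl h1
    have hab : a ≠ b := by
      rintro rfl
      rcases ha with ha | ha <;> rcases hb with hb | hb
      · exact hc.lo_ne_hi (ha.2.symm.trans hb.2)
      · exact (hS a hb.1).ne ha.1
      · exact (hS a ha.1).ne hb.1
      · exact lt_asymm ha.2 hb.2
    have hav := ha.imp And.left And.left
    have hbv := hb.imp And.left And.left
    rcases haj with rfl | haj
    · exact hav
    rcases hbj with rfl | hbj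
    · exact hbv
    exact absurd ((finRotate n).injective (haj.trans hbj.symm)) hab
  exact (forall_of_finRotate (p := fun j => j = v ∨ j ∈ S) (Or.inl rfl) hclosed t).elim htv ht

end Corner

open Classical in
/-- The diagonals that do not end at `v` and cross none of the segments from `v` to `S`. -/
def farDiagonals (P : Polygon Plane n) (v : Fin n) (S : Finset (Fin n)) : Finset (Sym2 (Fin n)) :=
  Finset.univ.filter fun e => e ∈ P.diagonals ∧ v ∉ e ∧
    ∀ x ∈ S, Disjoint (P.openSeg e) (openSegment ℝ (P v) (P x))

lemma mem_farDiagonals {v : Fin n} {S : Finset (Fin n)} {e : Sym2 (Fin n)} :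
    e ∈ P.farDiagonals v S ↔ e ∈ P.diagonals ∧ v ∉ e ∧
      ∀ x ∈ S, Disjoint (P.openSeg e) (openSegment ℝ (P v) (P x)) := by
  simp [farDiagonals]

/-- Let `S` be a set of end points of diagonals at the extremal vertex `v`, and suppose that some
vertex `t ≠ v` is neither in `S` nor next to `v`. Then one of the diagonals that avoid `v` and the
diagonals from `v` to `S` crosses no other one, or there is a further diagonal `v y` that is crossed
by none of them; in the latter case `y` lies in the interior of a triangle of vertices. -/
lemma IsCorner.isolated_or_insert {h : Plane} {v lo hi : Fin n} (hc : IsCorner P h v lo hi)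
    (hs : P.IsSimple) (hg : P.InGeneralPosition) {S : Finset (Fin n)}
    (hS : ∀ x ∈ S, s(v, x) ∈ P.diagonals) {t : Fin n} (htv : t ≠ v) (htlo : t ≠ lo) (hthi : t ≠ hi)
    (ht : t ∉ S) :
    (∃ e ∈ P.farDiagonals v S, ∀ e' ∈ P.farDiagonals v S, e' ≠ e →
      Disjoint (P.openSeg e') (P.openSeg e)) ∨
    ∃ w w' y, y ∉ S ∧ s(v, y) ∈ P.diagonals ∧ P.farDiagonals v (insert y S) = P.farDiagonals v S ∧
      0 < orient (P v) (P y) (P w') ∧ 0 < orient (P v) (P w) (P y) ∧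
      orient (P v) (P y) (P w') + orient (P v) (P w) (P y) < orient (P v) (P w) (P w') := by
  classical
  set S' := insert lo (insert hi S) with hS'
  have hspoke : ∀ x ∈ S', hc.IsSpoke x := by
    intro x hx
    simp only [hS', Finset.mem_insert] at hx
    exact hx.imp_right fun hx => hx.imp_right (hS x)
  obtain ⟨w, hwS, w', hwS', hlt, hgap, hnadj⟩ := hc.exists_gap hs hg hspoke (t := t)
    (by simp [hS']) (by simp [hS']) htv (by simp [hS', htlo, hthi, ht])
  have hw := hspoke w hwS
  have hw' := hspoke w' hwS'
  have hD := (hc.extremal.orient_pos_iff hw.ne hw'.ne).2 hlt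
  obtain ⟨y, hf⟩ := hg.exists_isFirst hw.ne.symm hD
  -- far diagonals avoid all spokes of `S'`
  have hfar : ∀ e ∈ P.farDiagonals v S, ∀ x ∈ S',
      Disjoint (P.openSeg e) (openSegment ℝ (P v) (P x)) := by
    intro e he x hx
    rw [mem_farDiagonals] at he
    simp only [hS', Finset.mem_insert] at hx
    rcases hx with hx | hx | hx
    · exact hc.disjoint_of_diagonal he.1 (Or.inl hx)
    · exact hc.disjoint_of_diagonal he.1 (Or.inr hx)
    · exact he.2.2 x hx
  -- they do not enter the part of the angle `w v w'` cut off by `w y`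
  have hregion : ∀ e ∈ P.farDiagonals v S, e ≠ s(w, y) → ∀ x, 0 < orient (P v) x (P w') →
      0 < orient (P v) (P w) x → 0 ≤ orient (P w) (P y) x → x ∉ P.openSeg e := by
    intro e he hne x h1 h2 h3
    have hd1 := hfar e he w hwS
    have hd2 := hfar e he w' hwS'
    rw [mem_farDiagonals] at he
    induction e with | h c d
    have hcd := (isChord_mk he.1.1).1
    have hvcd : v ≠ c ∧ v ≠ d := by simpa using he.2.1
    exact hf.notMem_openSegment hs hg hcd hvcd.1.symm hvcd.2.symm hne hd1 hd2 h1 h2 h3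
  by_cases hadj : ∀ i, s(i, finRotate n i) ≠ s(w, y)
  · left
    have hmem : s(w, y) ∈ P.farDiagonals v S := by
      refine mem_farDiagonals.2 ⟨⟨⟨by simpa using hf.ne_w.symm, fun i hi => hadj i hi.symm⟩,
        hc.openSegment_subset_inside hs hg hw hw' hf hadj⟩, by simp [hf.ne_vw, hf.ne_v.symm], ?_⟩
      intro x hx
      rw [openSeg_mk, Set.disjoint_left]
      intro q hq hq'
      have hxS' : x ∈ S' := by simp [hS', hx]
      have hxv := (hspoke x hxS').ne
      obtain ⟨t, h0, h1, rfl⟩ := mem_openSegment_iff'.1 hq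
      obtain ⟨r, hr0, -, hr⟩ := mem_openSegment_iff'.1 hq'
      have hT : 0 < r * orient (P v) (P w) (P x) := by
        have e1 := orient_segment (P v) (P w) (P w) (P y) t
        rw [hr, orient_segment, orient_self_left, orient_self_right] at e1
        have := mul_pos h0 hf.left_pos
        linarith
      have hSx : 0 < r * orient (P v) (P x) (P w') := by
        have e1 := orient_segment (P v) (P w') (P w) (P y) t
        rw [hr, orient_segment, orient_self_left, orient_swap_right (P v) (P x),
          orient_swap_right (P v) (P w), orient_swap_right (P v) (P y)] at e1
        have := mul_pos (sub_pos.2 h1) hf.pos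
        have := mul_nonneg h0.le hf.right_nonneg
        linarith
      rw [mul_pos_iff_of_pos_left hr0] at hT hSx
      rw [hc.extremal.orient_pos_iff hw.ne hxv] at hT
      rw [hc.extremal.orient_pos_iff hxv hw'.ne] at hSx
      rcases hgap x hxS' with h | h <;> linarith
    refine ⟨_, hmem, fun e' he' hne => Set.disjoint_right.2 fun q hq => ?_⟩
    obtain ⟨t, h0, h1, rfl⟩ := mem_openSegment_iff'.1 hq
    refine hregion e' he' hne _ ?_ ?_ ?_
    · rw [orient_swap_right, orient_segment, orient_swap_right (P v) (P w),
        orient_swap_right (P v) (P y)]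
      nlinarith [mul_pos (sub_pos.2 h1) hf.pos, mul_nonneg h0.le hf.right_nonneg]
    · rw [orient_segment, orient_self_right]
      have := mul_pos h0 hf.left_pos; linarith
    · rw [orient_segment]; simp
  · right
    have hyw' : y ≠ w' := by
      rintro rfl; exact hadj hnadj
    have hww' : w ≠ w' := by
      rintro rfl; exact lt_irrefl _ hlt
    have hSy : 0 < orient (P v) (P y) (P w') :=
      lt_of_le_of_ne hf.right_nonneg (hg.orient_ne_zero hf.ne_v.symm hyw' hw'.ne.symm).symm
    have hyS' : y ∉ S' := by
      intro hy
      have h1 := (hc.extremal.orient_pos_iff hw.ne hf.ne_v).1 hf.left_pos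
      have h2 := (hc.extremal.orient_pos_iff hf.ne_v hw'.ne).1 hSy
      rcases hgap y hy with h | h <;> linarith
    simp only [hS', Finset.mem_insert, not_or] at hyS'
    refine ⟨w, w', y, hyS'.2.2, ⟨isChord_mk_of hf.ne_v.symm ?_ ?_,
      hc.spoke_subset_inside hs hg hw hw' hf hSy⟩, ?_, hSy, hf.left_pos, ?_⟩
    · rcases hc.neighbours with h1 | h1 <;> rw [h1.1]
      · exact Ne.symm hyS'.1
      · exact Ne.symm hyS'.2.1
    · intro h1
      rcases hc.neighbours with h2 | h2
      · exact hyS'.2.1 ((finRotate n).injective (h1.trans h2.2.symm))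
      · exact hyS'.1 ((finRotate n).injective (h1.trans h2.2.symm))
    · ext e
      have key : e ∈ P.farDiagonals v S →
          Disjoint (P.openSeg e) (openSegment ℝ (P v) (P y)) := by
        intro he
        refine Set.disjoint_right.2 fun q hq => ?_
        have hne : e ≠ s(w, y) := by
          rintro rfl
          exact hadj fun i hi => (mem_farDiagonals.1 he).1.1.2 i hi.symm
        obtain ⟨t, h0, h1, rfl⟩ := mem_openSegment_iff'.1 hq
        refine hregion e he hne _ ?_ ?_ ?_
        · rw [orient_swap_right, orient_segment, orient_self_left, orient_swap_right (P v) (P y)]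
          have := mul_pos h0 hSy; linarith
        · rw [orient_segment, orient_self_left]
          have := mul_pos h0 hf.left_pos; linarith
        · rw [orient_segment, orient_self_right, orient_rotate]
          have := mul_pos (sub_pos.2 h1) hf.left_pos; linarith
      constructor
      · intro he
        rw [mem_farDiagonals] at he ⊢
        exact ⟨he.1, he.2.1, fun x hx => he.2.2 x (Finset.mem_insert_of_mem hx)⟩
      · intro he
        have hk := key he
        rw [mem_farDiagonals] at he ⊢
        refine ⟨he.1, he.2.1, fun x hx => ?_⟩
        rcases Finset.mem_insert.1 hx with rfl | hx
        · exact hk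
        · exact he.2.2 x hx
    · refine lt_of_le_of_ne hf.add_le fun heq => ?_
      refine hg.orient_ne_zero hww' hyw'.symm hf.ne_w.symm ?_
      have : orient (P w) (P w') (P y) = orient (P v) (P w) (P w') -
          (orient (P v) (P y) (P w') + orient (P v) (P w) (P y)) := by
        simp [orient, cross]; ring
      rw [this, heq, sub_self]

/-! ### Edges of the convex hull -/

/-- The segment from `P i` to `P j` is an edge of the convex hull of the vertices, directed so that
all other vertices lie strictly to its left. -/
def IsHullEdge (P : Polygon Plane n) (i j : Fin n) : Prop :=
  i ≠ j ∧ ∀ k, k ≠ i → k ≠ j → 0 < orient (P i) (P j) (P k)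

/-- The vertex farthest from the origin is extremal. -/
lemma IsSimple.exists_isExtremal (hs : P.IsSimple) : ∃ h v, P.IsExtremal h v := by
  have : Nonempty (Fin n) := ⟨⟨0, by have := hs.three_le; omega⟩⟩
  obtain ⟨v, -, hv⟩ := Finset.univ.exists_max_image (fun i => dot (P i) (P i)) Finset.univ_nonempty
  refine ⟨WithLp.toLp 2 ![-P v 1, P v 0], v, fun k hk => ?_⟩
  have h1 := hv k (Finset.mem_univ k)
  have h2 := dot_self_pos (sub_ne_zero.2 (hs.ne hk))
  simp only [dot, cross, PiLp.sub_apply, Matrix.cons_val_zero, Matrix.cons_val_one] at *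
  nlinarith

lemma IsExtremal.exists_isHullEdge {h : Plane} {v : Fin n} (hv : P.IsExtremal h v)
    (hs : P.IsSimple) (hg : P.InGeneralPosition) :
    (∃ j, P.IsHullEdge v j) ∧ ∃ b, P.IsHullEdge b v := by
  have hne : (Finset.univ.filter fun x : Fin n => x ≠ v).Nonempty :=
    ⟨finRotate n v, Finset.mem_filter.2 ⟨Finset.mem_univ _, finRotate_ne hs.three_le v⟩⟩
  constructor
  · obtain ⟨j, hj, hmin⟩ := Finset.exists_min_image _ (P.angleKey h v) hne
    have hjv := (Finset.mem_filter.1 hj).2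
    refine ⟨j, hjv.symm, fun k hk hkj => ?_⟩
    rw [hv.orient_pos_iff hjv hk]
    exact lt_of_le_of_ne (hmin k (Finset.mem_filter.2 ⟨Finset.mem_univ k, hk⟩))
      (hv.angleKey_ne hg hjv hk hkj.symm)
  · obtain ⟨b, hb, hmax⟩ := Finset.exists_max_image _ (P.angleKey h v) hne
    have hbv := (Finset.mem_filter.1 hb).2
    refine ⟨b, hbv, fun k hkb hk => ?_⟩
    rw [← orient_rotate, hv.orient_pos_iff hk hbv]
    exact lt_of_le_of_ne (hmax k (Finset.mem_filter.2 ⟨Finset.mem_univ k, hk⟩))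
      (hv.angleKey_ne hg hk hbv hkb)

lemma IsHullEdge.nonneg {i j : Fin n} (he : P.IsHullEdge i j) (k : Fin n) :
    0 ≤ orient (P i) (P j) (P k) := by
  by_cases h1 : k = i
  · simp [h1]
  by_cases h2 : k = j
  · simp [h2]
  exact (he.2 k h1 h2).le

lemma IsHullEdge.eq_or_eq {i j : Fin n} (he : P.IsHullEdge i j) {k : Fin n}
    (hk : orient (P i) (P j) (P k) ≤ 0) : k = i ∨ k = j := by
  by_contra! h
  exact absurd (he.2 k h.1 h.2) (not_lt.2 hk)

/-- The polygon has a third vertex, which cannot lie on both sides of a line. -/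
lemma IsHullEdge.not_swap {i j : Fin n} (he : P.IsHullEdge i j) (hs : P.IsSimple) :
    ¬ P.IsHullEdge j i := by
  have hn := hs.three_le
  intro he'
  obtain ⟨k, hk1, hk2⟩ : ∃ k, k ≠ i ∧ k ≠ j := by
    by_cases hj : finRotate n i = j
    · exact ⟨_, finRotate_finRotate_ne hn i, hj ▸ finRotate_ne hn _⟩
    · exact ⟨_, finRotate_ne hn i, hj⟩
  have h1 := he.2 k hk1 hk2
  have h2 := he'.2 k hk2 hk1
  rw [orient_swap_left] at h2
  linarith

/-- If `a` is an end point of the hull edge and `b` the other one, tilting the edge around `a`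
shows that `a` is extremal. -/
lemma IsHullEdge.exists_isExtremal_aux {i j a b : Fin n} (he : P.IsHullEdge i j) (hs : P.IsSimple)
    {σ : ℝ} (hσ : σ ≠ 0) (hb : σ • (P b - P a) = P j - P i)
    (hab : ∀ k, orient (P i) (P j) (P k) = cross (P j - P i) (P k - P a))
    (hij : ∀ k, k = i ∨ k = j → k = a ∨ k = b) : ∃ h, P.IsExtremal h a := by
  obtain ⟨w, hw⟩ := exists_cross_pos (sub_ne_zero.2 (hs.ne he.1.symm)) (neg_ne_zero.2 hσ)
  have hev : ∀ᶠ ε in nhdsWithin (0 : ℝ) (Set.Ioi 0), ∀ k, k ≠ a →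
      0 < cross (P j - P i + ε • w) (P k - P a) := by
    refine Filter.eventually_all.2 fun k => ?_
    by_cases hk : k = a
    · exact Filter.Eventually.of_forall fun _ h => absurd hk h
    by_cases hkb : k = b
    · subst hkb
      filter_upwards [self_mem_nhdsWithin] with ε hε _
      have hε : 0 < ε := hε
      have e : σ * cross (P j - P i + ε • w) (P k - P a) = ε * -cross (P j - P i) w := by
        rw [← cross_smul_right, hb, cross_add_left, cross_smul_left, cross_self, cross_swap w]
        ring
      have h2 : 0 < σ * (σ * cross (P j - P i + ε • w) (P k - P a)) := by
        rw [e]; nlinarith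
      rw [← mul_assoc] at h2
      exact (mul_pos_iff_of_pos_left (mul_self_pos.2 hσ)).1 h2
    · have hcont : Continuous fun ε : ℝ => cross (P j - P i + ε • w) (P k - P a) := by
        unfold cross; fun_prop
      have h0 : 0 < cross (P j - P i + (0 : ℝ) • w) (P k - P a) := by
        rw [zero_smul, add_zero, ← hab]
        by_contra! hle
        exact (hij k (he.eq_or_eq hle)).elim hk hkb
      filter_upwards [(hcont.continuousAt.eventually (lt_mem_nhds h0)).filter_mono
        nhdsWithin_le_nhds] with ε hε _ using hε
  obtain ⟨ε, hε⟩ := hev.exists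
  exact ⟨_, hε⟩

lemma IsHullEdge.exists_isExtremal {i j : Fin n} (he : P.IsHullEdge i j) (hs : P.IsSimple) :
    (∃ h, P.IsExtremal h i) ∧ ∃ h, P.IsExtremal h j := by
  refine ⟨he.exists_isExtremal_aux hs (b := j) one_ne_zero (one_smul _ _) (fun _ => rfl)
    fun _ => id, he.exists_isExtremal_aux hs (b := i) (neg_ne_zero.2 one_ne_zero) (by simp)
    (fun k => ?_) fun _ => Or.symm⟩
  simp [orient, cross]; ring

/-- A segment between vertices does not cross an edge of the convex hull. -/
lemma IsHullEdge.disjoint {i j c d : Fin n} (he : P.IsHullEdge i j) (hcd : c ≠ d)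
    (hne : s(c, d) ≠ s(i, j)) :
    Disjoint (openSegment ℝ (P c) (P d)) (segment ℝ (P i) (P j)) := by
  refine Set.disjoint_left.2 fun x hx hx' => ?_
  have h0 := orient_eq_zero_of_mem_segment hx'
  obtain ⟨t, ht0, ht1, rfl⟩ := mem_openSegment_iff'.1 hx
  rw [orient_segment] at h0
  have h1 := mul_nonneg (sub_pos.2 ht1).le (he.nonneg c)
  have h2 := mul_nonneg ht0.le (he.nonneg d)
  have hc : orient (P i) (P j) (P c) ≤ 0 := by
    by_contra! h; nlinarith [mul_pos (sub_pos.2 ht1) h]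
  have hd : orient (P i) (P j) (P d) ≤ 0 := by
    by_contra! h; nlinarith [mul_pos ht0 h]
  rcases he.eq_or_eq hc with rfl | rfl <;> rcases he.eq_or_eq hd with rfl | rfl
  · exact hcd rfl
  · exact hne rfl
  · exact hne Sym2.eq_swap
  · exact hcd rfl

lemma IsHullEdge.orient_nonneg_of_mem_boundary {i j : Fin n} (he : P.IsHullEdge i j) {x : Plane}
    (hx : x ∈ P.boundary ℝ) : 0 ≤ orient (P i) (P j) x := by
  obtain ⟨k, hk⟩ := mem_boundary.1 hx
  obtain ⟨t, ht0, ht1, rfl⟩ := mem_segment_iff'.1 hk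
  rw [orient_segment]
  exact add_nonneg (mul_nonneg (sub_nonneg.2 ht1) (he.nonneg _)) (mul_nonneg ht0 (he.nonneg _))

/-- A point off the boundary that does not lie strictly to the left of an edge of the convex hull
is exterior. -/
lemma IsHullEdge.mem_outside {i j : Fin n} (he : P.IsHullEdge i j) (hs : P.IsSimple) {x : Plane}
    (hx : x ∉ P.boundary ℝ) (hx' : orient (P i) (P j) x ≤ 0) : x ∈ P.outside := by
  obtain ⟨w, hw⟩ := exists_cross_pos (sub_ne_zero.2 (hs.ne he.1.symm)) (neg_ne_zero.2 one_ne_zero)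
  have hw0 : w ≠ 0 := by
    rintro rfl; simp [cross_zero_right] at hw
  refine mem_outside_of_ray hw0 fun τ hτ hmem => ?_
  rcases hτ.lt_or_eq with hτ | rfl
  · have h1 := he.orient_nonneg_of_mem_boundary hmem
    rw [orient_add_smul] at h1
    nlinarith
  · simp at hmem; exact hx hmem

/-- An edge of the convex hull that is no edge of the polygon is an epigonal. -/
lemma IsHullEdge.openSegment_subset_outside {i j : Fin n} (he : P.IsHullEdge i j) (hs : P.IsSimple)
    (hg : P.InGeneralPosition) (hadj : ∀ k, s(k, finRotate n k) ≠ s(i, j)) :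
    openSegment ℝ (P i) (P j) ⊆ P.outside := by
  intro x hx
  have hxs := openSegment_subset_segment _ _ _ hx
  refine he.mem_outside hs (fun hb => ?_) (orient_eq_zero_of_mem_segment hxs).le
  obtain ⟨k, hk⟩ := mem_boundary.1 hb
  rcases mem_segment_cases hk with rfl | rfl | hk
  · exact hg.notMem_openSegment hs _ he.1 hx
  · exact hg.notMem_openSegment hs _ he.1 hx
  · exact Set.disjoint_left.1 (he.disjoint (finRotate_ne hs.three_le k).symm (hadj k)) hk hxs

/-! ### Convex polygons -/

/-- Every edge of the convex hull of the vertices is an edge of the polygon. -/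
def HullEdgesAreEdges (P : Polygon Plane n) : Prop :=
  ∀ i j, P.IsHullEdge i j → ∃ k, s(k, finRotate n k) = s(i, j)

lemma IsConvex.hullEdgesAreEdges (hc : P.IsConvex) (hs : P.IsSimple) (hg : P.InGeneralPosition) :
    P.HullEdgesAreEdges := by
  intro i j he
  by_contra! hadj
  have hsub := he.openSegment_subset_outside hs hg hadj
  have hmid : P i + (1 / 2 : ℝ) • (P j - P i) ∈ openSegment ℝ (P i) (P j) :=
    mem_openSegment_iff'.2 ⟨1 / 2, by norm_num, by norm_num, rfl⟩
  rcases hc.segment_subset (Or.inr (vertex_mem_boundary P i)) (Or.inr (vertex_mem_boundary P j))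
    (openSegment_subset_segment _ _ _ hmid) with h | h
  · exact Set.disjoint_left.1 disjoint_inside_outside h (hsub hmid)
  · exact (hsub hmid).1 h

namespace HullEdgesAreEdges

lemma exists_isExtremal (ha : P.HullEdgesAreEdges) (hs : P.IsSimple) (hg : P.InGeneralPosition)
    (v : Fin n) : (∃ h, P.IsExtremal h v) ∧
      (P.IsHullEdge v (finRotate n v) ∨ P.IsHullEdge (finRotate n v) v) := by
  have hn := hs.three_le
  have step : ∀ v, (∃ h, P.IsExtremal h v) →
      P.IsHullEdge v (finRotate n v) ∨ P.IsHullEdge (finRotate n v) v := by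
    rintro v ⟨h, hv⟩
    obtain ⟨⟨j, hj⟩, ⟨b, hb⟩⟩ := hv.exists_isHullEdge hs hg
    have hjb : j ≠ b := by
      rintro rfl
      exact hj.not_swap hs hb
    obtain ⟨k, hk⟩ := ha v j hj
    obtain ⟨l, hl⟩ := ha b v hb
    rcases Sym2.eq_iff.1 hk with ⟨rfl, h1⟩ | ⟨rfl, h1⟩
    · exact Or.inl (h1 ▸ hj)
    rcases Sym2.eq_iff.1 hl with ⟨rfl, h2⟩ | ⟨rfl, h2⟩
    · exact absurd ((finRotate n).injective (h1.trans h2.symm)) hjb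
    · exact Or.inr (h2 ▸ hb)
  obtain ⟨h, u, hu⟩ := hs.exists_isExtremal
  have hall : ∀ v, ∃ h, P.IsExtremal h v := fun v =>
    forall_of_finRotate (p := fun v => ∃ h, P.IsExtremal h v) ⟨h, hu⟩ (fun v hv =>
      (step v hv).elim (fun he => (he.exists_isExtremal hs).2)
        fun he => (he.exists_isExtremal hs).1) v
  exact ⟨hall v, step v (hall v)⟩

/-- The interior is the intersection of the open half planes to the left of the edges of the convex
hull. -/
lemma mem_inside_iff (ha : P.HullEdgesAreEdges) (hs : P.IsSimple) (hg : P.InGeneralPosition)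
    {x : Plane} : x ∈ P.inside ↔ ∀ i j, P.IsHullEdge i j → 0 < orient (P i) (P j) x := by
  constructor
  · intro hx i j he
    by_contra! h
    exact Set.disjoint_left.1 disjoint_inside_outside hx (he.mem_outside hs hx.1 h)
  · intro hx
    have hconv : Convex ℝ {x | ∀ i j, P.IsHullEdge i j → 0 < orient (P i) (P j) x} := by
      intro p hp q hq α β hα hβ hαβ i j he
      have := convex_halfPlane (P i) (P j) 1 (by simpa using hp i j he)
        (by simpa using hq i j he) hα hβ hαβ
      simpa using this
    have hd : {x | ∀ i j, P.IsHullEdge i j → 0 < orient (P i) (P j) x} ⊆ (P.boundary ℝ)ᶜ := by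
      intro p hp hpb
      obtain ⟨k, hk⟩ := mem_boundary.1 hpb
      rcases (ha.exists_isExtremal hs hg k).2 with he | he
      · exact (hp _ _ he).ne' (orient_eq_zero_of_mem_segment hk)
      · rw [segment_symm] at hk
        exact (hp _ _ he).ne' (orient_eq_zero_of_mem_segment hk)
    -- a point of a triangle of vertices that is known to be interior
    obtain ⟨h, v, hv⟩ := hs.exists_isExtremal
    obtain ⟨lo, hi, hc⟩ := hv.exists_isCorner hs hg
    obtain ⟨y, hf⟩ := hg.exists_isFirst hc.lo_ne.symm hc.pos
    set q := P v + (1 / 4 : ℝ) • (P lo - P v) + (1 / 4 : ℝ) • (P y - P v) with hq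
    have hor : ∀ a b, orient a b q = (1 / 2) * orient a b (P v) + (1 / 4) * orient a b (P lo) +
        (1 / 4) * orient a b (P y) := by
      intro a b; simp [hq, orient, cross]; ring
    have hG : 0 < orient (P lo) (P y) q := by
      rw [hor, orient_rotate, orient_self_left, orient_self_right]
      have := hf.left_pos; linarith
    have hqi : q ∈ P.inside := by
      refine hc.mem_inside hs hg (Or.inl rfl) (Or.inr (Or.inl rfl)) hf ?_ ?_ ?_ hG.le (Or.inl hG)
      · intro h; rw [h] at hG; simp at hG
      · rw [orient_swap_right, hor, orient_self_left, orient_swap_right (P v) (P lo),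
          orient_swap_right (P v) (P y)]
        have := hf.pos; have := hf.right_nonneg; linarith
      · rw [hor, orient_self_left, orient_self_right]
        have := hf.left_pos; linarith
    refine mem_inside_of_mem hconv.isPreconnected hd (x := q) ?_ hx hqi
    intro i j he
    rw [hor]
    have h1 := he.nonneg v
    have h2 := he.nonneg lo
    have h3 := he.nonneg y
    by_contra! hle
    have := hf.ne_vw
    have := hf.ne_v
    have := hf.ne_w
    have e1 := he.eq_or_eq (k := v) (by linarith)
    have e2 := he.eq_or_eq (k := lo) (by linarith)
    have e3 := he.eq_or_eq (k := y) (by linarith)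
    grind

lemma isConvex (ha : P.HullEdgesAreEdges) (hs : P.IsSimple) (hg : P.InGeneralPosition) :
    P.IsConvex := by
  have heq : P.inside ∪ P.boundary ℝ =
      {x | ∀ i j, P.IsHullEdge i j → 0 ≤ orient (P i) (P j) x} := by
    ext x
    constructor
    · rintro (hx | hx) i j he
      · exact ((ha.mem_inside_iff hs hg).1 hx i j he).le
      · exact he.orient_nonneg_of_mem_boundary hx
    · intro hx
      by_contra hcon
      rw [Set.mem_union, not_or] at hcon
      refine hcon.1 ((ha.mem_inside_iff hs hg).2 fun i j he => ?_)
      refine lt_of_le_of_ne (hx i j he) fun h0 => hcon.2 ?_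
      -- a point of the line `i j` to the left of the two adjacent hull edges lies in the edge
      obtain ⟨⟨hi, hi'⟩, ⟨hj, hj'⟩⟩ := he.exists_isExtremal hs
      obtain ⟨b, hb⟩ := (hi'.exists_isHullEdge hs hg).2
      obtain ⟨k, hk⟩ := (hj'.exists_isHullEdge hs hg).1
      have hxe := eq_smul_of_cross_eq_zero (sub_ne_zero.2 (hs.ne he.1.symm))
        (show cross (P j - P i) (x - P i) = 0 from h0.symm)
      set s := dot (P j - P i) (x - P i) / dot (P j - P i) (P j - P i)
      have hxs : x = P i + s • (P j - P i) := by rw [← hxe]; abel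
      have h1 := hx b i hb
      have h2 := hx j k hk
      rw [hxs, orient_segment] at h1 h2
      rw [orient_self_right] at h1
      rw [orient_self_left] at h2
      have hbj : b ≠ j := by rintro rfl; exact he.not_swap hs hb
      have hki : k ≠ i := by rintro rfl; exact he.not_swap hs hk
      have h3 := hb.2 j hbj.symm he.1.symm
      have h4 := hk.2 i he.1 hki.symm
      have hmem : x ∈ segment ℝ (P i) (P j) := by
        refine mem_segment_iff'.2 ⟨s, ?_, ?_, hxs⟩
        · by_contra! h; nlinarith
        · by_contra! h; nlinarith
      obtain ⟨k, hk⟩ := ha i j he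
      refine mem_boundary.2 ⟨k, ?_⟩
      rcases Sym2.eq_iff.1 hk with ⟨rfl, h5⟩ | ⟨rfl, h5⟩
      · rwa [h5]
      · rwa [h5, segment_symm]
  rw [IsConvex, heq]
  intro p hp q hq α β hα hβ hαβ i j he
  rw [orient_combo _ _ _ _ hαβ]
  exact add_nonneg (mul_nonneg hα (hp i j he)) (mul_nonneg hβ (hq i j he))

lemma isChord_mem_diagonals (ha : P.HullEdgesAreEdges) (hs : P.IsSimple) (hg : P.InGeneralPosition)
    {e : Sym2 (Fin n)} (he : IsChord e) : e ∈ P.diagonals := by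
  refine ⟨he, fun x hx => (ha.mem_inside_iff hs hg).2 fun i j hij => ?_⟩
  induction e with | h c d
  by_contra! hle
  obtain ⟨t, ht0, ht1, rfl⟩ := mem_openSegment_iff'.1 hx
  rw [orient_segment] at hle
  have h1 := mul_nonneg (sub_pos.2 ht1).le (hij.nonneg c)
  have h2 := mul_nonneg ht0.le (hij.nonneg d)
  have hc : orient (P i) (P j) (P c) ≤ 0 := by
    by_contra! h; nlinarith [mul_pos (sub_pos.2 ht1) h]
  have hd : orient (P i) (P j) (P d) ≤ 0 := by
    by_contra! h; nlinarith [mul_pos ht0 h]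
  obtain ⟨k, hk⟩ := ha i j hij
  have hcd := (isChord_mk he).1
  refine he.2 k (Eq.trans ?_ hk.symm)
  rcases hij.eq_or_eq hc with rfl | rfl <;> rcases hij.eq_or_eq hd with rfl | rfl
  · exact absurd rfl hcd
  · rfl
  · exact Sym2.eq_swap
  · exact absurd rfl hcd

/-- No vertex lies in the interior of a triangle of vertices. -/
lemma notMem_triangle (ha : P.HullEdgesAreEdges) (hs : P.IsSimple) (hg : P.InGeneralPosition)
    {v w w' y : Fin n} (h1 : 0 < orient (P v) (P y) (P w')) (h2 : 0 < orient (P v) (P w) (P y))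
    (h3 : orient (P v) (P y) (P w') + orient (P v) (P w) (P y) < orient (P v) (P w) (P w')) :
    False := by
  obtain ⟨h, hy⟩ := (ha.exists_isExtremal hs hg y).1
  have e : (orient (P v) (P w) (P w') - orient (P v) (P y) (P w') - orient (P v) (P w) (P y)) *
      cross h (P v - P y) + orient (P v) (P y) (P w') * cross h (P w - P y) +
      orient (P v) (P w) (P y) * cross h (P w' - P y) = 0 := by
    simp [orient, cross]; ring
  have hv : v ≠ y := by rintro rfl; simp at h2
  have hw : w ≠ y := by rintro rfl; simp at h2
  have hw' : w' ≠ y := by rintro rfl; simp at h1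
  have := mul_pos h1 (hy w hw)
  have := mul_pos h2 (hy w' hw')
  have := mul_pos (by linarith : 0 < orient (P v) (P w) (P w') - orient (P v) (P y) (P w') -
    orient (P v) (P w) (P y)) (hy v hv)
  linarith

/-- Every diagonal that does not end at `v` is crossed by some segment from `v` to a vertex. -/
lemma exists_crossing (ha : P.HullEdgesAreEdges) (hs : P.IsSimple) (hg : P.InGeneralPosition)
    {v c d : Fin n} (hcd : IsChord s(c, d)) (hvc : v ≠ c) (hvd : v ≠ d) :
    ∃ x, x ≠ v ∧ ¬ Disjoint (openSegment ℝ (P c) (P d)) (openSegment ℝ (P v) (P x)) := by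
  have hne := (isChord_mk hcd).1
  have hv0 := hg.orient_ne_zero hne hvd.symm hvc.symm
  -- a vertex on the other side of the line `c d`
  obtain ⟨x, hxc, hxd, hx⟩ : ∃ x, x ≠ c ∧ x ≠ d ∧
      orient (P c) (P d) (P v) * orient (P c) (P d) (P x) < 0 := by
    by_contra! hcon
    rcases lt_or_gt_of_ne hv0 with hv | hv
    · have he : P.IsHullEdge d c := by
        refine ⟨hne.symm, fun k hkd hkc => ?_⟩
        have h1 := hcon k hkc hkd
        have h2 := hg.orient_ne_zero hne hkd.symm hkc.symm
        rw [orient_swap_left, neg_pos]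
        exact lt_of_le_of_ne (by by_contra! h; nlinarith) h2
      obtain ⟨k, hk⟩ := ha d c he
      exact hcd.2 k (by rw [hk, Sym2.eq_swap])
    · have he : P.IsHullEdge c d := by
        refine ⟨hne, fun k hkc hkd => ?_⟩
        have h1 := hcon k hkc hkd
        have h2 := hg.orient_ne_zero hne hkd.symm hkc.symm
        exact lt_of_le_of_ne (by by_contra! h; nlinarith) h2.symm
      obtain ⟨k, hk⟩ := ha c d he
      exact hcd.2 k hk.symm
  have hxv : x ≠ v := by rintro rfl; nlinarith [mul_self_nonneg (orient (P c) (P d) (P x))]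
  refine ⟨x, hxv, Set.not_disjoint_iff.2 ?_⟩
  set a := orient (P c) (P d) (P v) with hadef
  set b := orient (P c) (P d) (P x) with hbdef
  have hab : a - b ≠ 0 := by
    intro h; rw [sub_eq_zero.1 h] at hx; nlinarith [mul_self_nonneg b]
  set r := a / (a - b) with hr
  have hrab : r * (a - b) = a := div_mul_cancel₀ _ hab
  have hr0 : 0 < r := by
    have h1 : r * (a - b) ^ 2 = a ^ 2 - a * b := by rw [pow_two, ← mul_assoc, hrab]; ring
    by_contra! h; nlinarith [sq_nonneg a, sq_nonneg (a - b)]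
  have hr1 : r < 1 := by
    have h1 : (1 - r) * (a - b) ^ 2 = b ^ 2 - a * b := by
      have : r * (a - b) ^ 2 = a ^ 2 - a * b := by rw [pow_two, ← mul_assoc, hrab]; ring
      linarith
    by_contra! h; nlinarith [sq_nonneg b, sq_nonneg (a - b)]
  set z := P v + r • (P x - P v) with hz
  have hz0 : orient (P c) (P d) z = 0 := by
    rw [hz, orient_segment, ← hadef, ← hbdef, hr]; field_simp; ring
  have hze := eq_smul_of_cross_eq_zero (sub_ne_zero.2 (hs.ne hne.symm))
    (show cross (P d - P c) (z - P c) = 0 from hz0)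
  set s := dot (P d - P c) (z - P c) / dot (P d - P c) (P d - P c)
  have hzs : z = P c + s • (P d - P c) := by rw [← hze]; abel
  -- `c` and `d` are extremal, so neither lies in the triangle of `v`, `x` and the other one
  obtain ⟨g, hgc⟩ := (ha.exists_isExtremal hs hg c).1
  obtain ⟨g', hgd⟩ := (ha.exists_isExtremal hs hg d).1
  have e1 : (1 - r) * cross g (P v - P c) + r * cross g (P x - P c) = s * cross g (P d - P c) := by
    rw [← cross_smul_right s, ← hze, hz]; simp [cross]; ring
  have e2 : (1 - r) * cross g' (P v - P d) + r * cross g' (P x - P d) =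
      (1 - s) * cross g' (P c - P d) := by
    have : z - P d = (1 - s) • (P c - P d) := by rw [hzs]; module
    rw [← cross_smul_right (1 - s), ← this, hz]; simp [cross]; ring
  have h1 := hgc d hne.symm
  have h2 := hgd c hne
  refine ⟨z, mem_openSegment_iff'.2 ⟨s, ?_, ?_, hzs⟩, mem_openSegment_iff'.2 ⟨r, hr0, hr1, rfl⟩⟩
  · have := mul_pos (sub_pos.2 hr1) (hgc v hvc)
    have := mul_pos hr0 (hgc x hxc)
    by_contra! h; nlinarith
  · have := mul_pos (sub_pos.2 hr1) (hgd v hvd)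
    have := mul_pos hr0 (hgd x hxd)
    by_contra! h; nlinarith

end HullEdgesAreEdges

/-! ### Evaluation of the alternating sums -/

open Classical in
/-- The vertices that are joined to `v` by a diagonal. -/
def diagonalEnds (P : Polygon Plane n) (v : Fin n) : Finset (Fin n) :=
  Finset.univ.filter fun x => s(v, x) ∈ P.diagonals

lemma mem_diagonalEnds {v x : Fin n} : x ∈ P.diagonalEnds v ↔ s(v, x) ∈ P.diagonals := by
  simp [diagonalEnds]

open Classical in
/-- The alternating sum of the diagonals, sorted by the diagonals at the vertex `v`. -/
lemma InGeneralPosition.altSum_diagonals (hg : P.InGeneralPosition) (v : Fin n)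
    {D : Finset (Sym2 (Fin n))} (hD : ∀ e, e ∈ D ↔ e ∈ P.diagonals) :
    P.altSum D = ∑ S ∈ (P.diagonalEnds v).powerset,
      (-1 : ℤ) ^ S.card * P.altSum (P.farDiagonals v S) := by
  set N := P.diagonalEnds v with hN
  have hinj : Function.Injective fun x : Fin n => s(v, x) := fun x y h => by
    rcases Sym2.eq_iff.1 h with h | h
    · exact h.2
    · exact h.2.trans h.1
  have hV : P.NonCrossing
      ((N.image fun x => s(v, x) : Finset (Sym2 (Fin n))) : Set (Sym2 (Fin n))) := by
    intro e he e' he' hne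
    simp only [Finset.coe_image, Set.mem_image, Finset.mem_coe] at he he'
    obtain ⟨x, hx, rfl⟩ := he
    obtain ⟨y, hy, rfl⟩ := he'
    have hxy : x ≠ y := fun h => hne (by rw [h])
    have hvx := (isChord_mk (mem_diagonalEnds.1 hx).1).1
    have hvy := (isChord_mk (mem_diagonalEnds.1 hy).1).1
    refine Set.disjoint_left.2 fun q hq hq' => hg.orient_ne_zero hvx hxy hvy ?_
    have h0 := orient_eq_zero_of_mem_segment (openSegment_subset_segment _ _ _ hq)
    obtain ⟨t, ht, -, rfl⟩ := mem_openSegment_iff'.1 hq'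
    rw [orient_segment, orient_self_left, mul_zero, zero_add] at h0
    exact (mul_eq_zero.1 h0).resolve_left ht.ne'
  have hVD : (N.image fun x => s(v, x)) ⊆ D := by
    intro e he
    obtain ⟨x, hx, rfl⟩ := Finset.mem_image.1 he
    exact (hD _).2 (mem_diagonalEnds.1 hx)
  rw [altSum_eq_sum hVD hV, Finset.powerset_image, Finset.sum_image]
  · refine Finset.sum_congr rfl fun S _ => ?_
    rw [Finset.card_image_of_injective _ hinj]
    congr 2
    ext e
    simp only [Finset.mem_filter, Finset.mem_sdiff, Finset.mem_image, mem_farDiagonals, hD,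
      forall_exists_index, and_imp, forall_apply_eq_imp_iff₂, openSeg_mk, hN, mem_diagonalEnds,
      and_assoc]
    refine and_congr_right fun he => and_congr_left fun _ => not_congr ⟨?_, fun h => ?_⟩
    · rintro ⟨x, -, rfl⟩; simp
    · obtain ⟨x, rfl⟩ := Sym2.mem_iff_exists.1 h
      exact ⟨x, he, rfl⟩
  · exact (Finset.image_injective hinj).injOn

lemma altSum_empty : P.altSum ∅ = 1 := by
  classical
  rw [altSum, Finset.powerset_empty, Finset.filter_singleton, if_pos (by simp [NonCrossing]),
    Finset.sum_singleton, Finset.card_empty, pow_zero]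

section

variable {h : Plane} {v lo hi : Fin n}

/-- If one of the chords at the extremal vertex `v` is no diagonal, inserting diagonals at `v` one
after the other leads to an isolated diagonal. -/
lemma IsCorner.altSum_farDiagonals_eq_zero (hc : IsCorner P h v lo hi) (hs : P.IsSimple)
    (hg : P.InGeneralPosition) {t : Fin n} (htv : t ≠ v) (htlo : t ≠ lo) (hthi : t ≠ hi)
    (ht : s(v, t) ∉ P.diagonals) {S : Finset (Fin n)} (hS : ∀ x ∈ S, s(v, x) ∈ P.diagonals) :
    P.altSum (P.farDiagonals v S) = 0 := by
  induction hk : (Finset.univ \ S).card using Nat.strong_induction_on generalizing S with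
  | _ k ih =>
    rcases hc.isolated_or_insert hs hg hS htv htlo hthi (fun h => ht (hS t h)) with
      ⟨e, he, hiso⟩ | ⟨_, _, y, hyS, hy, heq, -⟩
    · exact altSum_eq_zero_of_isolated he hiso
    · rw [← heq]
      refine ih _ ?_ (fun x hx => ?_) rfl
      · rw [← hk]
        refine Finset.card_lt_card (Finset.ssubset_iff_of_subset ?_ |>.2 ⟨y, ?_, ?_⟩)
        · exact Finset.sdiff_subset_sdiff le_rfl (Finset.subset_insert _ _)
        · simpa using hyS
        · simp
      · rcases Finset.mem_insert.1 hx with rfl | hx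
        · exact hy
        · exact hS x hx

end

/-- The alternating sums of a non-convex polygon vanish: an edge of the convex hull that is no edge
of the polygon is an isolated epigonal, and no diagonal. -/
lemma altSum_eq_zero_of_not_isConvex (hs : P.IsSimple) (hg : P.InGeneralPosition)
    (hP : ¬ P.IsConvex) {D E : Finset (Sym2 (Fin n))} (hD : ∀ e, e ∈ D ↔ e ∈ P.diagonals)
    (hE : ∀ e, e ∈ E ↔ e ∈ P.epigonals) : P.altSum D = 0 ∧ P.altSum E = 0 := by
  have hne : ¬ P.HullEdgesAreEdges := fun h => hP (h.isConvex hs hg)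
  unfold HullEdgesAreEdges at hne
  push Not at hne
  obtain ⟨v, z, he, hadj⟩ := hne
  have hout := he.openSegment_subset_outside hs hg hadj
  have hvz : s(v, z) ∈ P.epigonals := ⟨⟨by simpa using he.1, fun i hi => hadj i hi.symm⟩, hout⟩
  constructor
  · obtain ⟨h, hv⟩ := (he.exists_isExtremal hs).1
    obtain ⟨lo, hi, hc⟩ := hv.exists_isCorner hs hg
    obtain ⟨h1, h2, h3⟩ := isChord_mk hvz.1
    have hzd : s(v, z) ∉ P.diagonals := by
      intro hd
      obtain ⟨q, hq⟩ : (openSegment ℝ (P v) (P z)).Nonempty := ⟨_, mem_openSegment_iff'.2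
        ⟨1 / 2, by norm_num, by norm_num, rfl⟩⟩
      exact Set.disjoint_left.1 disjoint_inside_outside (hd.2 hq) (hout hq)
    rw [hg.altSum_diagonals v hD]
    refine Finset.sum_eq_zero fun S hS => ?_
    rw [hc.altSum_farDiagonals_eq_zero hs hg h1.symm ?_ ?_ hzd, mul_zero]
    · exact fun x hx => mem_diagonalEnds.1 (Finset.mem_powerset.1 hS hx)
    · rintro rfl
      exact hc.neighbours.elim (fun h => h2 h.1) fun h => h3 h.2
    · rintro rfl
      exact hc.neighbours.elim (fun h => h3 h.2) fun h => h2 h.1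
  · refine altSum_eq_zero_of_isolated ((hE _).2 hvz) fun e' he' hne => ?_
    rw [hE] at he'
    induction e' with | h c d
    exact (he.disjoint (isChord_mk he'.1).1 hne).mono_right (openSegment_subset_segment _ _ _)

/-- In a convex polygon all chords are diagonals. The full set of diagonals at a vertex crosses
all other diagonals; for any smaller set the remaining alternating sum vanishes. -/
lemma altSum_of_isConvex (hs : P.IsSimple) (hg : P.InGeneralPosition)
    (hP : P.IsConvex) {D E : Finset (Sym2 (Fin n))} (hD : ∀ e, e ∈ D ↔ e ∈ P.diagonals)
    (hE : ∀ e, e ∈ E ↔ e ∈ P.epigonals) : P.altSum D = (-1) ^ (n - 3) ∧ P.altSum E = 1 := by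
  classical
  have ha := hP.hullEdgesAreEdges hs hg
  constructor
  · obtain ⟨h, v, hv⟩ := hs.exists_isExtremal
    obtain ⟨lo, hi, hc⟩ := hv.exists_isCorner hs hg
    set N := P.diagonalEnds v with hN
    have hmem : ∀ x, x ∈ N ↔ x ≠ v ∧ x ≠ lo ∧ x ≠ hi := by
      intro x
      rw [hN, mem_diagonalEnds]
      constructor
      · intro hx
        obtain ⟨h1, h2, h3⟩ := isChord_mk hx.1
        refine ⟨h1.symm, ?_, ?_⟩
        · rintro rfl
          exact hc.neighbours.elim (fun h => h2 h.1) fun h => h3 h.2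
        · rintro rfl
          exact hc.neighbours.elim (fun h => h3 h.2) fun h => h2 h.1
      · rintro ⟨h1, h2, h3⟩
        refine ha.isChord_mem_diagonals hs hg
          (isChord_mk_of h1.symm (fun h => ?_) fun h => ?_)
        · exact hc.neighbours.elim (fun h' => h2 (h.symm.trans h'.1))
            fun h' => h3 (h.symm.trans h'.1)
        · exact hc.neighbours.elim (fun h' => h3 ((finRotate n).injective (h.trans h'.2.symm)))
            fun h' => h2 ((finRotate n).injective (h.trans h'.2.symm))
    have hcard : N.card = n - 3 := by
      have : N = Finset.univ \ {v, lo, hi} := by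
        ext x; simp [hmem]
      rw [this, Finset.card_sdiff_of_subset (Finset.subset_univ _), Finset.card_univ,
        Fintype.card_fin, Finset.card_insert_of_notMem, Finset.card_pair hc.lo_ne_hi]
      simp [hc.lo_ne.symm, hc.hi_ne.symm]
    rw [hg.altSum_diagonals v hD, Finset.sum_eq_single N]
    · have : P.farDiagonals v N = ∅ := by
        refine Finset.eq_empty_iff_forall_notMem.2 fun e he => ?_
        rw [mem_farDiagonals] at he
        obtain ⟨hd, hve, hdis⟩ := he
        induction e with | h c d
        have hvcd : v ≠ c ∧ v ≠ d := by simpa using hve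
        obtain ⟨x, hxv, hx⟩ := ha.exists_crossing hs hg hd.1 hvcd.1 hvcd.2
        by_cases hxlh : x = lo ∨ x = hi
        · exact hx (hc.disjoint_of_diagonal hd hxlh)
        · rw [not_or] at hxlh
          exact hx (hdis x ((hmem x).2 ⟨hxv, hxlh⟩))
      rw [this, altSum_empty, hcard, mul_one]
    · intro S hS hSN
      rw [Finset.mem_powerset] at hS
      obtain ⟨t, htN, htS⟩ := Finset.exists_of_ssubset (lt_of_le_of_ne hS hSN)
      obtain ⟨h1, h2, h3⟩ := (hmem t).1 htN
      rcases hc.isolated_or_insert hs hg (fun x hx => mem_diagonalEnds.1 (hS hx)) h1 h2 h3 htS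
        with ⟨e, he, hiso⟩ | ⟨w, w', y, -, -, -, h4, h5, h6⟩
      · rw [altSum_eq_zero_of_isolated he hiso, mul_zero]
      · exact (ha.notMem_triangle hs hg h4 h5 h6).elim
    · exact fun h => absurd (Finset.mem_powerset_self N) h
  · have : E = ∅ := by
      refine Finset.eq_empty_iff_forall_notMem.2 fun e he => ?_
      rw [hE] at he
      have hd := ha.isChord_mem_diagonals hs hg he.1
      induction e with | h c d
      obtain ⟨q, hq⟩ : (openSegment ℝ (P c) (P d)).Nonempty := ⟨_, mem_openSegment_iff'.2
        ⟨1 / 2, by norm_num, by norm_num, rfl⟩⟩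
      exact Set.disjoint_left.1 disjoint_inside_outside (hd.2 hq) (he.2 hq)
    rw [this, altSum_empty]

end Polygon

end

theorem theorem1 (n : ℕ) (P : Polygon (EuclideanSpace ℝ (Fin 2)) n)
    (hsimple : P.IsSimple) (hgen : P.InGeneralPosition) :
    (P.IsConvex ↔
      ∑ i ∈ Finset.Icc 1 (n - 3), (-1 : ℤ) ^ (i + 1) * (P.count P.diagonals i : ℤ)
        = 1 + (-1 : ℤ) ^ n) ∧
    (¬ P.IsConvex ↔
      ∑ i ∈ Finset.Icc 1 (n - 3), (-1 : ℤ) ^ (i + 1) * (P.count P.diagonals i : ℤ) = 1) ∧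
    (¬ P.IsConvex ↔
      ∑ i ∈ Finset.Icc 1 (n - 3), (-1 : ℤ) ^ (i + 1) * (P.count P.epigonals i : ℤ) = 1) ∧
    (¬ P.IsConvex ↔ P.eulerChar P.diagonals = 0) ∧
    (¬ P.IsConvex ↔ P.eulerChar P.epigonals = 0) := by
  have hn := hsimple.three_le
  set D := P.diagonals.toFinite.toFinset with hDdef
  set E := P.epigonals.toFinite.toFinset with hEdef
  have hDc : (D : Set (Sym2 (Fin n))) = P.diagonals := Set.Finite.coe_toFinset _
  have hEc : (E : Set (Sym2 (Fin n))) = P.epigonals := Set.Finite.coe_toFinset _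
  have hD : ∀ e, e ∈ D ↔ e ∈ P.diagonals := fun e => Set.Finite.mem_toFinset _
  have hE : ∀ e, e ∈ E ↔ e ∈ P.epigonals := fun e => Set.Finite.mem_toFinset _
  have hsD := Polygon.sum_Icc_count_eq (P := P) D (N := n - 3) fun J hJ hJn =>
    hsimple.card_le hgen (Or.inl rfl) (hDc ▸ Finset.coe_subset.2 hJ) hJn
  have hsE := Polygon.sum_Icc_count_eq (P := P) E (N := n - 3) fun J hJ hJn =>
    hsimple.card_le hgen (Or.inr rfl) (hEc ▸ Finset.coe_subset.2 hJ) hJn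
  have hcD := Polygon.eulerChar_eq (P := P) D
  have hcE := Polygon.eulerChar_eq (P := P) E
  rw [hDc] at hsD hcD
  rw [hEc] at hsE hcE
  rw [hsD, hsE, hcD, hcE]
  have hpow : (-1 : ℤ) ^ n = -(-1) ^ (n - 3) := by
    obtain ⟨m, rfl⟩ := Nat.exists_eq_add_of_le' hn
    rw [Nat.add_sub_cancel, pow_add]; ring
  have hne : (-1 : ℤ) ^ (n - 3) ≠ 0 := pow_ne_zero _ (by norm_num)
  rw [hpow]
  by_cases hP : P.IsConvex
  · obtain ⟨h1, h2⟩ := Polygon.altSum_of_isConvex hsimple hgen hP hD hE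
    simp [hP, h1, h2, sub_eq_add_neg]
  · obtain ⟨h1, h2⟩ := Polygon.altSum_eq_zero_of_not_isConvex hsimple hgen hP hD hE
    simp [hP, h1, h2]
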